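/- **Setting.** Let $V_e,W_o:\mathbb R\to\mathbb R$ be absolutely convergent cosine series $$V_e(x)=\sum_{p\in\{0,2,4,\dots\}}v_p\cos(2\pi px),\qquad W_o(x)=\sum_{p\in\{1,3,5,\dots\}}w_p\cos(2\pi px),\qquad v_p,w_p\in\mathbb R,\ \ \sum|v_p|<\infty,\ \sum|w_p|<\infty,$$ let $\kappa_\infty>0$, and let $\kappa\in C^\infty(\mathbb R;\mathbb R)$ satisfy $\kappa(X)\to\pm\kappa_\infty$ as $X\to\pm\infty$. For $\delta>0$ consider in $L^2(\mathbb R)$, with domain $H^2(\mathbb R)$, the operators $$H_\delta=-\partial_x^2+V_e(x)+\delta\kappa(\delta x)W_o(x),\qquad H_{\delta,\pm}=-\partial_x^2+V_e(x)\pm\delta\kappa_\infty W_o(x).$$ The essential spectrum $\sigma_{\rm ess}(T)$ of a self-adjoint operator $T$ is the set of $z\in\mathbb C$ such that $T-z$ is not Fredholm. **Dirac points.** For $k\in\mathbb R$ let $L^2_k=\{f\in L^2_{\rm loc}(\mathbb R): f(x+1)=e^{ik}f(x)\}$, let $H^2_k$ be the space of $f\in L^2_k$ with weak derivatives $f',f''\in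 L^2_k$, and write $\langle f,g\rangle=\int_0^1\overline f\,g\,dx$. The operator $H=-\partial_x^2+V_e$ acts in $L^2_k$ with domain $H^2_k$; $E_1(k)\le E_2(k)\le\cdots$ are its eigenvalues, listed with multiplicity. The pair $(k_\star,E_\star)\in[0,2\pi]\times\mathbb R$ is a Dirac point of $H$ if: 1. $E_\star=E_{b_\star}(k_\star)=E_{b_\star+1}(k_\star)$ for some $b_\star\ge1$; 2. $E_\star$ is an eigenvalue of $H$ in $L^2_{k_\star}$ of multiplicity two; 3. $L^2_{k_\star}=L^2_A\oplus L^2_B$ and $H^2_{k_\star}=H^2_A\oplus H^2_B$, where $H^2_A=H^2_{k_\star}\cap L^2_A$ and $H^2_B=H^2_{k_\star}\cap L^2_B$, and $H$ maps $H^2_A$ into $L^2_A$ and $H^2_B$ into $L^2_B$; 4. there is a linear operator $\mathcal S$ on $L^2_{k_\star}$ which maps $H^2_A$ into $H^2_B$ and $H^2_B$ into $H^2_A$, with $\mathcal S^2=I$ and $H\mathcal S=\mathcal SH$ on $H^2_{k_\star}$; 5. the nullspace of $H-E_\star$ in $L^2_{k_\star}$ is spanned by functions $\Phi_1$ and $\Phi_2=\mathcal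 S\Phi_1$ with $\langle\Phi_a,\Phi_b\rangle=\delta_{ab}$; 6. there are $\lambda_\sharp\in\mathbb R\setminus\{0\}$, $\zeta_0>0$, smooth real functions $\eta_\pm$ on $(-\zeta_0,\zeta_0)$ with $\eta_\pm(0)=0$, and, for $|k-k_\star|<\zeta_0$, eigenpairs $(\Phi_\pm(\cdot;k),E_\pm(k))$ of $H$ in $L^2_k$ with $$E_\pm(k)-E_\star=\pm\lambda_\sharp(k-k_\star)\bigl(1+\eta_\pm(k-k_\star)\bigr).$$ **Proposition.** Let $(k_\star,E_\star)$ be a Dirac point of $-\partial_x^2+V_e$, with $\Phi_1,\Phi_2$ as in 5, and assume that $$\vartheta_\sharp=\langle\Phi_1,W_o\Phi_2\rangle\neq0.$$ Let $c<1$. Then there is $\delta_0>0$ such that for all $0<\delta<\delta_0$ the interval $$\mathcal I_\delta=\bigl(E_\star-c\,\delta\kappa_\infty|\vartheta_\sharp|,\ E_\star+c\,\delta\kappa_\infty|\vartheta_\sharp|\bigr)$$ satisfies $\mathcal I_\delta\cap\sigma_{\rm ess}(H_\delta)=\mathcal I_\delta\cap\sigma_{\rm ess}(H_{\delta,-})=\mathcal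 I_\delta\cap\sigma_{\rm ess}(H_{\delta,+})=\emptyset$. -/

import Mathlib

open MeasureTheory Set
open scoped ContDiff ComplexConjugate

noncomputable section

namespace DomainWall

/-! ### Potentials -/

/-- `V(x) = ∑_{p ∈ {0,2,4,…}} v_p cos(2πpx)`, a real even-index cosine series, absolutely
convergent. -/
def IsEvenCosineSeries (V : ℝ → ℝ) : Prop :=
  ∃ v : ℕ → ℝ, Summable (fun m => |v m|) ∧
    ∀ x, HasSum (fun m : ℕ => v m * Real.cos (2 * Real.pi * (2 * (m : ℝ)) * x)) (V x)

/-- `W(x) = ∑_{p ∈ {1,3,5,…}} w_p cos(2πpx)`, a real odd-index cosine series, absolutely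
convergent. -/
def IsOddCosineSeries (W : ℝ → ℝ) : Prop :=
  ∃ w : ℕ → ℝ, Summable (fun m => |w m|) ∧
    ∀ x, HasSum (fun m : ℕ => w m * Real.cos (2 * Real.pi * (2 * (m : ℝ) + 1) * x)) (W x)

/-! ### Weak derivatives -/

/-- `g` is the weak (distributional) derivative of `f` on the real line. -/
def HasWeakDeriv (f g : ℝ → ℂ) : Prop :=
  LocallyIntegrable f ∧ LocallyIntegrable g ∧
    ∀ φ : ℝ → ℝ, ContDiff ℝ ∞ φ → HasCompactSupport φ →
      ∫ x, deriv φ x • f x = -∫ x, φ x • g x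

lemma integrable_smul_of_test {f : ℝ → ℂ} (hf : LocallyIntegrable f) {φ : ℝ → ℝ}
    (hφ : Continuous φ) (hc : HasCompactSupport φ) : Integrable (fun x => φ x • f x) :=
  hf.integrable_smul_left_of_hasCompactSupport hφ hc

lemma HasWeakDeriv.congr {f g f' g' : ℝ → ℂ} (h : HasWeakDeriv f g)
    (hf : f =ᵐ[volume] f') (hg : g =ᵐ[volume] g') : HasWeakDeriv f' g' := by
  refine ⟨h.1.congr hf, h.2.1.congr hg, fun φ h1 h2 => ?_⟩
  have e1 : ∫ x, deriv φ x • f x = ∫ x, deriv φ x • f' x :=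
    integral_congr_ae (hf.mono fun x hx => by simp only [hx])
  have e2 : ∫ x, φ x • g x = ∫ x, φ x • g' x :=
    integral_congr_ae (hg.mono fun x hx => by simp only [hx])
  rw [← e1, ← e2]
  exact h.2.2 φ h1 h2

lemma HasWeakDeriv.add {f g f' g' : ℝ → ℂ} (h : HasWeakDeriv f g) (h' : HasWeakDeriv f' g') :
    HasWeakDeriv (f + f') (g + g') := by
  refine ⟨h.1.add h'.1, h.2.1.add h'.2.1, fun φ h1 h2 => ?_⟩
  have hd : Continuous (deriv φ) := h1.continuous_deriv (by simp)
  have e1 := integrable_smul_of_test h.1 hd h2.deriv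
  have e2 := integrable_smul_of_test h'.1 hd h2.deriv
  have e3 := integrable_smul_of_test h.2.1 h1.continuous h2
  have e4 := integrable_smul_of_test h'.2.1 h1.continuous h2
  simp only [Pi.add_apply, smul_add]
  rw [integral_add e1 e2, integral_add e3 e4, h.2.2 φ h1 h2, h'.2.2 φ h1 h2, neg_add]

lemma HasWeakDeriv.const_smul {f g : ℝ → ℂ} (h : HasWeakDeriv f g) (c : ℂ) :
    HasWeakDeriv (c • f) (c • g) := by
  refine ⟨h.1.smul c, h.2.1.smul c, fun φ h1 h2 => ?_⟩
  have e := h.2.2 φ h1 h2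
  simp only [Pi.smul_apply]
  simp_rw [fun x => smul_comm (deriv φ x) c (f x), fun x => smul_comm (φ x) c (g x)]
  rw [integral_smul, integral_smul, e, smul_neg]

lemma HasWeakDeriv.zero : HasWeakDeriv 0 0 :=
  ⟨locallyIntegrable_zero, locallyIntegrable_zero, fun φ _ _ => by simp⟩

lemma HasWeakDeriv.ae_eq_zero {f g : ℝ → ℂ} (h : HasWeakDeriv f g) (hf : f =ᵐ[volume] 0) :
    g =ᵐ[volume] 0 := by
  refine ae_eq_zero_of_integral_contDiff_smul_eq_zero h.2.1 fun φ h1 h2 => ?_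
  have e := h.2.2 φ h1 h2
  rw [integral_congr_ae (g := fun _ => (0 : ℂ))
    (hf.mono fun x hx => by simp [hx]), integral_zero] at e
  exact neg_eq_zero.mp e.symm

/-! ### The Schrödinger operator `-∂ₓ² + U` on a space of functions on the line -/

/-- Measurable functions on the line modulo equality almost everywhere. -/
abbrev Fn := ℝ →ₘ[volume] ℂ

section Operator

variable {Y : Type*} [AddCommGroup Y] [Module ℂ Y]

/-- `Y` is a space of functions (through `ι`). The graph consists of the pairs `(f, h)` with
`h = -f'' + U f`, where `f` has weak derivatives `f'`, `f''` in `Y`. -/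
def schrodingerGraph (ι : Y →ₗ[ℂ] Fn) (U : ℝ → ℝ) : Submodule ℂ (Y × Y) where
  carrier := {q | ∃ f₁ f₂ : Y, HasWeakDeriv (ι q.1) (ι f₁) ∧ HasWeakDeriv (ι f₁) (ι f₂) ∧
    ∀ᵐ x, ι q.2 x = -ι f₂ x + (U x : ℂ) * ι q.1 x}
  zero_mem' := by
    have h0 : ((ι 0 : Fn) : ℝ → ℂ) =ᵐ[volume] 0 := by
      rw [map_zero]; exact AEEqFun.coeFn_zero
    have hw : HasWeakDeriv (ι 0) (ι 0) := HasWeakDeriv.zero.congr h0.symm h0.symm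
    refine ⟨0, 0, hw, hw, ?_⟩
    filter_upwards [h0] with x hx
    simp only [Pi.zero_apply, Prod.fst_zero, Prod.snd_zero] at hx ⊢
    rw [hx]; simp
  add_mem' := by
    rintro ⟨f, h⟩ ⟨f', h'⟩ ⟨a, b, h1, h2, h3⟩ ⟨a', b', h1', h2', h3'⟩
    have hadd : ∀ u v : Y, (ι u : ℝ → ℂ) + (ι v : ℝ → ℂ) =ᵐ[volume] ι (u + v) := fun u v => by
      rw [map_add]; exact (AEEqFun.coeFn_add _ _).symm
    refine ⟨a + a', b + b', (h1.add h1').congr (hadd _ _) (hadd _ _),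
      (h2.add h2').congr (hadd _ _) (hadd _ _), ?_⟩
    filter_upwards [h3, h3', hadd f f', hadd h h', hadd b b'] with x e1 e2 e3 e4 e5
    simp only [Pi.add_apply, Prod.mk_add_mk] at *
    rw [← e3, ← e4, ← e5, e1, e2]; ring
  smul_mem' := by
    rintro c ⟨f, h⟩ ⟨a, b, h1, h2, h3⟩
    have hs : ∀ u : Y, c • (ι u : ℝ → ℂ) =ᵐ[volume] ι (c • u) := fun u => by
      rw [map_smul]; exact (AEEqFun.coeFn_smul _ _).symm
    refine ⟨c • a, c • b, (h1.const_smul c).congr (hs _) (hs _),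
      (h2.const_smul c).congr (hs _) (hs _), ?_⟩
    filter_upwards [h3, hs f, hs h, hs b] with x e1 e2 e3 e4
    simp only [Pi.smul_apply, Prod.smul_mk, smul_eq_mul] at *
    rw [← e2, ← e3, ← e4, e1]; ring

/-- The operator `f ↦ -f'' + U f` in `Y`, with domain the `f ∈ Y` whose weak derivatives
`f'`, `f''` and whose image `-f'' + U f` lie in `Y`. -/
def schrodingerOn (ι : Y →ₗ[ℂ] Fn) (U : ℝ → ℝ) : Y →ₗ.[ℂ] Y :=
  (schrodingerGraph ι U).toLinearPMap

/-- `T - z` on the domain of `T`. -/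
def shifted (T : Y →ₗ.[ℂ] Y) (z : ℂ) : T.domain →ₗ[ℂ] Y := T.toFun - z • T.domain.subtype

/-- The graph is single valued, so `schrodingerOn` is the operator with this graph. -/
lemma schrodingerOn_graph (ι : Y →ₗ[ℂ] Fn) (hι : Function.Injective ι) (U : ℝ → ℝ) :
    (schrodingerOn ι U).graph = schrodingerGraph ι U := by
  refine Submodule.toLinearPMap_graph_eq _ ?_
  rintro ⟨f, h⟩ ⟨a, b, h1, h2, h3⟩ (hf : f = 0)
  subst hf
  have h0 : ((ι 0 : Fn) : ℝ → ℂ) =ᵐ[volume] 0 := by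
    rw [map_zero]; exact AEEqFun.coeFn_zero
  have hb := h2.ae_eq_zero (h1.ae_eq_zero h0)
  apply hι
  rw [map_zero]
  refine AEEqFun.ext ?_
  filter_upwards [h3, h0, hb, AEEqFun.coeFn_zero (α := ℝ) (β := ℂ) (μ := volume)]
    with x e1 e2 e3 e4
  simp only [Pi.zero_apply] at e1 e2 e3 e4
  rw [e1, e2, e3, e4]; simp

end Operator

/-! ### The operators on `L²(ℝ)` and the essential spectrum -/

/-- `L²(ℝ; ℂ)`. -/
abbrev L2R := Lp ℂ 2 (volume : Measure ℝ)

/-- The inclusion of `L²(ℝ)` into the measurable functions. -/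
def L2R.incl : L2R →ₗ[ℂ] Fn where
  toFun f := f.1
  map_add' _ _ := rfl
  map_smul' _ _ := rfl

/-- `-∂ₓ² + U` acting in `L²(ℝ)`. Its domain is `H²(ℝ)` when `U` is bounded and measurable. -/
def lineOp (U : ℝ → ℝ) : L2R →ₗ.[ℂ] L2R := schrodingerOn L2R.incl U

/-- The essential spectrum of a (self-adjoint) operator `T`: the `z` for which `T - z` is not
Fredholm, i.e. does not have finite-dimensional kernel and closed range of finite codimension. -/
def essentialSpectrum {X : Type*} [NormedAddCommGroup X] [NormedSpace ℂ X] (T : X →ₗ.[ℂ] X) :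
    Set ℂ :=
  {z | ¬ (FiniteDimensional ℂ (LinearMap.ker (shifted T z)) ∧
    IsClosed (LinearMap.range (shifted T z) : Set X) ∧
    FiniteDimensional ℂ (X ⧸ LinearMap.range (shifted T z)))}

/-- `H_δ = -∂ₓ² + V(x) + δ κ(δx) W(x)`. -/
def domainWallOp (V W κ : ℝ → ℝ) (δ : ℝ) : L2R →ₗ.[ℂ] L2R :=
  lineOp (fun x => V x + δ * κ (δ * x) * W x)

/-- `H_{δ,+} = -∂ₓ² + V + δ κ_∞ W`. -/
def asympOpPlus (V W : ℝ → ℝ) (κinf δ : ℝ) : L2R →ₗ.[ℂ] L2R :=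
  lineOp (fun x => V x + δ * κinf * W x)

/-- `H_{δ,-} = -∂ₓ² + V - δ κ_∞ W`. -/
def asympOpMinus (V W : ℝ → ℝ) (κinf δ : ℝ) : L2R →ₗ.[ℂ] L2R :=
  lineOp (fun x => V x - δ * κinf * W x)

/-! ### Pseudo-periodic functions and Dirac points -/

/-- `L²_k`: the `f ∈ L²_loc(ℝ)` with `f(x + 1) = e^{ik} f(x)`. -/
def L2k (k : ℝ) : Submodule ℂ Fn where
  carrier := {f | (∀ a b : ℝ, MemLp f 2 (volume.restrict (Icc a b))) ∧
    ∀ᵐ x, f (x + 1) = Complex.exp (Complex.I * k) * f x}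
  zero_mem' := by
    have h0 : ((0 : Fn) : ℝ → ℂ) =ᵐ[volume] 0 := AEEqFun.coeFn_zero
    refine ⟨fun a b => (memLp_congr_ae (ae_restrict_of_ae h0)).mpr MemLp.zero, ?_⟩
    filter_upwards [h0, (measurePreserving_add_right volume (1 : ℝ)).quasiMeasurePreserving.ae h0]
      with x e1 e2
    simp only [Pi.zero_apply] at e1 e2
    rw [e1, e2, mul_zero]
  add_mem' := by
    rintro f g ⟨hf, hf'⟩ ⟨hg, hg'⟩
    have h0 : ((f + g : Fn) : ℝ → ℂ) =ᵐ[volume] f + g := AEEqFun.coeFn_add f g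
    refine ⟨fun a b => (memLp_congr_ae (ae_restrict_of_ae h0)).mpr ((hf a b).add (hg a b)), ?_⟩
    filter_upwards [h0, (measurePreserving_add_right volume (1 : ℝ)).quasiMeasurePreserving.ae h0,
      hf', hg'] with x e1 e2 e3 e4
    simp only [Pi.add_apply] at e1 e2
    rw [e1, e2, e3, e4]; ring
  smul_mem' := by
    rintro c f ⟨hf, hf'⟩
    have h0 : ((c • f : Fn) : ℝ → ℂ) =ᵐ[volume] c • (f : ℝ → ℂ) := AEEqFun.coeFn_smul c f
    refine ⟨fun a b => (memLp_congr_ae (ae_restrict_of_ae h0)).mpr ((hf a b).const_smul c), ?_⟩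
    filter_upwards [h0, (measurePreserving_add_right volume (1 : ℝ)).quasiMeasurePreserving.ae h0,
      hf'] with x e1 e2 e3
    simp only [Pi.smul_apply, smul_eq_mul] at e1 e2
    rw [e1, e2, e3]; ring

/-- `-∂ₓ² + V` acting in `L²_k`. Its domain is `H²_k` for `V` bounded, measurable, one-periodic. -/
def hillOp (V : ℝ → ℝ) (k : ℝ) : L2k k →ₗ.[ℂ] L2k k := schrodingerOn (L2k k).subtype V

/-- The `L²_k` nullspace of `-∂ₓ² + V - E`. -/
def blochSpace (V : ℝ → ℝ) (k E : ℝ) : Submodule ℂ (L2k k) :=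
  (LinearMap.ker (shifted (hillOp V k) E)).map
    (hillOp V k).domain.subtype

/-- `E_b(k)` for `b = 1, 2, …`: the `b`-th eigenvalue of `-∂ₓ² + V` in `L²_k`, in increasing order
and listed with multiplicity, i.e. the least `t` such that the eigenspaces with eigenvalue at
most `t` span a space of dimension at least `b`. -/
def band (V : ℝ → ℝ) (b : ℕ) (k : ℝ) : ℝ :=
  sInf {t : ℝ | (b : Cardinal) ≤ Module.rank ℂ (⨆ E : Iic t, blochSpace V k E : Submodule ℂ (L2k k))}

/-- `⟨f, g⟩ = ∫₀¹ f̄ g` in `L²[0,1]`. -/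
def cellInner (f g : ℝ → ℂ) : ℂ := ∫ x in (0 : ℝ)..1, conj (f x) * g x

/-- `(k, E)` is a Dirac point of `-∂ₓ² + V`, with all the data that go with it. -/
structure DiracPoint (V : ℝ → ℝ) (k E : ℝ) where
  k_mem : k ∈ Icc 0 (2 * Real.pi)
  /-- `E` is the energy of two consecutive bands at `k`. -/
  b : ℕ
  one_le_b : 1 ≤ b
  band_eq : band V b k = E
  band_succ_eq : band V (b + 1) k = E
  /-- `E` is an `L²_k` eigenvalue of multiplicity two. -/
  multiplicity : Module.finrank ℂ (blochSpace V k E) = 2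
  /-- `L²_k = L²_A ⊕ L²_B` and `H²_k = H²_A ⊕ H²_B`, where `H²_A = H²_k ∩ L²_A` and likewise for
  `B`, and both summands are invariant under the operator. -/
  A : Submodule ℂ (L2k k)
  B : Submodule ℂ (L2k k)
  isCompl : IsCompl A B
  domain_eq : ((hillOp V k).domain ⊓ A) ⊔ ((hillOp V k).domain ⊓ B) = (hillOp V k).domain
  map_A : ∀ f : (hillOp V k).domain, (f : L2k k) ∈ A → hillOp V k f ∈ A
  map_B : ∀ f : (hillOp V k).domain, (f : L2k k) ∈ B → hillOp V k f ∈ B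
  /-- The symmetry `S`, an involution which exchanges `H²_A` and `H²_B` and commutes with the
  operator. -/
  S : L2k k →ₗ[ℂ] L2k k
  S_A : ∀ f ∈ (hillOp V k).domain ⊓ A, S f ∈ (hillOp V k).domain ⊓ B
  S_B : ∀ f ∈ (hillOp V k).domain ⊓ B, S f ∈ (hillOp V k).domain ⊓ A
  S_invol : ∀ f ∈ (hillOp V k).domain, S (S f) = f
  S_comm : ∀ f g : (hillOp V k).domain, (g : L2k k) = S f → hillOp V k g = S (hillOp V k f)
  /-- The basis `Φ₁`, `Φ₂ = S Φ₁` of the nullspace, orthonormal in `L²[0,1]`. -/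
  Φ₁ : L2k k
  Φ₂ : L2k k
  Φ₂_eq : Φ₂ = S Φ₁
  span_eq : Submodule.span ℂ {Φ₁, Φ₂} = blochSpace V k E
  inner₁₁ : cellInner Φ₁.1 Φ₁.1 = 1
  inner₂₂ : cellInner Φ₂.1 Φ₂.1 = 1
  inner₁₂ : cellInner Φ₁.1 Φ₂.1 = 0
  /-- Two branches of Floquet-Bloch eigenpairs which cross linearly. -/
  lam : ℝ
  lam_ne : lam ≠ 0
  ζ₀ : ℝ
  ζ₀_pos : 0 < ζ₀
  Eplus : ℝ → ℝ
  Eminus : ℝ → ℝ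
  Φplus : (l : ℝ) → L2k l
  Φminus : (l : ℝ) → L2k l
  pair_plus : ∀ l, |l - k| < ζ₀ → Φplus l ≠ 0 ∧ Φplus l ∈ blochSpace V l (Eplus l)
  pair_minus : ∀ l, |l - k| < ζ₀ → Φminus l ≠ 0 ∧ Φminus l ∈ blochSpace V l (Eminus l)
  ηplus : ℝ → ℝ
  ηminus : ℝ → ℝ
  ηplus_smooth : ContDiffOn ℝ ∞ ηplus (Ioo (-ζ₀) ζ₀)
  ηminus_smooth : ContDiffOn ℝ ∞ ηminus (Ioo (-ζ₀) ζ₀)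
  ηplus_zero : ηplus 0 = 0
  ηminus_zero : ηminus 0 = 0
  crossing_plus : ∀ l, |l - k| < ζ₀ → Eplus l - E = lam * (l - k) * (1 + ηplus (l - k))
  crossing_minus : ∀ l, |l - k| < ζ₀ → Eminus l - E = -(lam * (l - k) * (1 + ηminus (l - k)))

/-- `ϑ_♯ = ⟨Φ₁, W Φ₂⟩` in `L²[0,1]`. -/
def DiracPoint.theta {V : ℝ → ℝ} {k E : ℝ} (D : DiracPoint V k E) (W : ℝ → ℝ) : ℂ :=
  cellInner D.Φ₁.1 (fun x => (W x : ℂ) * D.Φ₂.1 x)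

end DomainWall

end

/-! Everything is done with the ordinary differential equation `f'' = (U - x) f - h`. At a Dirac
point all solutions of `u'' = (V - E) u` are bounded: `Φ₁` and `Φ₂` are independent solutions with a
common Floquet multiplier `μ`, and constancy of the Wronskian forces `μ² = 1`
(`DiracPoint.exists_frame`). Variation of constants, `f = u c₁ + v c₂` and `f' = u' c₁ + v' c₂`,
turns the equation with potential `V - E + ρ` into `c' = ρ N c + g`, where `N` is a one-periodic
matrix of rank one (`PeriodicFrame.locallySolvable`).

Let `ρ` be close to `δ p` with `p = κ W - s`, `κ = ±κ_∞` and `x = E + δ s`. The amplitudes then vary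
slowly, and to leading order they obey the averaged system `c' = δ A c`. Here `A² = a²` with `|w|²
a² = κ² X² + κ² |θ|² - s²`, `w` being the Wronskian and `X = ⟨Φ₁, W Φ₁⟩`. The right-hand side is
minus the determinant of the Hermitian Gram matrix of `κ W - s`; the Gram matrix of `W` has trace
zero because the half-period shift acts unitarily on the solutions and reverses the sign of `W`
(`trace_eq_zero`, `exists_average_average`). Since `|s| ≤ c κ_∞ |θ|` with `c < 1`, `a` is bounded
away from zero: the averaged system has eigenvalues `±δ a` and is solvable in `L²` with an inverse
of size `1/δ`. The substitution `c = (1 + δ S) d` with `S' = p N - A` removes the oscillation up to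
an error `O(δ²) + O(δ ε)`, and a Neumann series solves the true system (`exists_solution_operator`,
`exists_threshold`). The outcome is `DiracPoint.exists_locallySolvable`, uniform over the energy
interval.

For the essential spectrum (`notMem_essentialSpectrum`), the domain-wall potential agrees far out on
each side with one that is close to an asymptotic potential on the whole line, and bounded intervals
are never an obstruction (`locallySolvable_Icc`). Solutions on the three pieces glue as soon as
values and derivatives match at the two junctions. The range therefore contains the kernel of four
bounded functionals, so it is closed of finite codimension, while the nullspace consists of
solutions of a second-order equation and is finite-dimensional. -/

namespace DomainWall

/-! ### Absolutely continuous functions, expressed as primitives. -/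

section Primitive

variable {E F G : Type*} [NormedAddCommGroup E] [NormedSpace ℝ E]
  [NormedAddCommGroup F] [NormedSpace ℝ F] [NormedAddCommGroup G] [NormedSpace ℝ G]

/-- `u` is a primitive of `f` on `I`. -/
def IsPrimitiveOn (I : Set ℝ) (u f : ℝ → E) : Prop :=
  ∀ x ∈ I, ∀ y ∈ I, IntervalIntegrable f volume x y ∧ u y - u x = ∫ t in x..y, f t

variable {I J : Set ℝ} {u f v g : ℝ → E}

lemma IsPrimitiveOn.mono (h : IsPrimitiveOn I u f) (hJ : J ⊆ I) : IsPrimitiveOn J u f :=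
  fun x hx y hy => h x (hJ hx) y (hJ hy)

lemma IsPrimitiveOn.add (h : IsPrimitiveOn I u f) (h' : IsPrimitiveOn I v g) :
    IsPrimitiveOn I (fun x => u x + v x) (fun x => f x + g x) := by
  intro x hx y hy
  obtain ⟨h1, h2⟩ := h x hx y hy
  obtain ⟨h1', h2'⟩ := h' x hx y hy
  refine ⟨h1.add h1', ?_⟩
  rw [intervalIntegral.integral_add h1 h1', ← h2, ← h2', add_sub_add_comm]

lemma IsPrimitiveOn.neg (h : IsPrimitiveOn I u f) :
    IsPrimitiveOn I (fun x => -u x) (fun x => -f x) := by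
  intro x hx y hy
  obtain ⟨h1, h2⟩ := h x hx y hy
  refine ⟨h1.neg, ?_⟩
  rw [intervalIntegral.integral_neg, ← h2, neg_sub_neg, neg_sub]

lemma IsPrimitiveOn.clm [CompleteSpace E] [CompleteSpace F] (h : IsPrimitiveOn I u f)
    (L : E →L[ℝ] F) : IsPrimitiveOn I (fun x => L (u x)) (fun x => L (f x)) := by
  intro x hx y hy
  obtain ⟨h1, h2⟩ := h x hx y hy
  refine ⟨⟨L.integrable_comp h1.1, L.integrable_comp h1.2⟩, ?_⟩
  rw [L.intervalIntegral_comp_comm h1, ← h2, map_sub]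

lemma IsPrimitiveOn.congr (hI : I.OrdConnected) (h : IsPrimitiveOn I u f)
    (hu : ∀ x ∈ I, u x = v x) (hf : ∀ᵐ x, x ∈ I → f x = g x) : IsPrimitiveOn I v g := by
  intro x hx y hy
  obtain ⟨h1, h2⟩ := h x hx y hy
  have key : ∀ᵐ t, t ∈ uIoc x y → f t = g t := by
    filter_upwards [hf] with t ht ht'
    exact ht (hI.uIcc_subset hx hy (uIoc_subset_uIcc ht'))
  refine ⟨h1.congr_ae ((ae_restrict_iff' measurableSet_uIoc).2 key), ?_⟩
  rw [← hu x hx, ← hu y hy, h2]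
  exact intervalIntegral.integral_congr_ae key

lemma IsPrimitiveOn.continuousOn_uIcc (h : IsPrimitiveOn I u f) {a b : ℝ} (hab : uIcc a b ⊆ I) :
    ContinuousOn u (uIcc a b) := by
  have ha := hab left_mem_uIcc
  have hb := hab right_mem_uIcc
  have h1 := intervalIntegral.continuousOn_primitive_interval (a := a) (b := b) (f := f)
    (μ := volume) ?_
  · refine (h1.add (continuousOn_const (c := u a))).congr ?_
    intro x hx
    change u x = (∫ t in a..x, f t) + u a
    rw [← (h a ha x (hab hx)).2, sub_add_cancel]
  · rw [uIcc, integrableOn_Icc_iff_integrableOn_Ioc]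
    exact (intervalIntegrable_iff.1 (h a ha b hb).1)

lemma IsPrimitiveOn.continuous (h : IsPrimitiveOn univ u f) : Continuous u := by
  rw [continuous_iff_continuousAt]
  intro x
  have := h.continuousOn_uIcc (a := x - 1) (b := x + 1) (subset_univ _)
  refine this.continuousAt ?_
  rw [uIcc_of_le (by linarith)]
  exact Icc_mem_nhds (by linarith) (by linarith)

lemma IsPrimitiveOn.locallyIntegrable (h : IsPrimitiveOn univ u f) : LocallyIntegrable f := by
  rw [MeasureTheory.locallyIntegrable_iff]
  intro K hK
  obtain ⟨a, ha⟩ := hK.bddBelow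
  obtain ⟨b, hb⟩ := hK.bddAbove
  rcases K.eq_empty_or_nonempty with rfl | ⟨x, hx⟩
  · exact integrableOn_empty
  have hab : a ≤ b := (ha hx).trans (hb hx)
  have := (intervalIntegrable_iff_integrableOn_Icc_of_le hab).1 (h a trivial b trivial).1
  exact this.mono_set fun y hy => ⟨ha hy, hb hy⟩

lemma isPrimitiveOn_of_hasDerivAt [CompleteSpace E] (h : ∀ x, HasDerivAt u (f x) x)
    (hf : Continuous f) :
    IsPrimitiveOn univ u f := fun x _ y _ =>
  ⟨hf.intervalIntegrable x y, (intervalIntegral.integral_eq_sub_of_hasDerivAt (fun t _ => h t)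
    (hf.intervalIntegrable x y)).symm⟩

lemma IsPrimitiveOn.hasDerivAt [CompleteSpace E] (h : IsPrimitiveOn univ u f) (hf : Continuous f)
    (x : ℝ) :
    HasDerivAt u (f x) x := by
  have h1 := intervalIntegral.integral_hasDerivAt_right (hf.intervalIntegrable x x)
    (hf.stronglyMeasurableAtFilter _ _) hf.continuousAt
  have h2 := h1.add_const (u x)
  refine h2.congr_of_eventuallyEq (Filter.Eventually.of_forall fun y => ?_)
  have := (h x trivial y trivial).2
  simp only [← this]
  abel

lemma isPrimitiveOn_integral (hf : ∀ a b, IntervalIntegrable f volume a b) (a : ℝ) :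
    IsPrimitiveOn univ (fun x => ∫ t in a..x, f t) f := fun x _ y _ =>
  ⟨hf x y, intervalIntegral.integral_interval_sub_left (hf _ _) (hf _ _)⟩

lemma IsPrimitiveOn.comp_neg (h : IsPrimitiveOn univ u f) :
    IsPrimitiveOn univ (fun x => u (-x)) (fun x => -f (-x)) := by
  intro x _ y _
  obtain ⟨h1, h2⟩ := h (-x) trivial (-y) trivial
  refine ⟨?_, ?_⟩
  · exact (by simpa using (IntervalIntegrable.iff_comp_neg (f := f) (by simp)).1 h1 : IntervalIntegrable (fun t => f (-t)) volume x y).neg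
  · rw [intervalIntegral.integral_neg, intervalIntegral.integral_comp_neg, h2,
      intervalIntegral.integral_symm]

/-- Two primitives which agree at `a` glue to a primitive. -/
lemma IsPrimitiveOn.glue (hI : I.OrdConnected) {a : ℝ} (ha : a ∈ I)
    (h : IsPrimitiveOn (I ∩ Iic a) u f) (h' : IsPrimitiveOn (I ∩ Ici a) v g) (huv : u a = v a) :
    IsPrimitiveOn I ((Iic a).piecewise u v) ((Iic a).piecewise f g) := by
  set U := (Iic a).piecewise u v
  set Φ := (Iic a).piecewise f g
  have h1 : IsPrimitiveOn (I ∩ Iic a) U Φ :=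
    h.congr (hI.inter ordConnected_Iic)
      (fun x hx => (piecewise_eq_of_mem _ _ _ hx.2).symm)
      (Filter.Eventually.of_forall fun x hx => (piecewise_eq_of_mem _ _ _ hx.2).symm)
  have h2 : IsPrimitiveOn (I ∩ Ici a) U Φ := by
    refine h'.congr (hI.inter ordConnected_Ici) (fun x hx => ?_) ?_
    · rcases eq_or_lt_of_le (show a ≤ x from hx.2) with rfl | hlt
      · simp [U, huv]
      · exact (piecewise_eq_of_notMem _ _ _ (by simpa using hlt)).symm
    -- At `a` itself the glued integrand takes the left value; a single point is a null set.
    · have : ∀ᵐ x : ℝ, x ≠ a := by simp [ae_iff]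
      filter_upwards [this] with x hxa hx
      exact (piecewise_eq_of_notMem _ _ _ (by
        simpa using lt_of_le_of_ne hx.2 (Ne.symm hxa))).symm
  have key : ∀ x ∈ I, IntervalIntegrable Φ volume a x ∧ U x - U a = ∫ t in a..x, Φ t := by
    intro x hx
    rcases le_total x a with hxa | hxa
    · exact h1 a ⟨ha, le_refl a⟩ x ⟨hx, hxa⟩
    · exact h2 a ⟨ha, le_refl a⟩ x ⟨hx, hxa⟩
  intro x hx y hy
  obtain ⟨i1, e1⟩ := key x hx
  obtain ⟨i2, e2⟩ := key y hy
  refine ⟨i1.symm.trans i2, ?_⟩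
  rw [← intervalIntegral.integral_interval_sub_left i2 i1, ← e1, ← e2]
  abel

lemma IsPrimitiveOn.ae_hasDerivAt [CompleteSpace E] (h : IsPrimitiveOn univ u f) :
    ∀ᵐ t, HasDerivAt u (f t) t := by
  filter_upwards [LocallyIntegrable.ae_hasDerivAt_integral h.locallyIntegrable] with t ht
  refine ((ht 0).add_const (u 0)).congr_of_eventuallyEq
    (Filter.Eventually.of_forall fun s => ?_)
  simp only [← (h 0 trivial s trivial).2, sub_add_cancel]

/-- Increments of `u` are dominated by those of the primitive of `‖f‖`, which is absolutely
continuous. -/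
lemma absolutelyContinuousOnInterval_of_isPrimitiveOn (h : IsPrimitiveOn univ u f) (a b : ℝ) :
    AbsolutelyContinuousOnInterval u a b := by
  have hn : IntervalIntegrable (fun t => ‖f t‖) volume a b := (h a trivial b trivial).1.norm
  have h0 := hn.absolutelyContinuousOnInterval_intervalIntegral (c := a) left_mem_uIcc
  unfold AbsolutelyContinuousOnInterval at h0 ⊢
  refine squeeze_zero (fun E => Finset.sum_nonneg fun _ _ => dist_nonneg) (fun E => ?_) h0
  refine Finset.sum_le_sum fun i _ => ?_
  have hi : ∀ c d, IntervalIntegrable (fun t => ‖f t‖) volume c d := fun c d =>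
    (h c trivial d trivial).1.norm
  rw [dist_comm, dist_eq_norm, (h _ trivial _ trivial).2, dist_comm, Real.dist_eq,
    intervalIntegral.integral_interval_sub_left (hi _ _) (hi _ _)]
  exact intervalIntegral.norm_integral_le_abs_integral_norm

lemma absolutelyContinuousOnInterval_bilinear {B : E × F → G} (hB : IsBoundedBilinearMap ℝ B)
    {p : ℝ → E} {q : ℝ → F} {a b : ℝ} (hp : AbsolutelyContinuousOnInterval p a b)
    (hq : AbsolutelyContinuousOnInterval q a b) :
    AbsolutelyContinuousOnInterval (fun x => B (p x, q x)) a b := by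
  obtain ⟨C, hC⟩ := hp.exists_bound
  obtain ⟨D, hD⟩ := hq.exists_bound
  obtain ⟨K, hK0, hK⟩ := hB.bound
  unfold AbsolutelyContinuousOnInterval at hp hq
  apply squeeze_zero' ?_ ?_
    (by simpa using (hq.const_mul (K * C)).add (hp.const_mul (K * D)))
  · exact Filter.Eventually.of_forall <| fun _ => Finset.sum_nonneg (fun i hi => dist_nonneg)
  rw [Filter.eventually_inf_principal]
  filter_upwards with (n, T) hT
  simp only [Finset.mul_sum, ← Finset.sum_add_distrib]
  refine Finset.sum_le_sum fun i hi => ?_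
  obtain ⟨h1, h2⟩ := hT.1 i hi
  -- The increment of the product is split so that each term has one bounded factor and one
  -- increment.
  have e : B (p (T i).1, q (T i).1) - B (p (T i).2, q (T i).2)
      = B (p (T i).1, q (T i).1 - q (T i).2) + B (p (T i).1 - p (T i).2, q (T i).2) := by
    rw [hB.map_sub_left, hB.map_sub_right]; abel
  rw [dist_eq_norm, dist_eq_norm, dist_eq_norm, e]
  refine (norm_add_le _ _).trans (add_le_add ((hK _ _).trans ?_) ((hK _ _).trans ?_))
  · gcongr
    exact hC _ h1
  · calc K * ‖p (T i).1 - p (T i).2‖ * ‖q (T i).2‖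
        = K * ‖q (T i).2‖ * ‖p (T i).1 - p (T i).2‖ := by ring
      _ ≤ _ := by gcongr; exact hD _ h2

/-- The product rule for primitives. -/
lemma IsPrimitiveOn.bilinear [CompleteSpace E] [CompleteSpace F] [CompleteSpace G]
    {B : E × F → G} (hB : IsBoundedBilinearMap ℝ B) {p p' : ℝ → E}
    {q q' : ℝ → F} (hp : IsPrimitiveOn univ p p') (hq : IsPrimitiveOn univ q q') :
    IsPrimitiveOn univ (fun x => B (p x, q x)) (fun x => B (p' x, q x) + B (p x, q' x)) := by
  intro x _ y _
  obtain ⟨K, hK0, hK⟩ := hB.bound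
  have hBc : Continuous B := hB.continuous
  have hint : ∀ a b, IntervalIntegrable (fun x => B (p' x, q x) + B (p x, q' x)) volume a b := by
    intro a b
    have i1 := (hp a trivial b trivial).1
    have i2 := (hq a trivial b trivial).1
    obtain ⟨C, hC⟩ := (absolutelyContinuousOnInterval_of_isPrimitiveOn hp a b).exists_bound
    obtain ⟨D, hD⟩ := (absolutelyContinuousOnInterval_of_isPrimitiveOn hq a b).exists_bound
    rw [intervalIntegrable_iff] at i1 i2 ⊢
    refine Integrable.add ?_ ?_
    · refine (i1.norm.const_mul (K * D)).mono' ?_ ?_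
      · exact hBc.comp_aestronglyMeasurable
          (i1.aestronglyMeasurable.prodMk hq.continuous.aestronglyMeasurable)
      · refine (ae_restrict_iff' measurableSet_uIoc).2 (Filter.Eventually.of_forall fun t ht => ?_)
        refine (hK _ _).trans ?_
        have := hD t (uIoc_subset_uIcc ht)
        calc K * ‖p' t‖ * ‖q t‖ = K * ‖q t‖ * ‖p' t‖ := by ring
          _ ≤ _ := by gcongr
    · refine (i2.norm.const_mul (K * C)).mono' ?_ ?_
      · exact hBc.comp_aestronglyMeasurable
          (hp.continuous.aestronglyMeasurable.prodMk i2.aestronglyMeasurable)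
      · refine (ae_restrict_iff' measurableSet_uIoc).2 (Filter.Eventually.of_forall fun t ht => ?_)
        refine (hK _ _).trans ?_
        have := hC t (uIoc_subset_uIcc ht)
        gcongr
  refine ⟨hint x y, ?_⟩
  have hprim := isPrimitiveOn_integral hint x
  -- The product minus the integral of its expected derivative is absolutely continuous with
  -- derivative zero almost everywhere, hence constant.
  have hac := (absolutelyContinuousOnInterval_bilinear hB
    (absolutelyContinuousOnInterval_of_isPrimitiveOn hp x y)
    (absolutelyContinuousOnInterval_of_isPrimitiveOn hq x y)).sub
    (absolutelyContinuousOnInterval_of_isPrimitiveOn hprim x y)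
  obtain ⟨c, hc⟩ := hac.const_of_ae_hasDerivAt_zero (by
    filter_upwards [hp.ae_hasDerivAt, hq.ae_hasDerivAt, hprim.ae_hasDerivAt] with t h1 h2 h3 _
    have h4 := (hB.hasFDerivAt (p t, q t)).comp_hasDerivAt t (h1.prodMk h2)
    have e : (0 : G) = hB.deriv (p t, q t) (p' t, q' t) - (B (p' t, q t) + B (p t, q' t)) := by
      rw [hB.deriv_apply, add_comm, sub_self]
    rw [e]
    exact h4.sub h3)
  have hx := hc x left_mem_uIcc
  have hy := hc y right_mem_uIcc
  simp only [Pi.sub_apply, intervalIntegral.integral_same, sub_zero] at hx hy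
  beta_reduce
  rw [hx, ← hy, sub_sub_cancel]

lemma IsPrimitiveOn.smul {𝕜 : Type*} [NormedField 𝕜] [NormedAlgebra ℝ 𝕜] [CompleteSpace 𝕜]
    [CompleteSpace E] [NormedSpace 𝕜 E] [IsScalarTower ℝ 𝕜 E] {p p' : ℝ → 𝕜}
    (hp : IsPrimitiveOn univ p p') (h : IsPrimitiveOn univ u f) :
    IsPrimitiveOn univ (fun x => p x • u x) (fun x => p' x • u x + p x • f x) :=
  IsPrimitiveOn.bilinear (B := fun q : 𝕜 × E => q.1 • q.2) isBoundedBilinearMap_smul hp h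

lemma isBoundedBilinearMap_complex_apply {E F : Type*} [NormedAddCommGroup E] [NormedSpace ℂ E]
    [NormedAddCommGroup F] [NormedSpace ℂ F] :
    IsBoundedBilinearMap ℝ (fun q : (E →L[ℂ] F) × E => q.1 q.2) where
  add_left _ _ _ := rfl
  smul_left _ _ _ := rfl
  add_right _ _ _ := map_add _ _ _
  smul_right c x y := by
    change x (c • y) = c • x y
    rw [← Complex.coe_smul, map_smul, Complex.coe_smul]
  bound := ⟨1, one_pos, fun x y => by simpa using x.le_opNorm y⟩

lemma IsPrimitiveOn.apply {E F : Type*} [NormedAddCommGroup E] [NormedSpace ℂ E] [CompleteSpace E]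
    [NormedAddCommGroup F] [NormedSpace ℂ F] [CompleteSpace F] {T T' : ℝ → E →L[ℂ] F}
    {u f : ℝ → E} (hT : IsPrimitiveOn univ T T') (h : IsPrimitiveOn univ u f) :
    IsPrimitiveOn univ (fun x => T x (u x)) (fun x => T' x (u x) + T x (f x)) :=
  IsPrimitiveOn.bilinear (B := fun q : (E →L[ℂ] F) × E => q.1 q.2)
    isBoundedBilinearMap_complex_apply hT h

end Primitive

/-! ### Weak derivatives and primitives -/

/-- Integration by parts: `φ u` is a primitive of `φ' u + φ f`, and it vanishes at both ends of an
interval containing the support of `φ`. -/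
lemma IsPrimitiveOn.hasWeakDeriv {u f : ℝ → ℂ} (h : IsPrimitiveOn univ u f) :
    HasWeakDeriv u f := by
  refine ⟨h.continuous.locallyIntegrable, h.locallyIntegrable, fun φ h1 h2 => ?_⟩
  have hd : Continuous (deriv φ) := h1.continuous_deriv (by simp)
  have hp : IsPrimitiveOn univ φ (deriv φ) := isPrimitiveOn_of_hasDerivAt
    (fun x => (h1.differentiable (by simp) x).hasDerivAt) hd
  have hprod := hp.smul h
  have i1 := integrable_smul_of_test h.continuous.locallyIntegrable hd h2.deriv
  have i2 := integrable_smul_of_test h.locallyIntegrable h1.continuous h2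
  rw [eq_neg_iff_add_eq_zero, ← integral_add i1 i2]
  obtain ⟨R, hR⟩ := h2.isBounded.subset_closedBall 0
  have hz : ∀ x, R < |x| → φ x = 0 := fun x hx => by
    by_contra hne
    have := hR (subset_tsupport φ hne)
    rw [mem_closedBall_zero_iff, Real.norm_eq_abs] at this
    linarith
  set a := |R| + 1
  have ha : R < a := (le_abs_self R).trans_lt (lt_add_one _)
  have ha0 : 0 < a := by positivity
  have hsupp : Function.support (fun x => deriv φ x • u x + φ x • f x) ⊆ Ioc (-a) a := by
    intro x hx
    by_contra hxa
    apply hx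
    have hx' : R < |x| ∧ deriv φ x = 0 := by
      have hle : a ≤ |x| := by
        rw [mem_Ioc, not_and_or] at hxa
        rcases hxa with h | h
        · exact le_abs.2 (Or.inr (by linarith))
        · exact le_abs.2 (Or.inl (by linarith))
      refine ⟨ha.trans_le hle, ?_⟩
      have : φ =ᶠ[nhds x] fun _ => 0 := by
        filter_upwards [continuous_abs.continuousAt.eventually (lt_mem_nhds (ha.trans_le hle))]
          with y hy using hz y hy
      rw [this.deriv_eq]; simp
    simp [hz x hx'.1, hx'.2]
  rw [← intervalIntegral.integral_eq_integral_of_support_subset hsupp,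
    ← (hprod (-a) trivial a trivial).2]
  beta_reduce
  rw [hz a (by rwa [abs_of_pos ha0]),
    hz (-a) (by rwa [abs_neg, abs_of_pos ha0])]
  simp

/-- A locally integrable function whose weak derivative vanishes is constant. -/
lemma ae_eq_const_of_hasWeakDeriv_zero {u : ℝ → ℂ} (h : HasWeakDeriv u 0) :
    ∃ c : ℂ, u =ᵐ[volume] fun _ => c := by
  obtain ⟨ρ, hρs, hρc, hρ1⟩ : ∃ ρ : ℝ → ℝ, ContDiff ℝ ∞ ρ ∧ HasCompactSupport ρ ∧ ∫ x, ρ x = 1 := by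
    let b : ContDiffBump (0 : ℝ) := ⟨1, 2, one_pos, one_lt_two⟩
    exact ⟨b.normed volume, b.contDiff_normed, b.hasCompactSupport_normed, b.integral_normed⟩
  refine ⟨∫ x, ρ x • u x, ?_⟩
  have hl : LocallyIntegrable fun x => u x - ∫ x, ρ x • u x :=
    h.1.sub (continuous_const.locallyIntegrable)
  have := ae_eq_zero_of_integral_contDiff_smul_eq_zero hl fun ψ hψ hψc => ?_
  · filter_upwards [this] with x hx using sub_eq_zero.1 hx
  -- Subtracting `m ρ` leaves a function `χ` of integral zero, whose primitive has compact support
  -- and is an admissible test function. Testing with it gives `∫ χ u = 0`, which is the required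
  -- identity for `ψ`.
  set m := ∫ x, ψ x
  set χ : ℝ → ℝ := fun x => ψ x - m * ρ x
  have hχs : ContDiff ℝ ∞ χ := hψ.sub (contDiff_const.mul hρs)
  have hχi : ∀ (a b : ℝ), IntervalIntegrable χ volume a b := fun a b =>
    hχs.continuous.intervalIntegrable a b
  obtain ⟨R, hR⟩ := hψc.isBounded.subset_closedBall 0
  obtain ⟨R', hR'⟩ := hρc.isBounded.subset_closedBall 0
  set a := max |R| |R'| + 1
  have ha0 : 0 < a := by positivity
  have hχz : ∀ x, a ≤ |x| → χ x = 0 := fun x hx => by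
    have h1 : ψ x = 0 := by
      by_contra hne
      have := hR (subset_tsupport ψ hne)
      rw [mem_closedBall_zero_iff, Real.norm_eq_abs] at this
      have := le_abs_self R
      have := le_max_left |R| |R'|
      linarith
    have h2 : ρ x = 0 := by
      by_contra hne
      have := hR' (subset_tsupport ρ hne)
      rw [mem_closedBall_zero_iff, Real.norm_eq_abs] at this
      have := le_abs_self R'
      have := le_max_right |R| |R'|
      linarith
    simp [χ, h1, h2]
  have hint0 : ∫ x, χ x = 0 := by
    rw [integral_sub (hψ.continuous.integrable_of_hasCompactSupport hψc)
      ((hρs.continuous.integrable_of_hasCompactSupport hρc).const_mul m), integral_const_mul, hρ1]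
    simp [m]
  have hχint : ∫ x in (-a)..a, χ x = 0 := by
    rw [intervalIntegral.integral_eq_integral_of_support_subset, hint0]
    intro x hx
    by_contra hxa
    apply hx
    apply hχz
    rw [mem_Ioc, not_and_or] at hxa
    rcases hxa with h | h
    · exact le_abs.2 (Or.inr (by linarith))
    · exact le_abs.2 (Or.inl (by linarith))
  set Φ : ℝ → ℝ := fun x => ∫ t in (-a)..x, χ t
  have hΦd : ∀ x, HasDerivAt Φ (χ x) x := fun x =>
    intervalIntegral.integral_hasDerivAt_right (hχi _ _)
      (hχs.continuous.stronglyMeasurableAtFilter _ _) hχs.continuous.continuousAt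
  have hderiv : deriv Φ = χ := funext fun x => (hΦd x).deriv
  have hΦs : ContDiff ℝ ∞ Φ := by
    rw [contDiff_infty_iff_deriv, hderiv]
    exact ⟨fun x => (hΦd x).differentiableAt, hχs⟩
  have hΦc : HasCompactSupport Φ := by
    refine HasCompactSupport.intro (isCompact_Icc (a := -a) (b := a)) fun x hx => ?_
    rw [mem_Icc, not_and_or, not_le, not_le] at hx
    rcases hx with h | h
    · refine intervalIntegral.integral_zero_ae (Filter.Eventually.of_forall fun t ht => ?_)
      rw [uIoc_of_ge h.le] at ht
      exact hχz t (le_abs.2 (Or.inr (by linarith [ht.2])))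
    · have : Φ x = (∫ t in (-a)..a, χ t) + ∫ t in a..x, χ t :=
        (intervalIntegral.integral_add_adjacent_intervals (hχi _ _) (hχi _ _)).symm
      rw [this, hχint, zero_add]
      refine intervalIntegral.integral_zero_ae (Filter.Eventually.of_forall fun t ht => ?_)
      rw [uIoc_of_le h.le] at ht
      exact hχz t (le_abs.2 (Or.inl (by linarith [ht.1])))
  have key := h.2.2 Φ hΦs hΦc
  rw [hderiv] at key
  have i1 := integrable_smul_of_test h.1 hψ.continuous hψc
  have i2 := integrable_smul_of_test h.1 hρs.continuous hρc
  have i3 : Integrable fun x => ψ x • ∫ y, ρ y • u y :=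
    (hψ.continuous.integrable_of_hasCompactSupport hψc).smul_const _
  simp only [Pi.zero_apply, smul_zero, integral_zero, neg_zero, χ, sub_smul, mul_smul] at key
  have e : ∫ x, (ψ x • u x - m • ρ x • u x) = (∫ x, ψ x • u x) - m • ∫ x, ρ x • u x := by
    rw [← integral_smul]; exact integral_sub i1 (i2.smul m)
  rw [e] at key
  simp only [smul_sub]
  rw [integral_sub i1 i3, integral_smul_const]
  exact key

/-- A function with a weak derivative agrees almost everywhere with a primitive of it. -/
lemma HasWeakDeriv.exists_primitive {u f : ℝ → ℂ} (h : HasWeakDeriv u f) :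
    ∃ v : ℝ → ℂ, IsPrimitiveOn univ v f ∧ u =ᵐ[volume] v := by
  have hf : ∀ a b, IntervalIntegrable f volume a b := fun a b =>
    intervalIntegrable_iff.2 ((h.2.1.integrableOn_isCompact isCompact_uIcc).mono_set
      uIoc_subset_uIcc)
  have hp := isPrimitiveOn_integral hf 0
  have hw := hp.hasWeakDeriv
  -- `u` minus the integral of `f` has weak derivative zero.
  have hd := h.add (hw.const_smul (-1))
  have e : f + (-1 : ℂ) • f = 0 := by ext x; simp
  rw [e] at hd
  obtain ⟨c, hc⟩ := ae_eq_const_of_hasWeakDeriv_zero hd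
  refine ⟨fun x => (∫ t in (0 : ℝ)..x, f t) + c, ?_, ?_⟩
  · intro x _ y _
    refine ⟨hf x y, ?_⟩
    rw [← (hp x trivial y trivial).2]
    ring
  · filter_upwards [hc] with x hx
    simp only [Pi.add_apply, Pi.smul_apply, smul_eq_mul] at hx
    rw [← hx]; ring


/-! ### Exponential averages on `L²` -/

section ExpAvg

variable {E : Type*} [NormedAddCommGroup E] [NormedSpace ℝ E]

/-- The solution `∫_{-∞}^x e^{-α(x-y)} g(y) dy` of `u' = -α u + g`. -/
noncomputable def expAvg (α : ℝ) (g : ℝ → E) (x : ℝ) : E :=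
  ∫ t in Ioi (0 : ℝ), Real.exp (-(α * t)) • g (x - t)

lemma eLpNorm_two_sq {E X : Type*} [NormedAddCommGroup E] [MeasurableSpace X] {μ : Measure X}
    (g : X → E) :
    eLpNorm g 2 μ ^ 2 = ∫⁻ x, ‖g x‖ₑ ^ 2 ∂μ := by
  have := eLpNorm_nnreal_pow_eq_lintegral (f := g) (μ := μ) (p := 2) two_ne_zero
  simpa using this

lemma lintegral_exp_neg {α : ℝ} (hα : 0 < α) :
    ∫⁻ t in Ioi (0 : ℝ), ENNReal.ofReal (Real.exp (-(α * t))) = ENNReal.ofReal (1 / α) := by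
  have h1 : IntegrableOn (fun t : ℝ => Real.exp (-(α * t))) (Ioi 0) := by
    simpa using integrableOn_exp_mul_Ioi (neg_lt_zero.2 hα) 0
  rw [← ofReal_integral_eq_lintegral_ofReal h1
    (Filter.Eventually.of_forall fun t => (Real.exp_pos _).le)]
  have := integral_exp_mul_Ioi (neg_lt_zero.2 hα) 0
  simp only [neg_mul, mul_zero, Real.exp_zero] at this
  rw [this, neg_div_neg_eq]

/-- Cauchy–Schwarz for the factors `√w` and `√w G`. -/
lemma lintegral_weight_sq_le {X : Type*} [MeasurableSpace X] (μ : Measure X)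
    {w G : X → ENNReal} (hw : Measurable w) (hG : Measurable G) :
    (∫⁻ t, w t * G t ∂μ) ^ 2 ≤ (∫⁻ t, w t ∂μ) * ∫⁻ t, w t * G t ^ 2 ∂μ := by
  have h := ENNReal.lintegral_mul_le_Lp_mul_Lq μ Real.HolderConjugate.two_two
    (f := fun t => w t ^ (1 / 2 : ℝ)) (g := fun t => w t ^ (1 / 2 : ℝ) * G t)
    (hw.pow_const _).aemeasurable ((hw.pow_const _).mul hG).aemeasurable
  have e0 : ∀ a : ENNReal, a ^ (1 / 2 : ℝ) * a ^ (1 / 2 : ℝ) = a := fun a => by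
    rw [← ENNReal.rpow_add_of_nonneg _ _ (by norm_num) (by norm_num)]; norm_num
  have e1 : ∀ a : ENNReal, (a ^ (1 / 2 : ℝ)) ^ (2 : ℝ) = a := fun a => by
    rw [← ENNReal.rpow_mul]; norm_num
  have e2 : ∀ a : ENNReal, (a ^ (1 / 2 : ℝ)) ^ 2 = a := fun a => by
    rw [pow_two, e0]
  simp only [Pi.mul_apply, ← mul_assoc, e0, e1, ENNReal.mul_rpow_of_nonneg _ _ zero_le_two] at h
  calc (∫⁻ t, w t * G t ∂μ) ^ 2 ≤ _ := pow_le_pow_left' h 2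
    _ = _ := by simp only [mul_pow, e2, ENNReal.rpow_two]

variable {α : ℝ} {g : ℝ → E}

lemma lintegral_expAvg_sq_le (hα : 0 < α) (hg : StronglyMeasurable g) (x : ℝ) :
    (∫⁻ t in Ioi (0 : ℝ), ‖Real.exp (-(α * t)) • g (x - t)‖ₑ) ^ 2 ≤
      ENNReal.ofReal (1 / α) *
        ∫⁻ t in Ioi (0 : ℝ), ENNReal.ofReal (Real.exp (-(α * t))) * ‖g (x - t)‖ₑ ^ 2 := by
  have h := lintegral_weight_sq_le (volume.restrict (Ioi (0 : ℝ)))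
    (w := fun t => ENNReal.ofReal (Real.exp (-(α * t)))) (G := fun t => ‖g (x - t)‖ₑ)
    (by fun_prop) ((hg.comp_measurable (measurable_const.sub measurable_id)).enorm)
  rw [lintegral_exp_neg hα] at h
  simpa only [enorm_smul, Real.enorm_of_nonneg (Real.exp_pos _).le] using h

lemma lintegral_expAvg_le_eLpNorm {E : Type*} [NormedAddCommGroup E] {g : ℝ → E} (hα : 0 < α)
    (x : ℝ) :
    ∫⁻ t in Ioi (0 : ℝ), ENNReal.ofReal (Real.exp (-(α * t))) * ‖g (x - t)‖ₑ ^ 2 ≤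
      eLpNorm g 2 volume ^ 2 := by
  rw [eLpNorm_two_sq, ← lintegral_sub_left_eq_self (fun y => ‖g y‖ₑ ^ 2) x]
  refine (setLIntegral_mono_ae' measurableSet_Ioi (g := fun t => ‖g (x - t)‖ₑ ^ 2)
    (Filter.Eventually.of_forall fun t ht => ?_)).trans (setLIntegral_le_lintegral _ _)
  have : Real.exp (-(α * t)) ≤ 1 := Real.exp_le_one_iff.2 (by
    have := mul_pos hα (mem_Ioi.1 ht); linarith)
  calc _ ≤ 1 * ‖g (x - t)‖ₑ ^ 2 := by
        gcongr; exact ENNReal.ofReal_le_one.2 this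
    _ = _ := one_mul _

lemma integrableOn_expAvg (hα : 0 < α) (hg : StronglyMeasurable g) (hm : MemLp g 2 volume)
    (x : ℝ) : IntegrableOn (fun t => Real.exp (-(α * t)) • g (x - t)) (Ioi 0) := by
  refine ⟨?_, ?_⟩
  · have h1 : Continuous fun t : ℝ => Real.exp (-(α * t)) := by fun_prop
    exact (h1.stronglyMeasurable.smul
      (hg.comp_measurable (measurable_const.sub measurable_id))).aestronglyMeasurable
  · have h := (lintegral_expAvg_sq_le hα hg x).trans
      (mul_le_mul_right (lintegral_expAvg_le_eLpNorm hα x) _)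
    have hlt : ENNReal.ofReal (1 / α) * eLpNorm g 2 volume ^ 2 < ⊤ :=
      ENNReal.mul_lt_top ENNReal.ofReal_lt_top (ENNReal.pow_lt_top hm.2)
    exact (ENNReal.pow_lt_top_iff.1 (h.trans_lt hlt)).resolve_right (by norm_num)

lemma enorm_expAvg_sq_le (hα : 0 < α) (hg : StronglyMeasurable g) (x : ℝ) :
    ‖expAvg α g x‖ₑ ^ 2 ≤ ENNReal.ofReal (1 / α) *
      ∫⁻ t in Ioi (0 : ℝ), ENNReal.ofReal (Real.exp (-(α * t))) * ‖g (x - t)‖ₑ ^ 2 :=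
  (pow_le_pow_left' (enorm_integral_le_lintegral_enorm _) 2).trans (lintegral_expAvg_sq_le hα hg x)

lemma norm_expAvg_le (hα : 0 < α) (hg : StronglyMeasurable g) (hm : MemLp g 2 volume) (x : ℝ) :
    ‖expAvg α g x‖ ≤ √(1 / α) * (eLpNorm g 2 volume).toReal := by
  have h := (enorm_expAvg_sq_le hα hg x).trans
      (mul_le_mul_right (lintegral_expAvg_le_eLpNorm hα x) _)
  have hlt : ENNReal.ofReal (1 / α) * eLpNorm g 2 volume ^ 2 ≠ ⊤ :=
    (ENNReal.mul_lt_top ENNReal.ofReal_lt_top (ENNReal.pow_lt_top hm.2)).ne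
  have h2 := ENNReal.toReal_mono hlt h
  rw [ENNReal.toReal_pow, ENNReal.toReal_mul, ENNReal.toReal_pow, toReal_enorm,
    ENNReal.toReal_ofReal (by positivity)] at h2
  refine le_of_sq_le_sq ?_ (by positivity)
  rwa [mul_pow, Real.sq_sqrt (by positivity)]

/-- The pointwise Cauchy–Schwarz bound is integrated with Tonelli and translation invariance.
Cauchy–Schwarz and the integration each contribute one factor `∫ e^{-αt} = 1/α`. -/
lemma eLpNorm_expAvg_le (hα : 0 < α) (hg : StronglyMeasurable g) :
    eLpNorm (expAvg α g) 2 volume ≤ ENNReal.ofReal (1 / α) * eLpNorm g 2 volume := by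
  refine (ENNReal.pow_le_pow_left_iff two_ne_zero).1 ?_
  rw [mul_pow, eLpNorm_two_sq, eLpNorm_two_sq]
  have hme : Measurable fun z : ℝ × ℝ =>
      ENNReal.ofReal (Real.exp (-(α * z.2))) * ‖g (z.1 - z.2)‖ₑ ^ 2 := by
    have h1 : Measurable fun z : ℝ × ℝ => ENNReal.ofReal (Real.exp (-(α * z.2))) := by fun_prop
    exact h1.mul ((hg.comp_measurable (measurable_fst.sub measurable_snd)).enorm.pow_const 2)
  calc ∫⁻ x, ‖expAvg α g x‖ₑ ^ 2
      ≤ ∫⁻ x, ENNReal.ofReal (1 / α) *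
          ∫⁻ t in Ioi (0 : ℝ), ENNReal.ofReal (Real.exp (-(α * t))) * ‖g (x - t)‖ₑ ^ 2 :=
        lintegral_mono fun x => enorm_expAvg_sq_le hα hg x
    _ = ENNReal.ofReal (1 / α) * ∫⁻ t in Ioi (0 : ℝ), ∫⁻ x,
          ENNReal.ofReal (Real.exp (-(α * t))) * ‖g (x - t)‖ₑ ^ 2 := by
        rw [lintegral_const_mul _ hme.lintegral_prod_right',
          lintegral_lintegral_swap hme.aemeasurable]
    _ = ENNReal.ofReal (1 / α) * ∫⁻ t in Ioi (0 : ℝ),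
          ENNReal.ofReal (Real.exp (-(α * t))) * ∫⁻ x, ‖g x‖ₑ ^ 2 := by
        congr 1
        refine lintegral_congr fun t => ?_
        rw [lintegral_const_mul' _ _ ENNReal.ofReal_ne_top,
          lintegral_sub_right_eq_self (fun x => ‖g x‖ₑ ^ 2) t]
    _ = ENNReal.ofReal (1 / α) ^ 2 * ∫⁻ x, ‖g x‖ₑ ^ 2 := by
        rw [lintegral_mul_const _ (by fun_prop), lintegral_exp_neg hα]
        ring

/-- The substitution `y = x - t` gives `e^{-αx} ∫_{-∞}^x e^{αy} g(y) dy`, to which the product rule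
applies. The form over `t > 0` is the one suited to norm estimates. -/
lemma isPrimitiveOn_expAvg [CompleteSpace E] (hα : 0 < α) (hg : StronglyMeasurable g)
    (hm : MemLp g 2 volume) :
    IsPrimitiveOn univ (expAvg α g) (fun x => g x - α • expAvg α g x) := by
  have hint : ∀ x, IntegrableOn (fun y => Real.exp (α * y) • g y) (Iic x) := by
    intro x
    have h := (integrableOn_expAvg hα hg hm x).smul (Real.exp (α * x))
    have h' : IntegrableOn (fun t => Real.exp (α * (x - t)) • g (x - t)) (Ioi 0) := by
      refine h.congr (Filter.Eventually.of_forall fun t => ?_)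
      simp only [Pi.smul_apply, smul_smul, ← Real.exp_add]
      ring_nf
    have hp := (Measure.measurePreserving_sub_left volume x).integrableOn_comp_preimage
      (f := fun y => Real.exp (α * y) • g y) (s := Iio x)
      (MeasurableEquiv.subLeft x).measurableEmbedding
    have e : (fun y => x - y) ⁻¹' Iio x = Ioi 0 := by ext t; simp
    rw [e] at hp
    exact (integrableOn_Iic_iff_integrableOn_Iio (by simp)).2 (hp.1 h')
  have hH : IsPrimitiveOn univ (fun x => ∫ y in Iic x, Real.exp (α * y) • g y)
      (fun y => Real.exp (α * y) • g y) := by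
    intro x _ y _
    refine ⟨⟨(hint y).mono_set fun t ht => ht.2, (hint x).mono_set fun t ht => ht.2⟩, ?_⟩
    exact intervalIntegral.integral_Iic_sub_Iic (hint x) (hint y)
  have hexp : IsPrimitiveOn univ (fun x => Real.exp (-(α * x)))
      (fun x => -α * Real.exp (-(α * x))) := by
    refine isPrimitiveOn_of_hasDerivAt (fun x => ?_) (by fun_prop)
    have := (((hasDerivAt_id x).const_mul α).neg).exp
    simpa [mul_comm] using this
  have hval : ∀ x, expAvg α g x
      = Real.exp (-(α * x)) • ∫ y in Iic x, Real.exp (α * y) • g y := by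
    intro x
    have hp := (Measure.measurePreserving_sub_left volume x).setIntegral_preimage_emb
      (MeasurableEquiv.subLeft x).measurableEmbedding
      (fun y => Real.exp (α * y) • g y) (Iio x)
    have e : (fun y => x - y) ⁻¹' Iio x = Ioi 0 := by ext t; simp
    rw [e] at hp
    rw [integral_Iic_eq_integral_Iio, ← hp, ← integral_smul, expAvg]
    refine setIntegral_congr_fun measurableSet_Ioi fun t _ => ?_
    simp only [smul_smul, ← Real.exp_add]
    ring_nf
  refine (hexp.smul hH).congr ordConnected_univ (fun x _ => (hval x).symm)
    (Filter.Eventually.of_forall fun x _ => ?_)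
  rw [hval x, smul_smul, smul_smul, ← Real.exp_add, neg_add_cancel, Real.exp_zero, one_smul,
    neg_mul, neg_smul, neg_add_eq_sub]

lemma expAvg_add (hα : 0 < α) {g' : ℝ → E} (hg : StronglyMeasurable g) (hm : MemLp g 2 volume)
    (hg' : StronglyMeasurable g') (hm' : MemLp g' 2 volume) (x : ℝ) :
    expAvg α (fun y => g y + g' y) x = expAvg α g x + expAvg α g' x := by
  rw [expAvg, expAvg, expAvg, ← integral_add (integrableOn_expAvg hα hg hm x)
    (integrableOn_expAvg hα hg' hm' x)]
  simp only [smul_add]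

lemma expAvg_smul {E : Type*} [NormedAddCommGroup E] [NormedSpace ℂ E] (g : ℝ → E) (c : ℂ)
    (x : ℝ) : expAvg α (fun y => c • g y) x = c • expAvg α g x := by
  rw [expAvg, expAvg, ← integral_smul]
  simp only [smul_comm c]

lemma expAvg_congr {g' : ℝ → E} (h : g =ᵐ[volume] g') (x : ℝ) :
    expAvg α g x = expAvg α g' x := by
  refine setIntegral_congr_ae measurableSet_Ioi ?_
  filter_upwards [(Measure.measurePreserving_sub_left volume x).quasiMeasurePreserving.ae h] with t ht _
  rw [ht]

end ExpAvg


/-! ### First-order systems on the line -/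

section FirstOrder

variable {E F : Type*} [NormedAddCommGroup E] [NormedSpace ℂ E] [NormedAddCommGroup F]
  [NormedSpace ℂ F]

/-- A map into measurable functions which is linear and bounded in `L²` up to null sets defines a
bounded operator. -/
lemma exists_clm_of_ae (Φ : Lp E 2 (volume : Measure ℝ) → ℝ → F) {b : ℝ} (hb : 0 ≤ b)
    (hadd : ∀ f g, Φ (f + g) =ᵐ[volume] fun x => Φ f x + Φ g x)
    (hsmul : ∀ (c : ℂ) f, Φ (c • f) =ᵐ[volume] fun x => c • Φ f x)
    (hmeas : ∀ f, AEStronglyMeasurable (Φ f) volume)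
    (hbound : ∀ f, eLpNorm (Φ f) 2 volume ≤ ENNReal.ofReal b * eLpNorm f 2 volume) :
    ∃ L : Lp E 2 (volume : Measure ℝ) →L[ℂ] Lp F 2 (volume : Measure ℝ), ‖L‖ ≤ b ∧
      ∀ f, L f =ᵐ[volume] Φ f := by
  have hmem : ∀ f, MemLp (Φ f) 2 volume := fun f => ⟨hmeas f, (hbound f).trans_lt
    (ENNReal.mul_lt_top ENNReal.ofReal_lt_top (Lp.memLp f).2)⟩
  let L₀ : Lp E 2 (volume : Measure ℝ) →ₗ[ℂ] Lp F 2 (volume : Measure ℝ) :=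
    { toFun := fun f => (hmem f).toLp
      map_add' := fun f g => by
        rw [← MemLp.toLp_add]
        exact (MemLp.toLp_eq_toLp_iff _ _).2 (hadd f g)
      map_smul' := fun c f => by
        rw [RingHom.id_apply, ← MemLp.toLp_const_smul]
        exact (MemLp.toLp_eq_toLp_iff _ _).2 (hsmul c f) }
  refine ⟨L₀.mkContinuous b fun f => ?_, LinearMap.mkContinuous_norm_le _ hb _, fun f =>
    (hmem f).coeFn_toLp⟩
  change ‖(hmem f).toLp‖ ≤ _
  rw [Lp.norm_toLp, Lp.norm_def, ← ENNReal.toReal_ofReal hb, ← ENNReal.toReal_mul]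
  exact ENNReal.toReal_mono
    (ENNReal.mul_lt_top ENNReal.ofReal_lt_top (Lp.memLp f).2).ne (hbound f)

/-- Multiplication by a bounded operator-valued function. -/
lemma exists_mulOp {T : ℝ → E →L[ℂ] F} (hT : AEStronglyMeasurable T volume) {b : ℝ} (hb : 0 ≤ b)
    (hTb : ∀ x, ‖T x‖ ≤ b) :
    ∃ L : Lp E 2 (volume : Measure ℝ) →L[ℂ] Lp F 2 (volume : Measure ℝ), ‖L‖ ≤ b ∧
      ∀ f, L f =ᵐ[volume] fun x => T x (f x) := by
  refine exists_clm_of_ae (fun f x => T x (f x)) hb (fun f g => ?_) (fun c f => ?_) (fun f => ?_)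
    (fun f => ?_)
  · filter_upwards [Lp.coeFn_add f g] with x hx
    rw [hx, Pi.add_apply, map_add]
  · filter_upwards [Lp.coeFn_smul c f] with x hx
    rw [hx, Pi.smul_apply, map_smul]
  · exact isBoundedBilinearMap_complex_apply.continuous.comp_aestronglyMeasurable
      (hT.prodMk (Lp.aestronglyMeasurable f))
  · refine eLpNorm_le_mul_eLpNorm_of_ae_le_mul (Filter.Eventually.of_forall fun x => ?_) 2
    exact ((T x).le_opNorm _).trans (by gcongr; exact hTb x)

variable {α : ℝ}

/-- The solution of `d' = A d + g` on the line when `P` and `Q` project onto the eigenspaces of `A`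
with eigenvalues `-α` and `α`. -/
noncomputable def green (α : ℝ) (P Q : E →L[ℂ] E) (g : ℝ → E) (x : ℝ) : E :=
  P (expAvg α g x) - Q (expAvg α (fun y => g (-y)) (-x))

lemma memLp_comp_neg {E : Type*} [NormedAddCommGroup E] {g : ℝ → E} (hm : MemLp g 2 volume) :
    MemLp (fun y => g (-y)) 2 volume :=
  hm.comp_measurePreserving (Measure.measurePreserving_neg volume)

lemma eLpNorm_comp_neg {E : Type*} [NormedAddCommGroup E] {g : ℝ → E}
    (hg : AEStronglyMeasurable g volume) :
    eLpNorm (fun y => g (-y)) 2 volume = eLpNorm g 2 volume :=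
  eLpNorm_comp_measurePreserving hg (Measure.measurePreserving_neg volume)

variable {A P Q : E →L[ℂ] E}

/-- The decaying component is integrated from `-∞` and the growing one, by reflection, from `+∞`; `P
+ Q = 1` reassembles the source. -/
lemma isPrimitiveOn_green [CompleteSpace E] (hα : 0 < α) (hP : ∀ v, A (P v) = -((α : ℂ) • P v))
    (hQ : ∀ v, A (Q v) = (α : ℂ) • Q v) (hPQ : ∀ v, P v + Q v = v) {g : ℝ → E}
    (hg : StronglyMeasurable g) (hm : MemLp g 2 volume) :
    IsPrimitiveOn univ (green α P Q g) (fun x => A (green α P Q g x) + g x) := by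
  have h1 := (isPrimitiveOn_expAvg hα hg hm).clm (P.restrictScalars ℝ)
  have hg' : StronglyMeasurable fun y => g (-y) := hg.comp_measurable measurable_neg
  have h2 := ((isPrimitiveOn_expAvg hα hg' (memLp_comp_neg hm)).comp_neg.clm
    (Q.restrictScalars ℝ)).neg
  refine (h1.add h2).congr ordConnected_univ (fun x _ => ?_)
    (Filter.Eventually.of_forall fun x _ => ?_)
  · simp [green, sub_eq_add_neg]
  · simp only [ContinuousLinearMap.coe_restrictScalars', green, map_sub, map_neg, hP, hQ, neg_neg,
      ← Complex.coe_smul, map_smul]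
    conv_rhs => rw [← hPQ (g x)]
    abel

lemma memLp_expAvg [CompleteSpace E] (hα : 0 < α) {g : ℝ → E}
    (hg : StronglyMeasurable g) (hm : MemLp g 2 volume) : MemLp (expAvg α g) 2 volume :=
  ⟨(isPrimitiveOn_expAvg hα hg hm).continuous.aestronglyMeasurable,
    (eLpNorm_expAvg_le hα hg).trans_lt (ENNReal.mul_lt_top ENNReal.ofReal_lt_top hm.2)⟩

lemma memLp_green [CompleteSpace E] (hα : 0 < α) {g : ℝ → E}
    (hg : StronglyMeasurable g) (hm : MemLp g 2 volume) : MemLp (green α P Q g) 2 volume := by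
  have hg' : StronglyMeasurable fun y => g (-y) := hg.comp_measurable measurable_neg
  exact (P.comp_memLp' (memLp_expAvg hα hg hm)).sub
    (Q.comp_memLp' (memLp_comp_neg (memLp_expAvg hα hg' (memLp_comp_neg hm))))

lemma eLpNorm_clm_comp_le (L : E →L[ℂ] F) (g : ℝ → E) :
    eLpNorm (fun x => L (g x)) 2 volume ≤ ENNReal.ofReal ‖L‖ * eLpNorm g 2 volume :=
  eLpNorm_le_mul_eLpNorm_of_ae_le_mul (Filter.Eventually.of_forall fun _ => L.le_opNorm _) 2

lemma eLpNorm_green_le [CompleteSpace E] (hα : 0 < α) {g : ℝ → E}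
    (hg : StronglyMeasurable g) (hm : MemLp g 2 volume) :
    eLpNorm (green α P Q g) 2 volume ≤
      ENNReal.ofReal ((‖P‖ + ‖Q‖) / α) * eLpNorm g 2 volume := by
  have hg' : StronglyMeasurable fun y => g (-y) := hg.comp_measurable measurable_neg
  have hn := memLp_expAvg hα hg hm
  have hn' := memLp_comp_neg (memLp_expAvg hα hg' (memLp_comp_neg hm))
  have h1 : eLpNorm (fun x => P (expAvg α g x)) 2 volume ≤
      ENNReal.ofReal ‖P‖ * (ENNReal.ofReal (1 / α) * eLpNorm g 2 volume) :=
    (eLpNorm_clm_comp_le P _).trans (by gcongr; exact eLpNorm_expAvg_le hα hg)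
  have h2 : eLpNorm (fun x => Q (expAvg α (fun y => g (-y)) (-x))) 2 volume ≤
      ENNReal.ofReal ‖Q‖ * (ENNReal.ofReal (1 / α) * eLpNorm g 2 volume) := by
    refine (eLpNorm_clm_comp_le Q _).trans ?_
    gcongr
    rw [eLpNorm_comp_neg (memLp_expAvg hα hg' (memLp_comp_neg hm)).1,
      ← eLpNorm_comp_neg hg.aestronglyMeasurable]
    exact eLpNorm_expAvg_le hα hg'
  calc eLpNorm (green α P Q g) 2 volume ≤ _ + _ :=
        eLpNorm_sub_le (P.comp_memLp' hn).1 (Q.comp_memLp' hn').1 one_le_two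
    _ ≤ _ := add_le_add h1 h2
    _ = _ := by
      rw [← mul_assoc, ← mul_assoc, ← add_mul, ← add_mul,
        ← ENNReal.ofReal_add (norm_nonneg _) (norm_nonneg _),
        ← ENNReal.ofReal_mul (by positivity), mul_one_div]

/-- The pointwise bound by the `L²` norm is what later makes evaluation of a solution at a junction
a bounded functional. -/
lemma norm_green_le (hα : 0 < α) {g : ℝ → E}
    (hg : StronglyMeasurable g) (hm : MemLp g 2 volume) (x : ℝ) :
    ‖green α P Q g x‖ ≤ (‖P‖ + ‖Q‖) * √(1 / α) * (eLpNorm g 2 volume).toReal := by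
  have hg' : StronglyMeasurable fun y => g (-y) := hg.comp_measurable measurable_neg
  have h2 := norm_expAvg_le hα hg' (memLp_comp_neg hm) (-x)
  rw [eLpNorm_comp_neg hm.1] at h2
  have h1 := norm_expAvg_le hα hg hm x
  calc ‖green α P Q g x‖ ≤ ‖P‖ * ‖expAvg α g x‖ + ‖Q‖ * ‖expAvg α (fun y => g (-y)) (-x)‖ :=
        (norm_sub_le _ _).trans (add_le_add (P.le_opNorm _) (Q.le_opNorm _))
    _ ≤ ‖P‖ * (√(1 / α) * (eLpNorm g 2 volume).toReal) +
          ‖Q‖ * (√(1 / α) * (eLpNorm g 2 volume).toReal) := by gcongr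
    _ = _ := by ring

/-- The identity holds at every point because the integrals do not see null sets; solution operators
with values in genuine functions need this. -/
lemma green_add (hα : 0 < α) (f g : Lp E 2 (volume : Measure ℝ)) (x : ℝ) :
    green α P Q (f + g : Lp E 2 (volume : Measure ℝ)) x = green α P Q f x + green α P Q g x := by
  have h := Lp.coeFn_add f g
  have h' := (Measure.measurePreserving_neg (volume : Measure ℝ)).quasiMeasurePreserving.ae h
  have hs : ∀ f : Lp E 2 (volume : Measure ℝ), StronglyMeasurable fun y => f (-y) := fun f =>
    (Lp.stronglyMeasurable f).comp_measurable measurable_neg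
  have e1 : expAvg α (f + g : Lp E 2 (volume : Measure ℝ)) x = expAvg α f x + expAvg α g x := by
    rw [expAvg_congr h, ← expAvg_add hα (Lp.stronglyMeasurable f) (Lp.memLp f)
      (Lp.stronglyMeasurable g) (Lp.memLp g)]
    rfl
  have e2 : expAvg α (fun y => (f + g : Lp E 2 (volume : Measure ℝ)) (-y)) (-x)
      = expAvg α (fun y => f (-y)) (-x) + expAvg α (fun y => g (-y)) (-x) := by
    rw [← expAvg_add hα (hs f) (memLp_comp_neg (Lp.memLp f)) (hs g) (memLp_comp_neg (Lp.memLp g))]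
    exact expAvg_congr h' _
  rw [green, e1, e2, map_add, map_add, green, green]
  abel

lemma green_smul (c : ℂ) (f : Lp E 2 (volume : Measure ℝ)) (x : ℝ) :
    green α P Q (c • f : Lp E 2 (volume : Measure ℝ)) x = c • green α P Q f x := by
  have h := Lp.coeFn_smul c f
  have h' := (Measure.measurePreserving_neg (volume : Measure ℝ)).quasiMeasurePreserving.ae h
  have e1 : expAvg α (c • f : Lp E 2 (volume : Measure ℝ)) x = c • expAvg α f x := by
    rw [expAvg_congr h, ← expAvg_smul]
    rfl
  have e2 : expAvg α (fun y => (c • f : Lp E 2 (volume : Measure ℝ)) (-y)) (-x)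
      = c • expAvg α (fun y => f (-y)) (-x) := by
    rw [← expAvg_smul]
    exact expAvg_congr h' _
  rw [green, e1, e2, map_smul, map_smul, green, smul_sub]

/-- Suppose that `A² = α²` and that `1 + S` transforms `d' = A d` into `c' = M c` up to a small
error. Then `c' = M c + g` has a solution in `L²` on the line for every `g` in `L²`. -/
theorem exists_solution_operator [CompleteSpace E] (hα : 0 < α) (hA : ∀ v, A (A v) = ((α : ℂ) ^ 2) • v)
    {S S' M : ℝ → E →L[ℂ] E} (hS : IsPrimitiveOn univ S S') (hS' : Continuous S')
    (hM : AEStronglyMeasurable M volume) {σ β : ℝ} (hSσ : ∀ x, ‖S x‖ ≤ σ)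
    (hβ : ∀ x, ‖S' x + (1 + S x) * A - M x * (1 + S x)‖ ≤ β)
    (hsmall : σ + β * ((1 + ‖A‖ / α) / α) < 1) :
    ∃ (C : ℝ) (sol : Lp E 2 (volume : Measure ℝ) →ₗ[ℂ] (ℝ → E)), ∀ g,
      IsPrimitiveOn univ (sol g) (fun x => M x (sol g x) + g x) ∧ MemLp (sol g) 2 volume ∧
      ∀ x, ‖sol g x‖ ≤ C * ‖g‖ := by
  have hα' : (α : ℂ) ≠ 0 := by exact_mod_cast hα.ne'
  have hσ0 : 0 ≤ σ := (norm_nonneg _).trans (hSσ 0)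
  have hβ0 : 0 ≤ β := (norm_nonneg _).trans (hβ 0)
  -- The spectral projections of `A`; as `A² = α²`, they are `(1 ∓ A/α)/2`.
  set P : E →L[ℂ] E := (1 / 2 : ℂ) • (1 - (α : ℂ)⁻¹ • A)
  set Q : E →L[ℂ] E := (1 / 2 : ℂ) • (1 + (α : ℂ)⁻¹ • A)
  have hP : ∀ v, A (P v) = -((α : ℂ) • P v) := fun v => by
    simp only [P, smul_apply, sub_apply,
      one_apply_eq_self, map_smul, map_sub, hA, smul_sub, smul_smul]
    match_scalars <;> field_simp
  have hQ : ∀ v, A (Q v) = (α : ℂ) • Q v := fun v => by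
    simp only [Q, smul_apply, add_apply,
      one_apply_eq_self, map_smul, map_add, hA, smul_add, smul_smul]
    match_scalars <;> field_simp
  have hPQ : ∀ v, P v + Q v = v := fun v => by
    simp only [P, Q, smul_apply, add_apply,
      sub_apply, one_apply_eq_self]
    module
  have hαA : ‖(α : ℂ)⁻¹ • A‖ ≤ ‖A‖ / α := by
    rw [norm_smul, norm_inv, Complex.norm_real, Real.norm_of_nonneg hα.le, div_eq_inv_mul]
  have h1n : ‖(1 : E →L[ℂ] E)‖ ≤ 1 := ContinuousLinearMap.norm_id_le
  have hPn : ‖P‖ ≤ 1 / 2 * (1 + ‖A‖ / α) := by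
    rw [norm_smul]
    have := norm_sub_le (1 : E →L[ℂ] E) ((α : ℂ)⁻¹ • A)
    norm_num
    linarith
  have hQn : ‖Q‖ ≤ 1 / 2 * (1 + ‖A‖ / α) := by
    rw [norm_smul]
    have := norm_add_le (1 : E →L[ℂ] E) ((α : ℂ)⁻¹ • A)
    norm_num
    linarith
  obtain ⟨K, hKn, hK⟩ := exists_clm_of_ae (E := E) (F := E) (fun f => green α P Q f)
    (b := (‖P‖ + ‖Q‖) / α) (by positivity)
    (fun f g => Filter.Eventually.of_forall (green_add hα f g))
    (fun c f => Filter.Eventually.of_forall (green_smul c f))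
    (fun f => (memLp_green hα (Lp.stronglyMeasurable f) (Lp.memLp f)).1)
    (fun f => eLpNorm_green_le hα (Lp.stronglyMeasurable f) (Lp.memLp f))
  have hSm : AEStronglyMeasurable S volume := hS.continuous.aestronglyMeasurable
  obtain ⟨LS, hLSn, hLS⟩ := exists_mulOp hSm hσ0 hSσ
  have hDm : AEStronglyMeasurable (fun x => S' x + (1 + S x) * A - M x * (1 + S x)) volume := by
    have h1S : AEStronglyMeasurable (fun x => 1 + S x) volume :=
      (continuous_const.add hS.continuous).aestronglyMeasurable
    exact (hS'.aestronglyMeasurable.add (h1S.mul aestronglyMeasurable_const)).sub (hM.mul h1S)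
  obtain ⟨LD, hLDn, hLD⟩ := exists_mulOp hDm hβ0 hβ
  -- For `d` the Green solution with source `r` and `c = (1 + S) d`, one finds `c' - M c = (1 + S) r
  -- + (S' + (1 + S) A - M (1 + S)) d = r + Z r`. The source must thus be `r = (1 + Z)⁻¹ g`, a
  -- Neumann series under `hsmall`.
  set Z := LS + LD.comp K
  have hZ : ‖-Z‖ < 1 := by
    rw [norm_neg]
    calc ‖Z‖ ≤ ‖LS‖ + ‖LD‖ * ‖K‖ :=
          (norm_add_le _ _).trans (by gcongr; exact LD.opNorm_comp_le K)
      _ ≤ σ + β * ((1 + ‖A‖ / α) / α) := by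
          have : ‖K‖ ≤ (1 + ‖A‖ / α) / α := hKn.trans
            (div_le_div_of_nonneg_right (by linarith) hα.le)
          gcongr
      _ < 1 := hsmall
  set N := Units.oneSub (-Z) hZ
  set R : Lp E 2 (volume : Measure ℝ) →L[ℂ] Lp E 2 (volume : Measure ℝ) := ↑N⁻¹
  have hR : ∀ g, R g + Z (R g) = g := fun g => by
    have h := N.mul_inv
    have h' := congrArg (fun T : Lp E 2 (volume : Measure ℝ) →L[ℂ] Lp E 2 (volume : Measure ℝ) =>
      T g) h
    simpa [N, R] using h'
  let sol : Lp E 2 (volume : Measure ℝ) →ₗ[ℂ] (ℝ → E) :=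
    { toFun := fun g x => (1 + S x) (green α P Q (R g) x)
      map_add' := fun f g => by
        ext x
        rw [map_add, green_add hα, map_add, Pi.add_apply]
      map_smul' := fun c f => by
        ext x
        rw [map_smul, green_smul, map_smul, Pi.smul_apply, RingHom.id_apply] }
  have hsol : ∀ g x, sol g x = (1 + S x) (green α P Q (R g) x) := fun _ _ => rfl
  have h1S : ∀ x, ‖1 + S x‖ ≤ 1 + σ := fun x =>
    (norm_add_le _ _).trans (add_le_add h1n (hSσ x))
  refine ⟨(1 + σ) * ((‖P‖ + ‖Q‖) * √(1 / α) * ‖R‖), sol, fun g => ⟨?_, ?_, fun x => ?_⟩⟩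
  · have hgr := isPrimitiveOn_green hα hP hQ hPQ (Lp.stronglyMeasurable (R g)) (Lp.memLp (R g))
    have h1 : IsPrimitiveOn univ (fun x => 1 + S x) S' := by
      intro x _ y _
      refine ⟨(hS x trivial y trivial).1, ?_⟩
      rw [← (hS x trivial y trivial).2, add_sub_add_left_eq_sub]
    refine (h1.apply hgr).congr ordConnected_univ (fun x _ => rfl) ?_
    have hg := hR g
    have e1 := Lp.coeFn_add (R g) (Z (R g))
    rw [hg] at e1
    filter_upwards [e1, Lp.coeFn_add (LS (R g)) ((LD.comp K) (R g)), hLS (R g), hLD (K (R g)),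
      hK (R g)] with x e1 e2 e3 e4 e5 _
    have e6 : (Z (R g) : Lp E 2 (volume : Measure ℝ)) x = LS (R g) x + LD (K (R g)) x := e2
    rw [e1, Pi.add_apply, e6, e3, e4, e5, hsol]
    simp only [sub_apply, add_apply,
      mul_apply_eq_comp, one_apply_eq_self, map_add]
    abel
  · have hgr := memLp_green (P := P) (Q := Q) hα (Lp.stronglyMeasurable (R g)) (Lp.memLp (R g))
    refine hgr.of_le_mul (c := 1 + σ) ?_ (Filter.Eventually.of_forall fun x => ?_)
    · exact isBoundedBilinearMap_complex_apply.continuous.comp_aestronglyMeasurable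
        ((continuous_const.add hS.continuous).aestronglyMeasurable.prodMk hgr.1)
    · exact ((1 + S x).le_opNorm _).trans (by gcongr; exact h1S x)
  · have h2 := norm_green_le (P := P) (Q := Q) hα (Lp.stronglyMeasurable (R g))
      (Lp.memLp (R g)) x
    rw [← Lp.norm_def] at h2
    calc ‖sol g x‖ ≤ ‖1 + S x‖ * ‖green α P Q (R g) x‖ := (1 + S x).le_opNorm _
      _ ≤ (1 + σ) * ((‖P‖ + ‖Q‖) * √(1 / α) * (‖R‖ * ‖g‖)) := by
          gcongr
          · exact h1S x
          · exact h2.trans (by gcongr; exact R.le_opNorm g)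
      _ = _ := by ring

end FirstOrder


/-! ### Classical solutions of `u'' = q u` -/

/-- `u` is a classical solution of `u'' = q u` with derivative `u'`. -/
def IsSolution (q : ℝ → ℝ) (u u' : ℝ → ℂ) : Prop :=
  ∀ x, HasDerivAt u (u' x) x ∧ HasDerivAt u' ((q x : ℂ) * u x) x

section Solutions

variable {q : ℝ → ℝ} {u u' v v' : ℝ → ℂ}

lemma IsSolution.add (h : IsSolution q u u') (h' : IsSolution q v v') :
    IsSolution q (fun x => u x + v x) (fun x => u' x + v' x) := fun x =>
  ⟨(h x).1.add (h' x).1, by rw [mul_add]; exact (h x).2.add (h' x).2⟩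

lemma IsSolution.const_mul (h : IsSolution q u u') (c : ℂ) :
    IsSolution q (fun x => c * u x) (fun x => c * u' x) := fun x =>
  ⟨(h x).1.const_mul c, by rw [mul_left_comm]; exact (h x).2.const_mul c⟩

lemma IsSolution.continuous (h : IsSolution q u u') : Continuous u :=
  continuous_iff_continuousAt.2 fun x => (h x).1.continuousAt

lemma IsSolution.continuous_deriv (h : IsSolution q u u') : Continuous u' :=
  continuous_iff_continuousAt.2 fun x => (h x).2.continuousAt

lemma IsSolution.eq_zero {B : ℝ} (hB : ∀ x, |q x| ≤ B) (h : IsSolution q u u') {t : ℝ}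
    (h0 : u t = 0) (h1 : u' t = 0) : u = 0 := by
  have hLip : ∀ x : ℝ, LipschitzOnWith (Real.toNNReal (max 1 B))
      (fun y : ℂ × ℂ => (y.2, (q x : ℂ) * y.1)) univ := by
    intro x
    refine (LipschitzWith.of_dist_le_mul fun y z => ?_).lipschitzOnWith
    rw [Real.coe_toNNReal _ (by positivity), dist_eq_norm, dist_eq_norm, Prod.mk_sub_mk,
      ← mul_sub, Prod.norm_mk, norm_mul, Complex.norm_real, Real.norm_eq_abs]
    refine max_le ?_ ?_
    · calc ‖y.2 - z.2‖ ≤ 1 * ‖y - z‖ := by rw [one_mul]; exact norm_snd_le (y - z)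
        _ ≤ _ := by gcongr; exact le_max_left _ _
    · exact mul_le_mul ((hB x).trans (le_max_right _ _)) (norm_fst_le (y - z)) (norm_nonneg _)
        (by positivity)
  have key := ODE_solution_unique_univ (v := fun x (y : ℂ × ℂ) => (y.2, (q x : ℂ) * y.1))
    (s := fun _ => univ) (t₀ := t) (f := fun x => (u x, u' x)) (g := fun _ => 0) hLip
    (fun x => ⟨(h x).1.prodMk (h x).2, trivial⟩)
    (fun x => ⟨by
      rw [show ((0 : ℂ × ℂ).2, (q x : ℂ) * (0 : ℂ × ℂ).1) = 0 by simp]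
      exact hasDerivAt_const x (0 : ℂ × ℂ), trivial⟩)
    (by simp [h0, h1])
  ext x
  exact congrArg Prod.fst (congrFun key x)

/-- Weak solutions of `f'' = q f` are classical. -/
lemma exists_isSolution (hq : Continuous q) {f f₁ f₂ : ℝ → ℂ} (h₁ : HasWeakDeriv f f₁)
    (h₂ : HasWeakDeriv f₁ f₂) (h : ∀ᵐ x, f₂ x = (q x : ℂ) * f x) :
    ∃ u u', IsSolution q u u' ∧ f =ᵐ[volume] u := by
  obtain ⟨u, hu, hfu⟩ := h₁.exists_primitive
  obtain ⟨u', hu', hfu'⟩ := h₂.exists_primitive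
  -- With continuous representatives inserted, both integrands become continuous, so the primitives
  -- are differentiable everywhere.
  have p1 : IsPrimitiveOn univ u u' := hu.congr ordConnected_univ (fun _ _ => rfl) (by
    filter_upwards [hfu'] with x hx _ using hx)
  have p2 : IsPrimitiveOn univ u' (fun x => (q x : ℂ) * u x) :=
    hu'.congr ordConnected_univ (fun _ _ => rfl) (by
      filter_upwards [hfu, h] with x hx hx' _
      rw [hx', hx])
  exact ⟨u, u', fun x => ⟨p1.hasDerivAt p2.continuous x, p2.hasDerivAt
    ((Complex.continuous_ofReal.comp hq).mul p1.continuous) x⟩, hfu⟩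

/-- The space of classical solutions of `u'' = q u`. -/
def solutionSpace (q : ℝ → ℝ) : Submodule ℂ (ℝ → ℂ) where
  carrier := {u | ∃ u', IsSolution q u u'}
  zero_mem' := ⟨0, fun x => ⟨hasDerivAt_const x 0, by simp⟩⟩
  add_mem' := by
    rintro u v ⟨u', hu⟩ ⟨v', hv⟩
    exact ⟨_, hu.add hv⟩
  smul_mem' := by
    rintro c u ⟨u', hu⟩
    exact ⟨_, hu.const_mul c⟩

/-- A solution is determined by its value and derivative at `0`. -/
lemma finiteDimensional_solutionSpace {B : ℝ} (hB : ∀ x, |q x| ≤ B) :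
    FiniteDimensional ℂ (solutionSpace q) := by
  let L : solutionSpace q →ₗ[ℂ] ℂ × ℂ :=
    { toFun := fun u => (u.1 0, deriv u.1 0)
      map_add' := by
        rintro ⟨u, u', hu⟩ ⟨v, v', hv⟩
        refine Prod.ext rfl ?_
        exact deriv_add (hu 0).1.differentiableAt (hv 0).1.differentiableAt
      map_smul' := by
        rintro c ⟨u, u', hu⟩
        refine Prod.ext rfl ?_
        exact deriv_const_mul c (hu 0).1.differentiableAt }
  refine FiniteDimensional.of_injective L ((injective_iff_map_eq_zero L).2 ?_)
  rintro ⟨u, u', hu⟩ h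
  have h0 : u 0 = 0 := congrArg Prod.fst h
  have h1 : deriv u 0 = 0 := congrArg Prod.snd h
  rw [(hu 0).1.deriv] at h1
  have := hu.eq_zero hB h0 h1
  ext x
  exact congrFun this x

end Solutions

/-! ### A Fredholm criterion by matching solutions -/

lemma mem_schrodingerGraph_iff {U : ℝ → ℝ} {f g : L2R} :
    (f, g) ∈ schrodingerGraph L2R.incl U ↔ ∃ f₁ f₂ : L2R, HasWeakDeriv f f₁ ∧ HasWeakDeriv f₁ f₂ ∧
      ∀ᵐ x, g x = -f₂ x + (U x : ℂ) * f x := Iff.rfl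

lemma incl_injective : Function.Injective L2R.incl := fun _ _ h => Subtype.ext h

lemma lineOp_graph (U : ℝ → ℝ) : (lineOp U).graph = schrodingerGraph L2R.incl U :=
  schrodingerOn_graph _ incl_injective _

lemma mem_range_shifted {U : ℝ → ℝ} {z : ℂ} {f h : L2R}
    (hf : (f, h + z • f) ∈ schrodingerGraph L2R.incl U) :
    h ∈ LinearMap.range (shifted (lineOp U) z) := by
  rw [← lineOp_graph, LinearPMap.mem_graph_iff] at hf
  obtain ⟨y, hy1, hy2⟩ := hf
  refine ⟨y, ?_⟩
  change (lineOp U) y - z • (y : L2R) = h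
  rw [hy1, hy2, add_sub_cancel_right]

/-- Null functions agree almost everywhere with classical solutions, so the kernel embeds in the
image of a finite-dimensional space. -/
lemma finiteDimensional_ker_shifted {U : ℝ → ℝ} (hU : Continuous U) {B : ℝ}
    (hB : ∀ x, |U x| ≤ B) (E : ℝ) :
    FiniteDimensional ℂ (LinearMap.ker (shifted (lineOp U) E)) := by
  have hfin : FiniteDimensional ℂ (solutionSpace fun x => U x - E) :=
    finiteDimensional_solutionSpace (B := B + |E|) fun x =>
      (abs_sub _ _).trans (add_le_add_left (hB x) _)
  let J : LinearMap.ker (shifted (lineOp U) E) →ₗ[ℂ] Fn :=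
    L2R.incl ∘ₗ (lineOp U).domain.subtype ∘ₗ (LinearMap.ker (shifted (lineOp U) E)).subtype
  have hJ : Function.Injective J :=
    incl_injective.comp (Subtype.val_injective.comp Subtype.val_injective)
  let T : (solutionSpace fun x => U x - E) →ₗ[ℂ] Fn :=
    { toFun := fun u => AEEqFun.mk u.1 (by
        obtain ⟨u', hu⟩ := u.2
        exact hu.continuous.aestronglyMeasurable)
      map_add' := fun _ _ => rfl
      map_smul' := fun _ _ => rfl }
  have hmem : ∀ y, J y ∈ LinearMap.range T := by
    rintro ⟨y, hy⟩
    have hy' : (lineOp U) y = (E : ℂ) • (y : L2R) := sub_eq_zero.1 hy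
    have hg := LinearPMap.mem_graph (lineOp U) y
    rw [lineOp_graph, hy', mem_schrodingerGraph_iff] at hg
    obtain ⟨f₁, f₂, h1, h2, h3⟩ := hg
    obtain ⟨u, u', hu, hfu⟩ := exists_isSolution (q := fun x => U x - E)
      (hU.sub continuous_const) h1 h2 (by
        filter_upwards [h3, Lp.coeFn_smul (E : ℂ) (y : L2R)] with x hx hx'
        rw [hx', Pi.smul_apply, smul_eq_mul] at hx
        push_cast
        linear_combination hx)
    refine ⟨⟨u, u', hu⟩, AEEqFun.ext ?_⟩
    exact (AEEqFun.coeFn_mk _ _).trans hfu.symm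
  refine Module.Finite.of_injective (J.codRestrict (LinearMap.range T) hmem) fun x y hxy => ?_
  have h : J x = J y := congrArg (fun w : LinearMap.range T => (w : Fn)) hxy
  exact hJ h

/-- `f'' = q f - h` can be solved on `I`, linearly and boundedly in `h ∈ L²`. -/
def LocallySolvable (q : ℝ → ℝ) (I : Set ℝ) : Prop :=
  ∃ (C : ℝ) (u u' : L2R →ₗ[ℂ] (ℝ → ℂ)), ∀ h : L2R,
    IsPrimitiveOn I (u h) (u' h) ∧ IsPrimitiveOn I (u' h) (fun x => (q x : ℂ) * u h x - h x) ∧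
    MemLp (u h) 2 (volume.restrict I) ∧ MemLp (u' h) 2 (volume.restrict I) ∧
    ∀ x ∈ I, ‖u h x‖ ≤ C * ‖h‖ ∧ ‖u' h x‖ ≤ C * ‖h‖

/-- The potential may be altered freely off `J`. A whole-line result for a modified potential
thereby serves the original operator on a half-line. -/
lemma LocallySolvable.mono {q q' : ℝ → ℝ} {I J : Set ℝ} (hJ : J.OrdConnected)
    (h : LocallySolvable q I) (hJI : J ⊆ I) (hq : ∀ x ∈ J, q x = q' x) : LocallySolvable q' J := by
  obtain ⟨C, u, u', H⟩ := h
  refine ⟨C, u, u', fun g => ?_⟩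
  obtain ⟨h1, h2, h3, h4, h5⟩ := H g
  have hμ : (volume : Measure ℝ).restrict J ≤ volume.restrict I := Measure.restrict_mono hJI le_rfl
  refine ⟨h1.mono hJI, ?_, h3.mono_measure hμ, h4.mono_measure hμ, fun x hx => h5 x (hJI hx)⟩
  refine (h2.mono hJI).congr hJ (fun _ _ => rfl) (Filter.Eventually.of_forall fun x hx => ?_)
  rw [hq x hx]

lemma memLp_piecewise {u v : ℝ → ℂ} {a : ℝ} {I : Set ℝ}
    (hu : MemLp u 2 (volume.restrict (I ∩ Iic a)))
    (hv : MemLp v 2 (volume.restrict (I ∩ Ici a))) :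
    MemLp ((Iic a).piecewise u v) 2 (volume.restrict I) := by
  refine MemLp.piecewise measurableSet_Iic ?_ ?_
  · rwa [Measure.restrict_restrict measurableSet_Iic, inter_comm]
  · rw [Measure.restrict_restrict measurableSet_Iic.compl, inter_comm]
    have hsub : I ∩ (Iic a)ᶜ ⊆ I ∩ Ici a := fun x hx =>
      ⟨hx.1, (not_le.1 (show ¬x ≤ a from hx.2)).le⟩
    have hμ : (volume : Measure ℝ).restrict (I ∩ (Iic a)ᶜ) ≤ volume.restrict (I ∩ Ici a) :=
      Measure.restrict_mono hsub le_rfl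
    exact hv.mono_measure hμ

lemma piecewise_mul_sub {q : ℝ → ℝ} {h u v : ℝ → ℂ} {a : ℝ} :
    (Iic a).piecewise (fun x => (q x : ℂ) * u x - h x) (fun x => (q x : ℂ) * v x - h x)
      = fun x => (q x : ℂ) * (Iic a).piecewise u v x - h x := by
  ext x
  by_cases hx : x ∈ Iic a <;> simp [hx]

/-- If `f'' = (U - E) f - h` is solvable on two half-lines and on the interval between them, then
`-∂ₓ² + U - E` is Fredholm. -/
theorem notMem_essentialSpectrum {U : ℝ → ℝ} (hU : Continuous U) {B : ℝ}
    (hB : ∀ x, |U x| ≤ B) {E a b : ℝ} (hab : a ≤ b)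
    (hl : LocallySolvable (fun x => U x - E) (Iic a))
    (hm : LocallySolvable (fun x => U x - E) (Icc a b))
    (hr : LocallySolvable (fun x => U x - E) (Ici b)) :
    (E : ℂ) ∉ essentialSpectrum (lineOp U) := by
  obtain ⟨Cl, l, l', Hl⟩ := hl
  obtain ⟨Cm, m, m', Hm⟩ := hm
  obtain ⟨Cr, r, r', Hr⟩ := hr
  have eval : ∀ (C x : ℝ) (u : L2R →ₗ[ℂ] (ℝ → ℂ)), (∀ h, ‖u h x‖ ≤ C * ‖h‖) →
      ∃ L : L2R →L[ℂ] ℂ, ∀ h, L h = u h x := fun C x u hu =>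
    ⟨((LinearMap.proj x).comp u).mkContinuous C hu, fun _ => rfl⟩
  obtain ⟨e1, he1⟩ := eval Cl a l fun h => ((Hl h).2.2.2.2 a self_mem_Iic).1
  obtain ⟨e2, he2⟩ := eval Cl a l' fun h => ((Hl h).2.2.2.2 a self_mem_Iic).2
  obtain ⟨e3, he3⟩ := eval Cm a m fun h => ((Hm h).2.2.2.2 a ⟨le_rfl, hab⟩).1
  obtain ⟨e4, he4⟩ := eval Cm a m' fun h => ((Hm h).2.2.2.2 a ⟨le_rfl, hab⟩).2
  obtain ⟨e5, he5⟩ := eval Cm b m fun h => ((Hm h).2.2.2.2 b ⟨hab, le_rfl⟩).1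
  obtain ⟨e6, he6⟩ := eval Cm b m' fun h => ((Hm h).2.2.2.2 b ⟨hab, le_rfl⟩).2
  obtain ⟨e7, he7⟩ := eval Cr b r fun h => ((Hr h).2.2.2.2 b self_mem_Ici).1
  obtain ⟨e8, he8⟩ := eval Cr b r' fun h => ((Hr h).2.2.2.2 b self_mem_Ici).2
  -- The jumps of the value and of the derivative at the junctions `a` and `b`. When all four
  -- vanish, the three pieces glue to a preimage of `h` in the domain.
  set M : L2R →L[ℂ] (ℂ × ℂ) × (ℂ × ℂ) :=
    ((e1 - e3).prod (e2 - e4)).prod ((e5 - e7).prod (e6 - e8))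
  set R := LinearMap.range (shifted (lineOp U) E)
  have hker : LinearMap.ker M.toLinearMap ≤ R := by
    intro h hh
    have hh' : M h = 0 := hh
    have m1 : l h a = m h a := by
      rw [← he1, ← he3]; exact sub_eq_zero.1 (congrArg (fun p => p.1.1) hh')
    have m2 : l' h a = m' h a := by
      rw [← he2, ← he4]; exact sub_eq_zero.1 (congrArg (fun p => p.1.2) hh')
    have m3 : m h b = r h b := by
      rw [← he5, ← he7]; exact sub_eq_zero.1 (congrArg (fun p => p.2.1) hh')
    have m4 : m' h b = r' h b := by
      rw [← he6, ← he8]; exact sub_eq_zero.1 (congrArg (fun p => p.2.2) hh')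
    obtain ⟨l1, l2, l3, l4, -⟩ := Hl h
    obtain ⟨n1, n2, n3, n4, -⟩ := Hm h
    obtain ⟨r1, r2, r3, r4, -⟩ := Hr h
    have s1 : Iic b ∩ Iic a = Iic a := by rw [Iic_inter_Iic, min_eq_right hab]
    have s2 : Iic b ∩ Ici a = Icc a b := by rw [inter_comm, Ici_inter_Iic]
    -- If `a = b`, the point `b` belongs to `Iic a` and carries the left value; the matching at `a`
    -- makes the two values equal.
    have hmid : ∀ u v : ℝ → ℂ, u a = v a → ((Iic a).piecewise u v) b = v b := by
      intro u v huv
      rcases eq_or_lt_of_le hab with rfl | hlt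
      · simp [huv]
      · exact piecewise_eq_of_notMem _ _ _ (by simpa using hlt)
    have g1 := IsPrimitiveOn.glue (I := Iic b) ordConnected_Iic (a := a) hab
      (by rwa [s1]) (by rwa [s2]) m1 (u := l h) (v := m h) (f := l' h) (g := m' h)
    have g2 := IsPrimitiveOn.glue (I := Iic b) ordConnected_Iic (a := a) hab
      (by rwa [s1]) (by rwa [s2]) m2 (u := l' h) (v := m' h)
      (f := fun x => ((U x - E : ℝ) : ℂ) * l h x - h x)
      (g := fun x => ((U x - E : ℝ) : ℂ) * m h x - h x)
    rw [piecewise_mul_sub] at g2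
    have L1 := memLp_piecewise (I := Iic b) (by rwa [s1]) (by rwa [s2])
      (a := a) (u := l h) (v := m h)
    have L2 := memLp_piecewise (I := Iic b) (by rwa [s1]) (by rwa [s2])
      (a := a) (u := l' h) (v := m' h)
    have f1 := IsPrimitiveOn.glue (I := univ) ordConnected_univ (a := b) trivial
      (by rwa [univ_inter]) (by rwa [univ_inter]) ((hmid _ _ m1).trans m3)
      (u := (Iic a).piecewise (l h) (m h)) (v := r h)
      (f := (Iic a).piecewise (l' h) (m' h)) (g := r' h)
    have f2 := IsPrimitiveOn.glue (I := univ) ordConnected_univ (a := b) trivial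
      (by rwa [univ_inter]) (by rwa [univ_inter]) ((hmid _ _ m2).trans m4)
      (u := (Iic a).piecewise (l' h) (m' h)) (v := r' h)
      (f := fun x => ((U x - E : ℝ) : ℂ) * (Iic a).piecewise (l h) (m h) x - h x)
      (g := fun x => ((U x - E : ℝ) : ℂ) * r h x - h x)
    rw [piecewise_mul_sub] at f2
    have F1 := memLp_piecewise (I := univ) (by rwa [univ_inter])
      (by rwa [univ_inter]) (a := b) (u := (Iic a).piecewise (l h) (m h)) (v := r h)
    have F2 := memLp_piecewise (I := univ) (by rwa [univ_inter])
      (by rwa [univ_inter]) (a := b) (u := (Iic a).piecewise (l' h) (m' h)) (v := r' h)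
    rw [Measure.restrict_univ] at F1 F2
    set u := (Iic b).piecewise ((Iic a).piecewise (l h) (m h)) (r h)
    set u' := (Iic b).piecewise ((Iic a).piecewise (l' h) (m' h)) (r' h)
    have F3 : MemLp (fun x => ((U x - E : ℝ) : ℂ) * u x - h x) 2 volume := by
      refine MemLp.sub ?_ (Lp.memLp h)
      refine F1.of_le_mul (c := B + |E|) ?_ (Filter.Eventually.of_forall fun x => ?_)
      · exact (Complex.continuous_ofReal.comp
          (hU.sub continuous_const)).aestronglyMeasurable.mul F1.1
      · rw [norm_mul, Complex.norm_real]
        gcongr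
        exact (abs_sub _ _).trans (add_le_add_left (hB x) _)
    refine mem_range_shifted (f := F1.toLp) (mem_schrodingerGraph_iff.2
      ⟨F2.toLp, F3.toLp, ?_, ?_, ?_⟩)
    · exact f1.hasWeakDeriv.congr F1.coeFn_toLp.symm F2.coeFn_toLp.symm
    · exact f2.hasWeakDeriv.congr F2.coeFn_toLp.symm F3.coeFn_toLp.symm
    · filter_upwards [F1.coeFn_toLp, F3.coeFn_toLp, Lp.coeFn_add h ((E : ℂ) • F1.toLp),
        Lp.coeFn_smul (E : ℂ) F1.toLp] with x x1 x3 x4 x5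
      rw [x4, Pi.add_apply, x5, Pi.smul_apply, x1, x3, smul_eq_mul]
      push_cast
      ring
  simp only [essentialSpectrum, mem_ofPred_eq, not_not]
  refine ⟨finiteDimensional_ker_shifted hU hB E, ?_, ?_⟩
  -- As `R` contains `ker M`, it is the preimage under `M` of a subspace of a finite-dimensional
  -- space; this gives closedness.
  · have h1 : R = (R.map M.toLinearMap).comap M.toLinearMap := by
      rw [Submodule.comap_map_eq, sup_eq_left.2 hker]
    have h2 : IsClosed ((R.map M.toLinearMap : Submodule ℂ ((ℂ × ℂ) × (ℂ × ℂ))) :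
        Set ((ℂ × ℂ) × (ℂ × ℂ))) := Submodule.closed_of_finiteDimensional _
    change IsClosed (R : Set L2R)
    rw [h1]
    exact h2.preimage M.continuous
  · have : FiniteDimensional ℂ (L2R ⧸ LinearMap.ker M.toLinearMap) :=
      FiniteDimensional.of_injective _ (LinearMap.quotKerEquivRange M.toLinearMap).injective
    exact Module.Finite.of_surjective (Submodule.factor hker) (Submodule.factor_surjective hker)


/-! ### Local solvability on bounded intervals -/

lemma norm_smul_fst_add_smul_snd_le (a b : ℂ) :
    ‖a • ContinuousLinearMap.fst ℂ ℂ ℂ + b • ContinuousLinearMap.snd ℂ ℂ ℂ‖ ≤ ‖a‖ + ‖b‖ := by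
  refine (norm_add_le _ _).trans (add_le_add ?_ ?_)
  · rw [norm_smul]
    exact mul_le_of_le_one_right (norm_nonneg _) (ContinuousLinearMap.norm_fst_le ℂ ℂ ℂ)
  · rw [norm_smul]
    exact mul_le_of_le_one_right (norm_nonneg _) (ContinuousLinearMap.norm_snd_le ℂ ℂ ℂ)

/-- The weight `e^{-lx}` turns `y' = G y + g` into a system whose matrix `-l + G` is a perturbation
of `-l`. For large `l` the perturbation is small enough for `exists_solution_operator`, and on a
bounded interval the weight can be undone at the cost of a constant. -/
lemma locallySolvable_Icc {q : ℝ → ℝ} (hq : Continuous q) {B : ℝ} (hB : ∀ x, |q x| ≤ B)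
    (a b : ℝ) : LocallySolvable q (Icc a b) := by
  set β : ℝ := max 1 B
  have hβ : 1 ≤ β := le_max_left _ _
  -- With `A = -l` the inverse has norm at most `2 / l`, and `β * (2 / l) = 2 / 3 < 1`.
  set l : ℝ := 3 * β
  have hl : 0 < l := by positivity
  let G : ℝ → (ℂ × ℂ) →L[ℂ] ℂ × ℂ := fun x =>
    (ContinuousLinearMap.snd ℂ ℂ ℂ).prod ((q x : ℂ) • ContinuousLinearMap.fst ℂ ℂ ℂ)
  have hGc : Continuous G := by
    have h : Continuous fun x => (q x : ℂ) • ContinuousLinearMap.fst ℂ ℂ ℂ :=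
      (Complex.continuous_ofReal.comp hq).smul continuous_const
    exact (ContinuousLinearMap.prodₗᵢ (𝕜 := ℂ) ℂ).continuous.comp (continuous_const.prodMk h)
  have hGn : ∀ x, ‖G x‖ ≤ β := fun x => by
    refine ContinuousLinearMap.opNorm_le_bound _ (by positivity) fun v => ?_
    change ‖(v.2, (q x : ℂ) • v.1)‖ ≤ _
    rw [Prod.norm_mk, norm_smul, Complex.norm_real]
    refine max_le ?_ ?_
    · calc ‖v.2‖ ≤ 1 * ‖v‖ := by rw [one_mul]; exact norm_snd_le v
        _ ≤ _ := by gcongr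
    · exact mul_le_mul ((hB x).trans (le_max_right _ _)) (norm_fst_le v) (norm_nonneg _)
        (by positivity)
  obtain ⟨C, sol, hsol⟩ := exists_solution_operator (E := ℂ × ℂ) (α := l)
    (A := -((l : ℂ) • 1)) hl (fun v => by
      simp only [neg_apply, smul_apply, one_apply_eq_self, map_neg, map_smul, smul_smul, neg_neg,
        pow_two, smul_neg])
    (S := fun _ => 0) (S' := fun _ => 0) (M := fun x => -((l : ℂ) • 1) + G x)
    (fun x _ y _ => ⟨intervalIntegrable_const, by simp⟩) continuous_const
    (continuous_const.add hGc).aestronglyMeasurable (σ := 0) (β := β) (fun x => by simp)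
    (fun x => by
      have e : (0 : (ℂ × ℂ) →L[ℂ] ℂ × ℂ) + (1 + 0) * -((l : ℂ) • 1)
          - (-((l : ℂ) • 1) + G x) * (1 + 0) = -G x := by
        rw [add_zero, one_mul, mul_one]; abel
      rw [e, norm_neg]
      exact hGn x)
    (by
      have h1 : ‖-((l : ℂ) • (1 : (ℂ × ℂ) →L[ℂ] ℂ × ℂ))‖ / l ≤ 1 := by
        rw [norm_neg, norm_smul, Complex.norm_real, Real.norm_of_nonneg hl.le, div_le_one hl]
        exact mul_le_of_le_one_right hl.le ContinuousLinearMap.norm_id_le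
      have h2 : (1 + ‖-((l : ℂ) • (1 : (ℂ × ℂ) →L[ℂ] ℂ × ℂ))‖ / l) / l ≤ 2 / l := by
        gcongr; linarith
      have h3 : β * (2 / l) = 2 / 3 := by
        simp only [l]; field_simp
      have := mul_le_mul_of_nonneg_left h2 (by positivity : (0 : ℝ) ≤ β)
      linarith)
  -- The source `(0, -h)` multiplied by the weight, and cut off to `[a, b]` where the weight is
  -- bounded.
  let n : ℝ → ℂ × ℂ := (Icc a b).indicator fun x => (0, -(Real.exp (-(l * x)) : ℂ))
  let T : ℝ → ℂ →L[ℂ] ℂ × ℂ := fun x => ContinuousLinearMap.toSpanSingleton ℂ (n x)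
  have hnm : AEStronglyMeasurable n volume := by
    refine AEStronglyMeasurable.indicator (Continuous.aestronglyMeasurable ?_) measurableSet_Icc
    exact continuous_const.prodMk (Complex.continuous_ofReal.comp (by fun_prop)).neg
  have hTm : AEStronglyMeasurable T volume :=
    ContinuousLinearMap.toSpanSingletonCLE.continuous.comp_aestronglyMeasurable hnm
  have hTn : ∀ x, ‖T x‖ ≤ Real.exp (-(l * a)) := fun x => by
    rw [ContinuousLinearMap.norm_toSpanSingleton]
    refine (norm_indicator_le_of_subset subset_rfl _ x).trans ?_
    by_cases hx : x ∈ Icc a b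
    · simp only [indicator_of_mem hx, Prod.norm_mk, norm_zero, norm_neg, Complex.norm_real,
        Real.norm_of_nonneg (Real.exp_pos _).le]
      refine max_le (Real.exp_pos _).le (Real.exp_le_exp.2 ?_)
      have := mul_le_mul_of_nonneg_left hx.1 hl.le
      linarith
    · simp only [indicator_of_notMem hx, norm_zero]
      positivity
  obtain ⟨LT, hLTn, hLT⟩ := exists_mulOp hTm (Real.exp_pos _).le hTn
  have hexp : IsPrimitiveOn univ (fun x => Real.exp (l * x)) (fun x => l * Real.exp (l * x)) := by
    refine isPrimitiveOn_of_hasDerivAt (fun x => ?_) (by fun_prop)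
    have := ((hasDerivAt_id x).const_mul l).exp
    simpa [mul_comm] using this
  let mk : ((ℂ × ℂ) →L[ℂ] ℂ) → L2R →ₗ[ℂ] (ℝ → ℂ) := fun P =>
    { toFun := fun h x => P (Real.exp (l * x) • sol (LT h) x)
      map_add' := fun f g => by
        ext x
        simp only [map_add, Pi.add_apply, smul_add]
      map_smul' := fun c f => by
        ext x
        simp only [map_smul, Pi.smul_apply, RingHom.id_apply, smul_comm (Real.exp (l * x)) c] }
  have hmk : ∀ P h x, mk P h x = P (Real.exp (l * x) • sol (LT h) x) := fun _ _ _ => rfl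
  have hmk' : ∀ P h x, mk P h x = (Real.exp (l * x) : ℂ) • P (sol (LT h) x) := fun P h x => by
    rw [hmk, ← Complex.coe_smul, map_smul]
  have hbd : ∀ P : (ℂ × ℂ) →L[ℂ] ℂ, ‖P‖ ≤ 1 → ∀ h, ∀ x ∈ Icc a b,
      ‖mk P h x‖ ≤ Real.exp (l * b) * ‖sol (LT h) x‖ := by
    intro P hP h x hx
    rw [hmk', norm_smul, Complex.norm_real, Real.norm_of_nonneg (Real.exp_pos _).le]
    gcongr
    · exact hx.2
    · exact (P.le_opNorm _).trans (mul_le_of_le_one_left (norm_nonneg _) hP)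
  have hbd' : ∀ P : (ℂ × ℂ) →L[ℂ] ℂ, ‖P‖ ≤ 1 → ∀ h, ∀ x ∈ Icc a b,
      ‖mk P h x‖ ≤ (Real.exp (l * b) * (|C| * ‖LT‖)) * ‖h‖ := by
    intro P hP h x hx
    calc _ ≤ Real.exp (l * b) * ‖sol (LT h) x‖ := hbd P hP h x hx
      _ ≤ Real.exp (l * b) * (|C| * (‖LT‖ * ‖h‖)) := by
          gcongr
          refine ((hsol (LT h)).2.2 x).trans ?_
          gcongr
          · exact le_abs_self C
          · exact LT.le_opNorm h
      _ = _ := by ring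
  have hprim : ∀ h, IsPrimitiveOn univ (fun x => Real.exp (l * x) • sol (LT h) x)
      (fun x => G x (Real.exp (l * x) • sol (LT h) x) + Real.exp (l * x) • LT h x) := by
    intro h
    refine (hexp.smul (hsol (LT h)).1).congr ordConnected_univ (fun _ _ => rfl)
      (Filter.Eventually.of_forall fun x _ => ?_)
    simp only [← Complex.coe_smul, map_smul, add_apply, neg_apply, smul_apply, one_apply_eq_self]
    push_cast
    module
  have hmem : ∀ P : (ℂ × ℂ) →L[ℂ] ℂ, ‖P‖ ≤ 1 → ∀ h,
      MemLp (mk P h) 2 (volume.restrict (Icc a b)) := by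
    intro P hP h
    refine (((hsol (LT h)).2.1.restrict (Icc a b)).of_le_mul (c := Real.exp (l * b)) ?_ ?_)
    · exact (P.continuous.comp (hprim h).continuous).aestronglyMeasurable
    · exact (ae_restrict_iff' measurableSet_Icc).2
        (Filter.Eventually.of_forall fun x hx => hbd P hP h x hx)
  have hf := ContinuousLinearMap.norm_fst_le ℂ ℂ ℂ
  have hs := ContinuousLinearMap.norm_snd_le ℂ ℂ ℂ
  refine ⟨_, mk (ContinuousLinearMap.fst ℂ ℂ ℂ), mk (ContinuousLinearMap.snd ℂ ℂ ℂ), fun h =>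
    ⟨?_, ?_, hmem _ hf h, hmem _ hs h, fun x hx => ⟨hbd' _ hf h x hx, hbd' _ hs h x hx⟩⟩⟩
  · refine (((hprim h).clm ((ContinuousLinearMap.fst ℂ ℂ ℂ).restrictScalars ℝ)).mono
      (subset_univ _)).congr ordConnected_Icc (fun _ _ => rfl) ?_
    filter_upwards [hLT h] with x hx hxI
    rw [hx]
    simp [hmk, G, T, n, indicator_of_mem hxI]
  · refine (((hprim h).clm ((ContinuousLinearMap.snd ℂ ℂ ℂ).restrictScalars ℝ)).mono
      (subset_univ _)).congr ordConnected_Icc (fun _ _ => rfl) ?_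
    filter_upwards [hLT h] with x hx hxI
    have e : (Real.exp (l * x) : ℂ) * (Real.exp (-(l * x)) : ℂ) = 1 := by
      rw [← Complex.ofReal_mul, ← Real.exp_add, add_neg_cancel, Real.exp_zero, Complex.ofReal_one]
    rw [hx]
    simp only [hmk, G, T, n, indicator_of_mem hxI, ContinuousLinearMap.coe_restrictScalars',
      map_add, ← Complex.coe_smul, map_smul, ContinuousLinearMap.prod_apply, smul_apply,
      ContinuousLinearMap.coe_snd', ContinuousLinearMap.coe_fst', smul_eq_mul,
      ContinuousLinearMap.toSpanSingleton_apply, Prod.smul_mk]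
    linear_combination -(h x) * e


/-! ### Periodic frames and averaging -/

/-- Two bounded solutions of `u'' = q u` with Wronskian `w ≠ 0` whose products are one-periodic. -/
structure PeriodicFrame (q : ℝ → ℝ) where
  u : ℝ → ℂ
  u' : ℝ → ℂ
  v : ℝ → ℂ
  v' : ℝ → ℂ
  sol_u : IsSolution q u u'
  sol_v : IsSolution q v v'
  w : ℂ
  w_ne : w ≠ 0
  wronskian : ∀ x, u x * v' x - u' x * v x = w
  K : ℝ
  bound_u : ∀ x, ‖u x‖ ≤ K
  bound_u' : ∀ x, ‖u' x‖ ≤ K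
  bound_v : ∀ x, ‖v x‖ ≤ K
  bound_v' : ∀ x, ‖v' x‖ ≤ K
  periodic_uu : Function.Periodic (fun x => u x * u x) 1
  periodic_uv : Function.Periodic (fun x => u x * v x) 1
  periodic_vv : Function.Periodic (fun x => v x * v x) 1

namespace PeriodicFrame

variable {q : ℝ → ℝ} (F : PeriodicFrame q)

lemma K_nonneg : 0 ≤ F.K := (norm_nonneg _).trans (F.bound_u 0)

/-- The functional `c ↦ u c₁ + v c₂`. -/
noncomputable def row (x : ℝ) : (ℂ × ℂ) →L[ℂ] ℂ :=
  F.u x • ContinuousLinearMap.fst ℂ ℂ ℂ + F.v x • ContinuousLinearMap.snd ℂ ℂ ℂ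

/-- The functional `c ↦ u' c₁ + v' c₂`. -/
noncomputable def row' (x : ℝ) : (ℂ × ℂ) →L[ℂ] ℂ :=
  F.u' x • ContinuousLinearMap.fst ℂ ℂ ℂ + F.v' x • ContinuousLinearMap.snd ℂ ℂ ℂ

/-- The vector with `row x (col x) = 0` and `row' x (col x) = 1`. -/
noncomputable def col (x : ℝ) : ℂ × ℂ := (F.w⁻¹ * -F.v x, F.w⁻¹ * F.u x)

/-- The rank-one matrix which couples the amplitudes. -/
noncomputable def coupling (x : ℝ) : (ℂ × ℂ) →L[ℂ] ℂ × ℂ := (F.row x).smulRight (F.col x)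

lemma row_apply (x : ℝ) (c : ℂ × ℂ) : F.row x c = F.u x * c.1 + F.v x * c.2 := rfl

lemma row'_apply (x : ℝ) (c : ℂ × ℂ) : F.row' x c = F.u' x * c.1 + F.v' x * c.2 := rfl

lemma coupling_apply (x : ℝ) (c : ℂ × ℂ) : F.coupling x c = F.row x c • F.col x := rfl

/-- With `row'_col`, this is variation of constants: moving the amplitudes along `col` leaves `f`
unchanged and changes `f'` at unit rate. -/
lemma row_col (x : ℝ) : F.row x (F.col x) = 0 := by
  rw [row_apply, col]; ring

lemma row'_col (x : ℝ) : F.row' x (F.col x) = 1 := by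
  rw [row'_apply, col]
  have h := F.wronskian x
  have := F.w_ne
  field_simp
  linear_combination h

lemma continuous_row : Continuous F.row :=
  (F.sol_u.continuous.smul continuous_const).add (F.sol_v.continuous.smul continuous_const)

lemma continuous_row' : Continuous F.row' :=
  (F.sol_u.continuous_deriv.smul continuous_const).add
    (F.sol_v.continuous_deriv.smul continuous_const)

lemma continuous_col : Continuous F.col :=
  (continuous_const.mul F.sol_v.continuous.neg).prodMk (continuous_const.mul F.sol_u.continuous)

lemma continuous_coupling : Continuous F.coupling :=
  ((ContinuousLinearMap.smulRightL ℂ (ℂ × ℂ) (ℂ × ℂ)).continuous.comp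
    F.continuous_row).clm_apply F.continuous_col

lemma norm_row_le (x : ℝ) : ‖F.row x‖ ≤ 2 * F.K :=
  (norm_smul_fst_add_smul_snd_le _ _).trans (by linarith [F.bound_u x, F.bound_v x])

lemma norm_row'_le (x : ℝ) : ‖F.row' x‖ ≤ 2 * F.K :=
  (norm_smul_fst_add_smul_snd_le _ _).trans (by linarith [F.bound_u' x, F.bound_v' x])

lemma norm_col_le (x : ℝ) : ‖F.col x‖ ≤ ‖F.w⁻¹‖ * F.K := by
  rw [col, Prod.norm_mk, norm_mul, norm_mul, norm_neg]
  exact max_le (by gcongr; exact F.bound_v x) (by gcongr; exact F.bound_u x)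

/-- A bound for the norm of the coupling matrix. -/
noncomputable def bound : ℝ := 2 * F.K * (‖F.w⁻¹‖ * F.K)

lemma bound_nonneg : 0 ≤ F.bound := by
  have := F.K_nonneg
  unfold bound
  positivity

lemma norm_coupling_le (x : ℝ) : ‖F.coupling x‖ ≤ F.bound := by
  rw [coupling, ContinuousLinearMap.norm_smulRight_apply]
  have := F.K_nonneg
  exact mul_le_mul (F.norm_row_le x) (F.norm_col_le x) (norm_nonneg _) (by positivity)

lemma coupling_eq (x : ℝ) (c : ℂ × ℂ) :
    F.coupling x c = (F.w⁻¹ * -(F.u x * F.v x * c.1 + F.v x * F.v x * c.2),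
      F.w⁻¹ * (F.u x * F.u x * c.1 + F.u x * F.v x * c.2)) := by
  rw [coupling_apply, row_apply, col, Prod.smul_mk, smul_eq_mul, smul_eq_mul]
  exact Prod.ext (by ring) (by ring)

/-- The entries involve only products of two frame functions, so antiperiodic frames also give a
one-periodic matrix. -/
lemma periodic_coupling : Function.Periodic F.coupling 1 := by
  intro x
  refine ContinuousLinearMap.ext fun c => ?_
  have h1 := F.periodic_uu x
  have h2 := F.periodic_uv x
  have h3 := F.periodic_vv x
  beta_reduce at h1 h2 h3
  rw [coupling_eq, coupling_eq, h1, h2, h3]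

/-- Solvability of the system for the amplitudes `c` in `f = u c₁ + v c₂` gives solvability of
`f'' = (q + ρ) f - h`. -/
lemma locallySolvable (hq : Continuous q) {ρ : ℝ → ℝ} {C : ℝ}
    {sol : Lp (ℂ × ℂ) 2 (volume : Measure ℝ) →ₗ[ℂ] (ℝ → ℂ × ℂ)}
    (hsol : ∀ g, IsPrimitiveOn univ (sol g) (fun x => ((ρ x : ℂ) • F.coupling x) (sol g x) + g x) ∧
      MemLp (sol g) 2 volume ∧ ∀ x, ‖sol g x‖ ≤ C * ‖g‖) :
    LocallySolvable (fun x => q x + ρ x) univ := by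
  have hK := F.K_nonneg
  let T : ℝ → ℂ →L[ℂ] ℂ × ℂ := fun x => ContinuousLinearMap.toSpanSingleton ℂ (-F.col x)
  have hTm : AEStronglyMeasurable T volume :=
    ContinuousLinearMap.toSpanSingletonCLE.continuous.comp_aestronglyMeasurable
      F.continuous_col.neg.aestronglyMeasurable
  have hTn : ∀ x, ‖T x‖ ≤ ‖F.w⁻¹‖ * F.K := fun x => by
    rw [ContinuousLinearMap.norm_toSpanSingleton, norm_neg]
    exact F.norm_col_le x
  obtain ⟨LT, hLTn, hLT⟩ := exists_mulOp hTm (by positivity) hTn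
  let mk : (ℝ → (ℂ × ℂ) →L[ℂ] ℂ) → L2R →ₗ[ℂ] (ℝ → ℂ) := fun P =>
    { toFun := fun h x => P x (sol (LT h) x)
      map_add' := fun f g => by
        ext x
        simp only [map_add, Pi.add_apply]
      map_smul' := fun c f => by
        ext x
        simp only [map_smul, Pi.smul_apply, RingHom.id_apply] }
  have hmem : ∀ P : ℝ → (ℂ × ℂ) →L[ℂ] ℂ, Continuous P → (∀ x, ‖P x‖ ≤ 2 * F.K) → ∀ h,
      MemLp (mk P h) 2 (volume.restrict univ) := by
    intro P hPc hP h
    rw [Measure.restrict_univ]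
    refine (hsol (LT h)).2.1.of_le_mul (c := 2 * F.K) ?_ (Filter.Eventually.of_forall fun x => ?_)
    · exact (hPc.clm_apply (hsol (LT h)).1.continuous).aestronglyMeasurable
    · exact ((P x).le_opNorm _).trans (by gcongr; exact hP x)
  have hbd : ∀ P : ℝ → (ℂ × ℂ) →L[ℂ] ℂ, (∀ x, ‖P x‖ ≤ 2 * F.K) → ∀ h x,
      ‖mk P h x‖ ≤ (2 * F.K * (|C| * ‖LT‖)) * ‖h‖ := by
    intro P hP h x
    calc ‖mk P h x‖ ≤ ‖P x‖ * ‖sol (LT h) x‖ := (P x).le_opNorm _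
      _ ≤ 2 * F.K * (|C| * (‖LT‖ * ‖h‖)) := by
          gcongr
          · exact hP x
          · refine ((hsol (LT h)).2.2 x).trans ?_
            gcongr
            · exact le_abs_self C
            · exact LT.le_opNorm h
      _ = _ := by ring
  have hrow : IsPrimitiveOn univ F.row F.row' := by
    refine isPrimitiveOn_of_hasDerivAt (fun x => ?_) F.continuous_row'
    exact ((F.sol_u x).1.smul_const (ContinuousLinearMap.fst ℂ ℂ ℂ)).add
      ((F.sol_v x).1.smul_const (ContinuousLinearMap.snd ℂ ℂ ℂ))
  refine ⟨_, mk F.row, mk F.row', fun h => ⟨?_, ?_, hmem _ F.continuous_row F.norm_row_le h,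
    hmem _ F.continuous_row' F.norm_row'_le h,
    fun x _ => ⟨hbd _ F.norm_row_le h x, hbd _ F.norm_row'_le h x⟩⟩⟩
  -- Since `row` annihilates `col`, the derivative of `f = row c` is `row' c`. In the second
  -- derivative `row' col = 1` produces the terms `ρ f - h`.
  · refine (hrow.apply (hsol (LT h)).1).congr ordConnected_univ (fun _ _ => rfl) ?_
    filter_upwards [hLT h] with x hx _
    rw [hx, map_add, smul_apply, coupling_apply, map_smul, map_smul, row_col]
    simp only [T, ContinuousLinearMap.toSpanSingleton_apply, map_smul, map_neg, row_col,
      smul_zero, neg_zero, add_zero]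
    rfl
  · have hder : ∀ x, HasDerivAt F.row' ((q x : ℂ) • F.row x) x := fun x => by
      rw [row, smul_add, smul_smul, smul_smul]
      exact ((F.sol_u x).2.smul_const (ContinuousLinearMap.fst ℂ ℂ ℂ)).add
        ((F.sol_v x).2.smul_const (ContinuousLinearMap.snd ℂ ℂ ℂ))
    have hprod := (isPrimitiveOn_of_hasDerivAt hder
      ((Complex.continuous_ofReal.comp hq).smul F.continuous_row)).apply (hsol (LT h)).1
    refine hprod.congr ordConnected_univ (fun _ _ => rfl) ?_
    filter_upwards [hLT h] with x hx _
    rw [hx, map_add, smul_apply, smul_apply, coupling_apply, map_smul, map_smul, row'_col]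
    simp only [T, ContinuousLinearMap.toSpanSingleton_apply, map_smul, map_neg, row'_col,
      smul_eq_mul]
    change _ = ((q x + ρ x : ℝ) : ℂ) * F.row x (sol (LT h) x) - h x
    push_cast
    ring

/-- The average of `p` times the coupling matrix over a period. -/
noncomputable def average (p : ℝ → ℝ) : (ℂ × ℂ) →L[ℂ] ℂ × ℂ :=
  ∫ x in (0 : ℝ)..1, (p x : ℂ) • F.coupling x

/-- If the average of `p` times the coupling matrix squares to `a² > 0`, then the equation with
potential `q + δ p` is solvable on the line for all small `δ`, and stays so under perturbations
which are small compared with `δ`. All constants depend only on bounds for `p` and `a`. -/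
theorem exists_threshold (hq : Continuous q) (B a₀ : ℝ) (ha₀ : 0 < a₀) :
    ∃ δ₀ > 0, ∃ ε > 0, ∀ δ, 0 < δ → δ < δ₀ → ∀ p : ℝ → ℝ, Continuous p →
      Function.Periodic p 1 → (∀ x, |p x| ≤ B) → ∀ a, a₀ ≤ a →
      (∀ c, F.average p (F.average p c) = ((a : ℂ) ^ 2) • c) →
      ∀ ρ : ℝ → ℝ, AEStronglyMeasurable ρ volume → (∀ x, |ρ x - δ * p x| ≤ δ * ε) →
      LocallySolvable (fun x => q x + ρ x) univ := by
  -- No `p` is bounded by a negative number.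
  wlog hB : 0 ≤ B
  · refine ⟨1, one_pos, 1, one_pos, fun δ _ _ p _ _ hp => ?_⟩
    exact absurd ((abs_nonneg _).trans (hp 0)) hB
  have hn := F.bound_nonneg
  set n := F.bound
  set L := B * n
  have hL : 0 ≤ L := by positivity
  set c₀ := (1 + L / a₀) / a₀
  have hc₀ : 0 < c₀ := by positivity
  -- The contraction constant will be at most `ε n c₀ + δ X`, and `ε` and `δ₀` make each term at
  -- most `1 / 4`. The minimum with `1` ensures `|ρ| ≤ δ (B + 1)`.
  set ε := min 1 (1 / (4 * (n * c₀ + 1)))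
  have hε : 0 < ε := by positivity
  set X := 2 * L + (2 * L * L + (B + 1) * n * (2 * L)) * c₀
  have hX : 0 ≤ X := by positivity
  refine ⟨1 / (4 * (X + 1)), by positivity, ε, hε, ?_⟩
  intro δ hδ hδ₀ p hpc hper hpB a ha hA ρ hρ hρp
  have hapos : 0 < a := ha₀.trans_le ha
  set A := F.average p
  have hpN : Continuous fun x => (p x : ℂ) • F.coupling x :=
    (Complex.continuous_ofReal.comp hpc).smul F.continuous_coupling
  have hpNn : ∀ x, ‖(p x : ℂ) • F.coupling x‖ ≤ L := fun x => by
    rw [norm_smul, Complex.norm_real]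
    exact mul_le_mul (hpB x) (F.norm_coupling_le x) (norm_nonneg _) hB
  have hAn : ‖A‖ ≤ L := by
    have := intervalIntegral.norm_integral_le_of_norm_le_const (a := 0) (b := 1)
      (f := fun x => (p x : ℂ) • F.coupling x) (C := L) fun x _ => hpNn x
    simpa [A, average] using this
  have hS' : Continuous fun x => (p x : ℂ) • F.coupling x - A := hpN.sub continuous_const
  set S : ℝ → (ℂ × ℂ) →L[ℂ] ℂ × ℂ := fun x => ∫ t in (0 : ℝ)..x, ((p t : ℂ) • F.coupling t - A)
  have hSprim : IsPrimitiveOn univ S fun x => (p x : ℂ) • F.coupling x - A :=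
    isPrimitiveOn_integral (fun a b => hS'.intervalIntegrable a b) 0
  -- Subtracting the average makes the integrand have mean zero, so its primitive is periodic and
  -- hence bounded independently of `δ`.
  have hSper : Function.Periodic S 1 := by
    have hp : Function.Periodic (fun x => (p x : ℂ) • F.coupling x - A) 1 := fun x => by
      beta_reduce
      rw [hper x, F.periodic_coupling x]
    intro x
    have h1 := (hSprim x trivial (x + 1) trivial).2
    rw [hp.intervalIntegral_add_eq x 0, zero_add, intervalIntegral.integral_sub
      (hpN.intervalIntegrable _ _) intervalIntegrable_const] at h1
    rw [← sub_eq_zero, h1]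
    simp [A, average]
  have hSn : ∀ x, ‖S x‖ ≤ 2 * L := by
    intro x
    have e : S x = S (Int.fract x) := by
      have := hSper.sub_zsmul_eq ⌊x⌋ (x := x)
      rw [← this, zsmul_one, Int.self_sub_floor]
    rw [e]
    have h0 := Int.fract_nonneg x
    have h1 := (Int.fract_lt_one x).le
    have := intervalIntegral.norm_integral_le_of_norm_le_const (a := 0) (b := Int.fract x)
      (f := fun x => (p x : ℂ) • F.coupling x - A) (C := 2 * L) fun t _ =>
        (norm_sub_le _ _).trans (by linarith [hpNn t])
    refine this.trans ?_
    rw [sub_zero, abs_of_nonneg h0]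
    exact mul_le_of_le_one_right (by positivity) h1
  have hρB : ∀ x, |ρ x| ≤ δ * (B + 1) := fun x => by
    have h1 : |δ * p x| ≤ δ * B := by
      rw [abs_mul, abs_of_pos hδ]
      exact mul_le_mul_of_nonneg_left (hpB x) hδ.le
    have h2 : δ * ε ≤ δ * 1 := mul_le_mul_of_nonneg_left (min_le_left _ _) hδ.le
    calc |ρ x| = |(ρ x - δ * p x) + δ * p x| := by ring_nf
      _ ≤ |ρ x - δ * p x| + |δ * p x| := abs_add_le _ _
      _ ≤ _ := by linarith [hρp x]
  have hα : 0 < δ * a := mul_pos hδ hapos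
  have hδS' : Continuous fun x => (δ : ℂ) • ((p x : ℂ) • F.coupling x - A) :=
    hS'.const_smul (δ : ℂ)
  obtain ⟨C, sol, hsol⟩ := exists_solution_operator (E := ℂ × ℂ) (α := δ * a)
    (A := (δ : ℂ) • A) hα (fun c => by
      rw [smul_apply, smul_apply, map_smul, hA c, smul_smul, smul_smul]
      congr 1
      push_cast
      ring)
    (S := fun x => (δ : ℂ) • S x) (S' := fun x => (δ : ℂ) • ((p x : ℂ) • F.coupling x - A))
    (M := fun x => (ρ x : ℂ) • F.coupling x)
    (hSprim.clm (((δ : ℂ) • ContinuousLinearMap.id ℂ ((ℂ × ℂ) →L[ℂ] ℂ × ℂ)).restrictScalars ℝ))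
    hδS'
    ((Complex.continuous_ofReal.comp_aestronglyMeasurable hρ).smul
      F.continuous_coupling.aestronglyMeasurable)
    (σ := δ * (2 * L)) (β := δ * ε * n + δ ^ 2 * (2 * L * L + (B + 1) * n * (2 * L)))
    (fun x => by
      rw [norm_smul, Complex.norm_real, Real.norm_of_nonneg hδ.le]
      exact mul_le_mul_of_nonneg_left (hSn x) hδ.le)
    (fun x => by
      -- By the choice of `S` the terms of order `δ` cancel, apart from the deviation of `ρ` from `δ
      -- p`. What remains can absorb the factor `c₀ / δ` of the Green operator.
      have e : (δ : ℂ) • ((p x : ℂ) • F.coupling x - A) + (1 + (δ : ℂ) • S x) * (δ : ℂ) • A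
          - (ρ x : ℂ) • F.coupling x * (1 + (δ : ℂ) • S x)
          = -((ρ x - δ * p x : ℝ) : ℂ) • F.coupling x + ((δ : ℂ) ^ 2) • (S x * A)
            - ((ρ x : ℂ) * δ) • (F.coupling x * S x) := by
        refine ContinuousLinearMap.ext fun c => ?_
        simp only [sub_apply, add_apply, smul_apply, mul_apply_eq_comp, one_apply_eq_self,
          map_add, map_smul]
        push_cast
        module
      rw [e]
      have t1 : ‖-((ρ x - δ * p x : ℝ) : ℂ) • F.coupling x‖ ≤ δ * ε * n := by
        rw [norm_smul, norm_neg, Complex.norm_real]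
        exact mul_le_mul (hρp x) (F.norm_coupling_le x) (norm_nonneg _) (by positivity)
      have t2 : ‖((δ : ℂ) ^ 2) • (S x * A)‖ ≤ δ ^ 2 * (2 * L * L) := by
        rw [norm_smul, norm_pow, Complex.norm_real, Real.norm_of_nonneg hδ.le]
        gcongr
        exact (norm_mul_le _ _).trans (mul_le_mul (hSn x) hAn (norm_nonneg _) (by positivity))
      have t3 : ‖((ρ x : ℂ) * δ) • (F.coupling x * S x)‖ ≤
          δ * (B + 1) * δ * (n * (2 * L)) := by
        rw [norm_smul, norm_mul, Complex.norm_real, Complex.norm_real, Real.norm_of_nonneg hδ.le]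
        refine mul_le_mul (mul_le_mul_of_nonneg_right (hρB x) hδ.le) ?_ (norm_nonneg _)
          (by positivity)
        exact (norm_mul_le _ _).trans
          (mul_le_mul (F.norm_coupling_le x) (hSn x) (norm_nonneg _) hn)
      refine (norm_sub_le _ _).trans ((add_le_add (norm_add_le _ _) le_rfl).trans ?_)
      calc _ ≤ δ * ε * n + δ ^ 2 * (2 * L * L) + δ * (B + 1) * δ * (n * (2 * L)) :=
            add_le_add (add_le_add t1 t2) t3
        _ = _ := by ring)
    (by
      have h1 : ‖(δ : ℂ) • A‖ / (δ * a) ≤ L / a₀ := by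
        rw [norm_smul, Complex.norm_real, Real.norm_of_nonneg hδ.le,
          mul_div_mul_left _ _ hδ.ne']
        gcongr
      have h2 : (1 + ‖(δ : ℂ) • A‖ / (δ * a)) / (δ * a) ≤ c₀ / δ := by
        calc _ ≤ (1 + L / a₀) / (δ * a₀) := by gcongr
          _ = c₀ / δ := by simp only [c₀]; field_simp
      have h3 : (δ * ε * n + δ ^ 2 * (2 * L * L + (B + 1) * n * (2 * L))) *
          ((1 + ‖(δ : ℂ) • A‖ / (δ * a)) / (δ * a)) ≤
          (δ * ε * n + δ ^ 2 * (2 * L * L + (B + 1) * n * (2 * L))) * (c₀ / δ) := by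
        gcongr
      have h4 : (δ * ε * n + δ ^ 2 * (2 * L * L + (B + 1) * n * (2 * L))) * (c₀ / δ)
          = ε * (n * c₀) + δ * ((2 * L * L + (B + 1) * n * (2 * L)) * c₀) := by
        field_simp
      have h5 : ε * (n * c₀) ≤ 1 / 4 := by
        have hpos : 0 < n * c₀ + 1 := by positivity
        calc ε * (n * c₀) ≤ 1 / (4 * (n * c₀ + 1)) * (n * c₀ + 1) :=
              mul_le_mul (min_le_right _ _) (by linarith) (by positivity) (by positivity)
          _ = 1 / 4 := by field_simp
      have h6 : δ * X ≤ 1 / 4 := by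
        calc δ * X ≤ 1 / (4 * (X + 1)) * (X + 1) :=
              mul_le_mul hδ₀.le (by linarith) hX (by positivity)
          _ = 1 / 4 := by field_simp
      have h7 : δ * X = δ * (2 * L) +
          δ * ((2 * L * L + (B + 1) * n * (2 * L)) * c₀) := by simp only [X]; ring
      linarith)
  exact F.locallySolvable hq hsol

end PeriodicFrame


/-! ### Cosine series -/

lemma continuous_of_hasSum_cos {v c : ℕ → ℝ} {V : ℝ → ℝ} (hv : Summable fun m => |v m|)
    (h : ∀ x, HasSum (fun m => v m * Real.cos (c m * x)) (V x)) :
    Continuous V ∧ ∃ B, ∀ x, |V x| ≤ B := by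
  have hle : ∀ m x, ‖v m * Real.cos (c m * x)‖ ≤ |v m| := fun m x => by
    rw [norm_mul, Real.norm_eq_abs, Real.norm_eq_abs]
    exact mul_le_of_le_one_right (abs_nonneg _) (Real.abs_cos_le_one _)
  have e : V = fun x => ∑' m, v m * Real.cos (c m * x) := funext fun x => (h x).tsum_eq.symm
  refine ⟨?_, ∑' m, |v m|, fun x => ?_⟩
  · rw [e]
    exact continuous_tsum (fun m => by fun_prop) hv hle
  · rw [e]
    exact tsum_of_norm_bounded hv.hasSum fun m => hle m x

lemma IsEvenCosineSeries.continuous {V : ℝ → ℝ} (h : IsEvenCosineSeries V) :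
    Continuous V ∧ ∃ B, ∀ x, |V x| ≤ B := by
  obtain ⟨v, hv, hV⟩ := h
  exact continuous_of_hasSum_cos hv hV

lemma IsOddCosineSeries.continuous {W : ℝ → ℝ} (h : IsOddCosineSeries W) :
    Continuous W ∧ ∃ B, ∀ x, |W x| ≤ B := by
  obtain ⟨w, hw, hW⟩ := h
  exact continuous_of_hasSum_cos hw hW

lemma IsEvenCosineSeries.add_half {V : ℝ → ℝ} (h : IsEvenCosineSeries V) (x : ℝ) :
    V (x + 1 / 2) = V x := by
  obtain ⟨v, -, hV⟩ := h
  refine (hV (x + 1 / 2)).unique ?_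
  have e : ∀ m : ℕ, 2 * Real.pi * (2 * (m : ℝ)) * (x + 1 / 2)
      = 2 * Real.pi * (2 * (m : ℝ)) * x + m * (2 * Real.pi) := fun m => by ring
  simp only [e, Real.cos_add_nat_mul_two_pi]
  exact hV x

/-- Half a period shifts each phase by an odd multiple of `π`. -/
lemma IsOddCosineSeries.add_half {W : ℝ → ℝ} (h : IsOddCosineSeries W) (x : ℝ) :
    W (x + 1 / 2) = -W x := by
  obtain ⟨w, -, hW⟩ := h
  refine (hW (x + 1 / 2)).unique ?_
  have e : ∀ m : ℕ, 2 * Real.pi * (2 * (m : ℝ) + 1) * (x + 1 / 2)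
      = 2 * Real.pi * (2 * (m : ℝ) + 1) * x + Real.pi + m * (2 * Real.pi) := fun m => by ring
  simp only [e, Real.cos_add_nat_mul_two_pi, Real.cos_add_pi, mul_neg]
  exact (hW x).neg

/-! ### Algebra of solutions -/

section Solutions

variable {q : ℝ → ℝ} {u u' v v' f f' : ℝ → ℂ}

lemma IsSolution.wronskian_eq (hu : IsSolution q u u') (hv : IsSolution q v v') (x y : ℝ) :
    u x * v' x - u' x * v x = u y * v' y - u' y * v y := by
  have hd : ∀ t, HasDerivAt (fun t => u t * v' t - u' t * v t) 0 t := fun t => by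
    have e : (0 : ℂ) = (u' t * v' t + u t * (q t * v t)) - (q t * u t * v t + u' t * v' t) := by
      ring
    rw [e]
    exact ((hu t).1.mul (hv t).2).sub ((hu t).2.mul (hv t).1)
  exact is_const_of_deriv_eq_zero (fun t => (hd t).differentiableAt) (fun t => (hd t).deriv) x y

/-- Two solutions with nonzero Wronskian span all solutions. -/
lemma IsSolution.exists_combination (hu : IsSolution q u u') (hv : IsSolution q v v') {w : ℂ}
    (hw : w ≠ 0) (hW : ∀ x, u x * v' x - u' x * v x = w) (hf : IsSolution q f f') :
    ∃ a b : ℂ, ∀ x, f x = a * u x + b * v x ∧ f' x = a * u' x + b * v' x := by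
  refine ⟨(f 0 * v' 0 - f' 0 * v 0) / w, (u 0 * f' 0 - u' 0 * f 0) / w, fun x => ?_⟩
  rw [← hf.wronskian_eq hv x 0, ← hu.wronskian_eq hf x 0]
  constructor
  · field_simp
    linear_combination (-f x) * hW x
  · field_simp
    linear_combination (-f' x) * hW x

/-- The coefficient is real. This permits expressing conjugates of frame functions in the frame
itself. -/
lemma IsSolution.conj (hu : IsSolution q u u') :
    IsSolution q (fun x => conj (u x)) (fun x => conj (u' x)) := by
  have key : ∀ {f : ℝ → ℂ} {f' : ℂ} {x : ℝ}, HasDerivAt f f' x →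
      HasDerivAt (fun x => conj (f x)) (conj f') x := fun {f f' x} h =>
    (Complex.conjCLE.toContinuousLinearMap.hasFDerivAt (x := f x)).comp_hasDerivAt x h
  refine fun x => ⟨key (hu x).1, ?_⟩
  have := key (hu x).2
  rwa [map_mul, Complex.conj_ofReal] at this

lemma IsSolution.comp_add_const (hu : IsSolution q u u') {a : ℝ} (hq : ∀ x, q (x + a) = q x) :
    IsSolution q (fun x => u (x + a)) (fun x => u' (x + a)) := fun x =>
  ⟨(hu (x + a)).1.comp_add_const x a, by
    have := (hu (x + a)).2.comp_add_const x a
    rwa [hq] at this⟩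

end Solutions

/-- Elements of the Bloch space are classical pseudo-periodic solutions. -/
lemma exists_isSolution_of_mem_blochSpace {V : ℝ → ℝ} (hV : Continuous V) {k E : ℝ} {f : L2k k}
    (hf : f ∈ blochSpace V k E) :
    ∃ u u', IsSolution (fun x => V x - E) u u' ∧ (f.1 : ℝ → ℂ) =ᵐ[volume] u ∧
      ∀ x, u (x + 1) = Complex.exp (Complex.I * k) * u x := by
  obtain ⟨y, hy, rfl⟩ := hf
  have hker : shifted (hillOp V k) E y = 0 := hy
  have hy' : (hillOp V k) y = (E : ℂ) • (y : L2k k) := sub_eq_zero.1 hker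
  have hgraph : (hillOp V k).graph = schrodingerGraph (L2k k).subtype V :=
    schrodingerOn_graph _ (Submodule.injective_subtype _) V
  have hg := LinearPMap.mem_graph (hillOp V k) y
  rw [hgraph] at hg
  obtain ⟨f₁, f₂, h1, h2, h3⟩ := hg
  have h3' : ∀ᵐ x, ((E : ℂ) • ((y : L2k k) : Fn) : Fn) x
      = -(f₂ : Fn) x + (V x : ℂ) * ((y : L2k k) : Fn) x := by
    filter_upwards [h3] with x hx
    have e : ((E : ℂ) • ((y : L2k k) : Fn) : Fn) = (((hillOp V k) y : L2k k) : Fn) := by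
      rw [hy']; rfl
    rw [e]
    exact hx
  obtain ⟨u, u', hu, hfu⟩ := exists_isSolution (q := fun x => V x - E)
    (hV.sub continuous_const) h1 h2 (by
      filter_upwards [h3', AEEqFun.coeFn_smul (E : ℂ) ((y : L2k k) : Fn)] with x hx hx'
      rw [hx', Pi.smul_apply, smul_eq_mul] at hx
      change (f₂ : Fn) x = ((V x - E : ℝ) : ℂ) * ((y : L2k k) : Fn) x
      push_cast
      linear_combination hx)
  refine ⟨u, u', hu, hfu, fun x => ?_⟩
  -- Pseudo-periodicity is known almost everywhere and extends to every point by continuity.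
  have hae : (fun x => u (x + 1)) =ᵐ[volume] fun x => Complex.exp (Complex.I * k) * u x := by
    have hfu' := (measurePreserving_add_right volume (1 : ℝ)).quasiMeasurePreserving.ae hfu
    filter_upwards [hfu, hfu', (y : L2k k).2.2] with x e1 e2 e3
    change ((y : L2k k) : Fn) x = u x at e1
    change ((y : L2k k) : Fn) (x + 1) = u (x + 1) at e2
    rw [← e1, ← e2, e3]
  exact congrFun ((Continuous.ae_eq_iff_eq volume
    (hu.continuous.comp (continuous_id.add continuous_const))
    (continuous_const.mul hu.continuous)).1 hae) x

/-! ### Integrals over a period -/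

lemma integral_combination_two {f g : ℝ → ℂ} (hf : Continuous f) (hg : Continuous g) (a b : ℂ) :
    ∫ x in (0 : ℝ)..1, (a * f x + b * g x)
      = a * (∫ x in (0 : ℝ)..1, f x) + b * ∫ x in (0 : ℝ)..1, g x := by
  rw [intervalIntegral.integral_add ((hf.intervalIntegrable _ _).const_mul _)
    ((hg.intervalIntegrable _ _).const_mul _), intervalIntegral.integral_const_mul,
    intervalIntegral.integral_const_mul]

lemma integral_combination_four {f g h l : ℝ → ℂ} (hf : Continuous f) (hg : Continuous g)
    (hh : Continuous h) (hl : Continuous l) (a b c d : ℂ) :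
    ∫ x in (0 : ℝ)..1, (a * f x + b * g x + (c * h x + d * l x))
      = a * (∫ x in (0 : ℝ)..1, f x) + b * (∫ x in (0 : ℝ)..1, g x) +
        (c * (∫ x in (0 : ℝ)..1, h x) + d * ∫ x in (0 : ℝ)..1, l x) := by
  have h1 : Continuous fun x => a * f x + b * g x := by fun_prop
  have h2 : Continuous fun x => c * h x + d * l x := by fun_prop
  rw [intervalIntegral.integral_add (h1.intervalIntegrable _ _) (h2.intervalIntegrable _ _),
    integral_combination_two hf hg, integral_combination_two hh hl]

namespace PeriodicFrame

variable {q : ℝ → ℝ} (F : PeriodicFrame q)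

/-- The squared average is scalar, given by the Gram determinant of `p`. -/
lemma average_average {p : ℝ → ℝ} (hp : Continuous p) (c : ℂ × ℂ) :
    F.average p (F.average p c) = ((F.w⁻¹) ^ 2 *
      ((∫ x in (0 : ℝ)..1, (p x : ℂ) * (F.u x * F.v x)) ^ 2 -
        (∫ x in (0 : ℝ)..1, (p x : ℂ) * (F.u x * F.u x)) *
        ∫ x in (0 : ℝ)..1, (p x : ℂ) * (F.v x * F.v x))) • c := by
  have hu := F.sol_u.continuous
  have hv := F.sol_v.continuous
  have hp' : Continuous fun x => (p x : ℂ) := Complex.continuous_ofReal.comp hp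
  have hint : IntervalIntegrable (fun x => (p x : ℂ) • F.coupling x) volume 0 1 :=
    (hp'.smul F.continuous_coupling).intervalIntegrable _ _
  -- The averaged matrix has trace zero, so by Cayley–Hamilton its square is minus its determinant.
  have key : ∀ c : ℂ × ℂ, F.average p c =
      (-F.w⁻¹ * c.1 * (∫ x in (0 : ℝ)..1, (p x : ℂ) * (F.u x * F.v x)) +
        -F.w⁻¹ * c.2 * (∫ x in (0 : ℝ)..1, (p x : ℂ) * (F.v x * F.v x)),
      F.w⁻¹ * c.1 * (∫ x in (0 : ℝ)..1, (p x : ℂ) * (F.u x * F.u x)) +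
        F.w⁻¹ * c.2 * (∫ x in (0 : ℝ)..1, (p x : ℂ) * (F.u x * F.v x))) := by
    intro c
    have hL : ∀ P : (ℂ × ℂ) →L[ℂ] ℂ,
        P (F.average p c) = ∫ x in (0 : ℝ)..1, P (((p x : ℂ) • F.coupling x) c) := fun P => by
      let L : ((ℂ × ℂ) →L[ℂ] ℂ × ℂ) →L[ℂ] ℂ := P.comp (ContinuousLinearMap.apply ℂ (ℂ × ℂ) c)
      exact (ContinuousLinearMap.intervalIntegral_comp_comm (𝕜 := ℂ) L hint).symm
    refine Prod.ext ?_ ?_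
    · rw [show (F.average p c).1 = _ from hL (ContinuousLinearMap.fst ℂ ℂ ℂ)]
      dsimp only
      rw [← integral_combination_two (by fun_prop) (by fun_prop)]
      refine intervalIntegral.integral_congr fun x _ => ?_
      simp only [smul_apply, coupling_eq, Prod.smul_mk, ContinuousLinearMap.coe_fst', smul_eq_mul]
      ring
    · rw [show (F.average p c).2 = _ from hL (ContinuousLinearMap.snd ℂ ℂ ℂ)]
      dsimp only
      rw [← integral_combination_two (by fun_prop) (by fun_prop)]
      refine intervalIntegral.integral_congr fun x _ => ?_
      simp only [smul_apply, coupling_eq, Prod.smul_mk, ContinuousLinearMap.coe_snd', smul_eq_mul]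
      ring
  rw [key (F.average p c), key c]
  refine Prod.ext ?_ ?_ <;> simp only [Prod.smul_fst, Prod.smul_snd, smul_eq_mul] <;> ring

end PeriodicFrame


/-! ### The frame of a Dirac point -/

lemma exists_norm_le_of_periodic {f : ℝ → ℂ} (hf : Continuous f) {T : ℝ} (hT : T ≠ 0)
    (h : Function.Periodic f T) : ∃ K, ∀ x, ‖f x‖ ≤ K := by
  obtain ⟨K, hK⟩ := (h.isBounded_of_continuous hT hf).exists_norm_le
  exact ⟨K, fun x => hK _ (mem_range_self x)⟩

/-- A Dirac point provides a frame which is orthonormal in `L²[0,1]` and pseudo-periodic. -/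
lemma DiracPoint.exists_frame {V W : ℝ → ℝ} (hV : Continuous V) (hVb : ∃ B, ∀ x, |V x| ≤ B)
    {k E : ℝ} (D : DiracPoint V k E) :
    ∃ (F : PeriodicFrame fun x => V x - E) (μ : ℂ), ‖μ‖ = 1 ∧
      (∀ x, F.u (x + 1) = μ * F.u x) ∧ (∀ x, F.v (x + 1) = μ * F.v x) ∧
      ∫ x in (0 : ℝ)..1, conj (F.u x) * F.u x = 1 ∧
      ∫ x in (0 : ℝ)..1, conj (F.v x) * F.v x = 1 ∧
      ∫ x in (0 : ℝ)..1, conj (F.u x) * F.v x = 0 ∧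
      ∫ x in (0 : ℝ)..1, (W x : ℂ) * (conj (F.u x) * F.v x) = D.theta W := by
  obtain ⟨B, hB⟩ := hVb
  have hB' : ∀ x, |V x - E| ≤ B + |E| := fun x =>
    (abs_sub _ _).trans (add_le_add_left (hB x) _)
  have m1 : D.Φ₁ ∈ blochSpace V k E := D.span_eq ▸ Submodule.subset_span (by simp)
  have m2 : D.Φ₂ ∈ blochSpace V k E := D.span_eq ▸ Submodule.subset_span (by simp)
  obtain ⟨u, u', hu, hΦu, hu1⟩ := exists_isSolution_of_mem_blochSpace hV m1
  obtain ⟨v, v', hv, hΦv, hv1⟩ := exists_isSolution_of_mem_blochSpace hV m2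
  have hcell : ∀ {f g f₀ g₀ : ℝ → ℂ}, f =ᵐ[volume] f₀ → g =ᵐ[volume] g₀ →
      cellInner f g = ∫ x in (0 : ℝ)..1, conj (f₀ x) * g₀ x := by
    intro f g f₀ g₀ h1 h2
    refine intervalIntegral.integral_congr_ae ?_
    filter_upwards [h1, h2] with x e1 e2 _
    rw [e1, e2]
  have i11 := (hcell hΦu hΦu).symm.trans D.inner₁₁
  have i22 := (hcell hΦv hΦv).symm.trans D.inner₂₂
  have i12 := (hcell hΦu hΦv).symm.trans D.inner₁₂
  have iθ : ∫ x in (0 : ℝ)..1, (W x : ℂ) * (conj (u x) * v x) = D.theta W := by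
    have h2 : (fun x => (W x : ℂ) * D.Φ₂.1 x) =ᵐ[volume] fun x => (W x : ℂ) * v x := by
      filter_upwards [hΦv] with x e
      rw [e]
    rw [DiracPoint.theta, hcell hΦu h2]
    refine intervalIntegral.integral_congr fun x _ => ?_
    ring
  have huc := hu.continuous
  have hvc := hv.continuous
  have hμ : ‖Complex.exp (Complex.I * k)‖ = 1 := by
    rw [mul_comm]; exact Complex.norm_exp_ofReal_mul_I k
  set μ := Complex.exp (Complex.I * k)
  have indep : ∀ a b : ℂ, (∀ x, a * u x + b * v x = 0) → a = 0 ∧ b = 0 := by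
    intro a b hab
    have h1 : ∫ x in (0 : ℝ)..1, conj (u x) * (a * u x + b * v x) = 0 := by simp [hab]
    have h2 : ∫ x in (0 : ℝ)..1, conj (a * u x + b * v x) * v x = 0 := by simp [hab]
    have e1 : ∫ x in (0 : ℝ)..1, conj (u x) * (a * u x + b * v x)
        = a * (∫ x in (0 : ℝ)..1, conj (u x) * u x) + b * ∫ x in (0 : ℝ)..1, conj (u x) * v x := by
      rw [← integral_combination_two (by fun_prop) (by fun_prop)]
      exact intervalIntegral.integral_congr fun x _ => by ring
    have e2 : ∫ x in (0 : ℝ)..1, conj (a * u x + b * v x) * v x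
        = conj a * (∫ x in (0 : ℝ)..1, conj (u x) * v x) +
          conj b * ∫ x in (0 : ℝ)..1, conj (v x) * v x := by
      rw [← integral_combination_two (by fun_prop) (by fun_prop)]
      exact intervalIntegral.integral_congr fun x _ => by simp only [map_add, map_mul]; ring
    rw [e1, i11, i12] at h1
    rw [e2, i12, i22] at h2
    exact ⟨by simpa using h1, by simpa using h2⟩
  -- If the Wronskian vanished, the coefficients `(v, -u)` and `(v', -u')` taken at `0` would give
  -- combinations with zero Cauchy data. Independence then forces `u` to have zero data as well, a
  -- contradiction.
  have hw : u 0 * v' 0 - u' 0 * v 0 ≠ 0 := by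
    intro hw
    have hz : ∀ a b : ℂ, a * u 0 + b * v 0 = 0 → a * u' 0 + b * v' 0 = 0 → a = 0 ∧ b = 0 := by
      intro a b h1 h2
      have := ((hu.const_mul a).add (hv.const_mul b)).eq_zero hB' h1 h2
      exact indep a b (congrFun this)
    obtain ⟨-, h1⟩ := hz (v 0) (-u 0) (by ring) (by linear_combination -hw)
    obtain ⟨-, h2⟩ := hz (v' 0) (-u' 0) (by linear_combination hw) (by ring)
    exact one_ne_zero (hz 1 0 (by linear_combination -h1) (by linear_combination -h2)).1
  have hwr : ∀ x, u x * v' x - u' x * v x = u 0 * v' 0 - u' 0 * v 0 := fun x =>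
    hu.wronskian_eq hv x 0
  have deriv_add_one : ∀ {f f' : ℝ → ℂ}, IsSolution (fun x => V x - E) f f' →
      (∀ x, f (x + 1) = μ * f x) → ∀ x, f' (x + 1) = μ * f' x := by
    intro f f' hf h x
    have h1 := (hf (x + 1)).1.comp_add_const x 1
    have h2 := (hf x).1.const_mul μ
    have e : (fun x => f (x + 1)) = fun x => μ * f x := funext h
    rw [e] at h1
    exact h1.unique h2
  have hu1' := deriv_add_one hu hu1
  have hv1' := deriv_add_one hv hv1
  -- A unit shift multiplies the constant Wronskian by `μ²`. The frame is thus periodic or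
  -- antiperiodic, in either case two-periodic.
  have hμ2 : μ * μ = 1 := by
    have h := hwr (0 + 1)
    rw [hu1, hu1', hv1, hv1'] at h
    refine mul_right_cancel₀ hw ?_
    linear_combination h
  have bounded : ∀ {f : ℝ → ℂ}, Continuous f → (∀ x, f (x + 1) = μ * f x) →
      ∃ K, ∀ x, ‖f x‖ ≤ K := by
    intro f hf h
    refine exists_norm_le_of_periodic hf two_ne_zero fun x => ?_
    rw [← one_add_one_eq_two, ← add_assoc, h, h, ← mul_assoc, hμ2, one_mul]
  obtain ⟨K1, h1⟩ := bounded huc hu1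
  obtain ⟨K2, h2⟩ := bounded hu.continuous_deriv hu1'
  obtain ⟨K3, h3⟩ := bounded hvc hv1
  obtain ⟨K4, h4⟩ := bounded hv.continuous_deriv hv1'
  have periodic : ∀ {f g : ℝ → ℂ}, (∀ x, f (x + 1) = μ * f x) → (∀ x, g (x + 1) = μ * g x) →
      Function.Periodic (fun x => f x * g x) 1 := by
    intro f g hf hg x
    beta_reduce
    rw [hf, hg]
    linear_combination f x * g x * hμ2
  exact ⟨{
    u := u
    u' := u'
    v := v
    v' := v'
    sol_u := hu
    sol_v := hv
    w := u 0 * v' 0 - u' 0 * v 0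
    w_ne := hw
    wronskian := hwr
    K := max (max K1 K2) (max K3 K4)
    bound_u := fun x => (h1 x).trans ((le_max_left _ _).trans (le_max_left _ _))
    bound_u' := fun x => (h2 x).trans ((le_max_right _ _).trans (le_max_left _ _))
    bound_v := fun x => (h3 x).trans ((le_max_left _ _).trans (le_max_right _ _))
    bound_v' := fun x => (h4 x).trans ((le_max_right _ _).trans (le_max_right _ _))
    periodic_uu := periodic hu1 hu1
    periodic_uv := periodic hu1 hv1
    periodic_vv := periodic hv1 hv1 }, μ, hμ, hu1, hv1, i11, i22, i12, iθ⟩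

/-! ### Trace and eigenvalues of the averaged coupling. -/

namespace PeriodicFrame

variable {q : ℝ → ℝ} (F : PeriodicFrame q)

lemma conj_gram {wt : ℝ → ℝ} (f g : ℝ → ℂ) :
    conj (∫ x in (0 : ℝ)..1, (wt x : ℂ) * (conj (f x) * g x))
      = ∫ x in (0 : ℝ)..1, (wt x : ℂ) * (conj (g x) * f x) := by
  rw [intervalIntegral.integral_of_le zero_le_one, ← integral_conj,
    ← intervalIntegral.integral_of_le zero_le_one]
  refine intervalIntegral.integral_congr fun x _ => ?_
  simp only [map_mul, Complex.conj_ofReal, Complex.conj_conj]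
  ring

/-- A weight which changes sign under the half-period shift has trace zero. -/
lemma trace_eq_zero (hq : ∀ x, q (x + 1 / 2) = q x) {W : ℝ → ℝ} (hWc : Continuous W)
    (hW : ∀ x, W (x + 1 / 2) = -W x) {μ : ℂ} (hμ : ‖μ‖ = 1)
    (hu : ∀ x, F.u (x + 1) = μ * F.u x) (hv : ∀ x, F.v (x + 1) = μ * F.v x)
    (huu : ∫ x in (0 : ℝ)..1, conj (F.u x) * F.u x = 1)
    (hvv : ∫ x in (0 : ℝ)..1, conj (F.v x) * F.v x = 1)
    (huv : ∫ x in (0 : ℝ)..1, conj (F.u x) * F.v x = 0) :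
    (∫ x in (0 : ℝ)..1, (W x : ℂ) * (conj (F.u x) * F.u x)) +
      ∫ x in (0 : ℝ)..1, (W x : ℂ) * (conj (F.v x) * F.v x) = 0 := by
  have huc := F.sol_u.continuous
  have hvc := F.sol_v.continuous
  have hμ2 : conj μ * μ = 1 := by
    rw [mul_comm, Complex.mul_conj, Complex.normSq_eq_norm_sq, hμ]; simp
  -- The half-period shift maps solutions to solutions. Its matrix in the orthonormal frame is
  -- unitary (weight `1`, sign `1`) and conjugates the Gram matrix of `W` into its negative (weight
  -- `W`, sign `-1`), so the trace equals its own negative.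
  obtain ⟨a, b, hab⟩ := F.sol_u.exists_combination F.sol_v F.w_ne F.wronskian
    (F.sol_u.comp_add_const hq)
  obtain ⟨c, d, hcd⟩ := F.sol_u.exists_combination F.sol_v F.w_ne F.wronskian
    (F.sol_v.comp_add_const hq)
  -- the Gram integrals of the shifted functions
  have shift : ∀ {wt : ℝ → ℝ} {e : ℂ}, (∀ x, (wt (x + 1 / 2) : ℂ) = e * wt x) → e * e = 1 →
      ∀ {f g : ℝ → ℂ}, (∀ x, f (x + 1) = μ * f x) → (∀ x, g (x + 1) = μ * g x) →
      ∫ x in (0 : ℝ)..1, (wt x : ℂ) * (conj (f (x + 1 / 2)) * g (x + 1 / 2))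
        = e * ∫ x in (0 : ℝ)..1, (wt x : ℂ) * (conj (f x) * g x) := by
    intro wt e hwt he f g hf hg
    have hper : Function.Periodic (fun x => (wt x : ℂ) * (conj (f x) * g x)) 1 := fun x => by
      have : (wt (x + 1) : ℂ) = wt x := by
        rw [show x + 1 = x + 1 / 2 + 1 / 2 by ring, hwt, hwt, ← mul_assoc, he, one_mul]
      beta_reduce
      rw [this, hf, hg, map_mul]
      linear_combination (wt x : ℂ) * (conj (f x) * g x) * hμ2
    have h1 : ∫ x in (0 : ℝ)..1, (wt (x + 1 / 2) : ℂ) * (conj (f (x + 1 / 2)) * g (x + 1 / 2))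
        = ∫ x in (0 : ℝ)..1, (wt x : ℂ) * (conj (f x) * g x) := by
      rw [intervalIntegral.integral_comp_add_right
        (fun x => (wt x : ℂ) * (conj (f x) * g x)) (1 / 2), zero_add, add_comm (1 : ℝ),
        hper.intervalIntegral_add_eq (1 / 2) 0, zero_add]
    rw [← h1, ← intervalIntegral.integral_const_mul]
    refine intervalIntegral.integral_congr fun x _ => ?_
    rw [hwt]
    linear_combination -((wt x : ℂ) * (conj (f (x + 1 / 2)) * g (x + 1 / 2))) * he
  have expand : ∀ {wt : ℝ → ℝ}, Continuous wt → ∀ (a b c d : ℂ),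
      ∫ x in (0 : ℝ)..1, (wt x : ℂ) * (conj (a * F.u x + b * F.v x) * (c * F.u x + d * F.v x))
        = conj a * c * (∫ x in (0 : ℝ)..1, (wt x : ℂ) * (conj (F.u x) * F.u x)) +
          conj a * d * (∫ x in (0 : ℝ)..1, (wt x : ℂ) * (conj (F.u x) * F.v x)) +
          (conj b * c * (∫ x in (0 : ℝ)..1, (wt x : ℂ) * (conj (F.v x) * F.u x)) +
          conj b * d * ∫ x in (0 : ℝ)..1, (wt x : ℂ) * (conj (F.v x) * F.v x)) := by
    intro wt hwt a b c d
    have hwt' : Continuous fun x => (wt x : ℂ) := Complex.continuous_ofReal.comp hwt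
    rw [← integral_combination_four (by fun_prop) (by fun_prop) (by fun_prop) (by fun_prop)]
    refine intervalIntegral.integral_congr fun x _ => ?_
    simp only [map_add, map_mul]
    ring
  have hvu : ∫ x in (0 : ℝ)..1, conj (F.v x) * F.u x = 0 := by
    have := conj_gram (wt := fun _ => 1) F.u F.v
    simp only [Complex.ofReal_one, one_mul, huv, map_zero] at this
    exact this.symm
  have one_shift : ∀ _ : ℝ, ((1 : ℝ) : ℂ) = 1 * ((1 : ℝ) : ℂ) := fun _ => (one_mul _).symm
  have g1 := shift (wt := fun _ => 1) one_shift (one_mul 1) hu hu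
  have g2 := shift (wt := fun _ => 1) one_shift (one_mul 1) hu hv
  have g3 := shift (wt := fun _ => 1) one_shift (one_mul 1) hv hv
  simp only [(hab _).1, (hcd _).1] at g1 g2 g3
  rw [expand continuous_const] at g1 g2 g3
  simp only [Complex.ofReal_one, one_mul, huu, huv, hvv, hvu, mul_zero, mul_one, add_zero,
    zero_add] at g1 g2 g3
  have w1 := shift (wt := W) (e := -1) (fun x => by rw [hW]; push_cast; ring) (by ring) hu hu
  have w2 := shift (wt := W) (e := -1) (fun x => by rw [hW]; push_cast; ring) (by ring) hv hv
  simp only [(hab _).1, (hcd _).1] at w1 w2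
  rw [expand hWc] at w1 w2
  have g4 : conj c * a + conj d * b = 0 := by
    have := congrArg conj g2
    simp only [map_add, map_mul, Complex.conj_conj, map_zero] at this
    linear_combination this
  -- orthonormal rows have orthonormal columns
  have hmat : (!![conj a, conj b; conj c, conj d] : Matrix (Fin 2) (Fin 2) ℂ) * !![a, c; b, d]
      = 1 := by
    rw [Matrix.mul_fin_two, Matrix.one_fin_two, g1, g2, g3, g4]
  have hmat' := mul_eq_one_comm.1 hmat
  rw [Matrix.mul_fin_two, Matrix.one_fin_two] at hmat'
  have c1 : a * conj a + c * conj c = 1 := by simpa using congrFun (congrFun hmat' 0) 0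
  have c2 : a * conj b + c * conj d = 0 := by simpa using congrFun (congrFun hmat' 0) 1
  have c3 : b * conj a + d * conj c = 0 := by simpa using congrFun (congrFun hmat' 1) 0
  have c4 : b * conj b + d * conj d = 1 := by simpa using congrFun (congrFun hmat' 1) 1
  set X := ∫ x in (0 : ℝ)..1, (W x : ℂ) * (conj (F.u x) * F.u x)
  set Y := ∫ x in (0 : ℝ)..1, (W x : ℂ) * (conj (F.v x) * F.v x)
  set Z := ∫ x in (0 : ℝ)..1, (W x : ℂ) * (conj (F.u x) * F.v x)
  set Z' := ∫ x in (0 : ℝ)..1, (W x : ℂ) * (conj (F.v x) * F.u x)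
  have h2 : (2 : ℂ) * (X + Y) = 0 := by
    linear_combination w1 + w2 - X * c1 - Z' * c2 - Z * c3 - Y * c4
  exact (mul_eq_zero.1 h2).resolve_left two_ne_zero

/-- The averaged coupling matrix of `κ W - s` has real eigenvalues `±a` away from zero when `s` is
small compared with the off-diagonal entry of `W`. -/
lemma exists_average_average {W : ℝ → ℝ} (hWc : Continuous W)
    (huu : ∫ x in (0 : ℝ)..1, conj (F.u x) * F.u x = 1)
    (hvv : ∫ x in (0 : ℝ)..1, conj (F.v x) * F.v x = 1)
    (huv : ∫ x in (0 : ℝ)..1, conj (F.u x) * F.v x = 0) {θ : ℂ}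
    (hθ : ∫ x in (0 : ℝ)..1, (W x : ℂ) * (conj (F.u x) * F.v x) = θ)
    (htr : (∫ x in (0 : ℝ)..1, (W x : ℂ) * (conj (F.u x) * F.u x)) +
      ∫ x in (0 : ℝ)..1, (W x : ℂ) * (conj (F.v x) * F.v x) = 0)
    {κ s r : ℝ} (h : (r * ‖F.w‖) ^ 2 ≤ κ ^ 2 * ‖θ‖ ^ 2 - s ^ 2) :
    ∃ a, r ≤ a ∧ ∀ c, F.average (fun x => κ * W x - s) (F.average (fun x => κ * W x - s) c)
      = ((a : ℂ) ^ 2) • c := by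
  have huc := F.sol_u.continuous
  have hvc := F.sol_v.continuous
  have hWc' : Continuous fun x => (W x : ℂ) := Complex.continuous_ofReal.comp hWc
  set p : ℝ → ℝ := fun x => κ * W x - s
  have hp : Continuous p := (continuous_const.mul hWc).sub continuous_const
  have hp' : Continuous fun x => (p x : ℂ) := Complex.continuous_ofReal.comp hp
  obtain ⟨a, b, hab⟩ := F.sol_u.exists_combination F.sol_v F.w_ne F.wronskian F.sol_u.conj
  obtain ⟨c, d, hcd⟩ := F.sol_u.exists_combination F.sol_v F.w_ne F.wronskian F.sol_v.conj
  -- Conjugating the Wronskian identity shows that the change of basis to the conjugate frame has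
  -- determinant `conj w / w`.
  have hdet : conj F.w = (a * d - b * c) * F.w := by
    have h0 := F.wronskian 0
    have h1 := congrArg conj h0
    simp only [map_sub, map_mul, (hab 0).1, (hab 0).2, (hcd 0).1, (hcd 0).2] at h1
    rw [← h1, ← h0]
    ring
  have hsplit : ∀ {f g : ℝ → ℂ}, Continuous f → Continuous g →
      ∫ x in (0 : ℝ)..1, (p x : ℂ) * (conj (f x) * g x)
        = κ * (∫ x in (0 : ℝ)..1, (W x : ℂ) * (conj (f x) * g x)) +
          (-s : ℂ) * ∫ x in (0 : ℝ)..1, conj (f x) * g x := by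
    intro f g hf hg
    rw [← integral_combination_two (by fun_prop) (by fun_prop)]
    refine intervalIntegral.integral_congr fun x _ => ?_
    simp only [p]
    push_cast
    ring
  have hcomb : ∀ (a b : ℂ) {f g : ℝ → ℂ}, Continuous g →
      (∀ x, conj (f x) = a * F.u x + b * F.v x) →
      ∫ x in (0 : ℝ)..1, (p x : ℂ) * (conj (f x) * g x)
        = a * (∫ x in (0 : ℝ)..1, (p x : ℂ) * (F.u x * g x)) +
          b * ∫ x in (0 : ℝ)..1, (p x : ℂ) * (F.v x * g x) := by
    intro a b f g hg hf
    rw [← integral_combination_two (by fun_prop) (by fun_prop)]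
    refine intervalIntegral.integral_congr fun x _ => ?_
    rw [hf]
    ring
  have hvu : ∫ x in (0 : ℝ)..1, conj (F.v x) * F.u x = 0 := by
    have := conj_gram (wt := fun _ => 1) F.u F.v
    simp only [Complex.ofReal_one, one_mul, huv, map_zero] at this
    exact this.symm
  have p1 := (hcomb a b huc fun x => (hab x).1).symm.trans (hsplit huc huc)
  have p2 := (hcomb a b hvc fun x => (hab x).1).symm.trans (hsplit huc hvc)
  have p3 := (hcomb c d huc fun x => (hcd x).1).symm.trans (hsplit hvc huc)
  have p4 := (hcomb c d hvc fun x => (hcd x).1).symm.trans (hsplit hvc hvc)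
  have hθ' : ∫ x in (0 : ℝ)..1, (W x : ℂ) * (conj (F.v x) * F.u x) = conj θ := by
    rw [← hθ, conj_gram]
  have hreal : conj (∫ x in (0 : ℝ)..1, (W x : ℂ) * (conj (F.u x) * F.u x))
      = ∫ x in (0 : ℝ)..1, (W x : ℂ) * (conj (F.u x) * F.u x) := conj_gram F.u F.u
  obtain ⟨X, hX⟩ := Complex.conj_eq_iff_real.1 hreal
  have hY : ∫ x in (0 : ℝ)..1, (W x : ℂ) * (conj (F.v x) * F.v x) = -(X : ℂ) := by
    rw [← hX]; linear_combination htr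
  have hsymm : ∫ x in (0 : ℝ)..1, (p x : ℂ) * (F.v x * F.u x)
      = ∫ x in (0 : ℝ)..1, (p x : ℂ) * (F.u x * F.v x) := by
    simp only [mul_comm (F.v _)]
  rw [hX, huu, hsymm] at p1
  rw [hθ, huv] at p2
  rw [hθ', hvu, hsymm] at p3
  rw [hY, hvv] at p4
  set Quu := ∫ x in (0 : ℝ)..1, (p x : ℂ) * (F.u x * F.u x)
  set Quv := ∫ x in (0 : ℝ)..1, (p x : ℂ) * (F.u x * F.v x)
  set Qvv := ∫ x in (0 : ℝ)..1, (p x : ℂ) * (F.v x * F.v x)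
  have hw := F.w_ne
  have hwn : 0 < ‖F.w‖ := norm_pos_iff.2 hw
  -- Minus the determinant of the Hermitian Gram matrix of `p`, which has diagonal `κ X - s`, `-κ X
  -- - s` and off-diagonal `κ θ`, `κ conj θ`. The term in `X` only helps the lower bound.
  set R : ℝ := κ ^ 2 * X ^ 2 + κ ^ 2 * ‖θ‖ ^ 2 - s ^ 2
  have hR : (r * ‖F.w‖) ^ 2 ≤ R := by
    have : 0 ≤ κ ^ 2 * X ^ 2 := by positivity
    simp only [R]
    linarith
  have hθn : θ * conj θ = ((‖θ‖ ^ 2 : ℝ) : ℂ) := by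
    rw [Complex.mul_conj, Complex.normSq_eq_norm_sq]
  have hwc : F.w * conj F.w = ((‖F.w‖ ^ 2 : ℝ) : ℂ) := by
    rw [Complex.mul_conj, Complex.normSq_eq_norm_sq]
  -- The Hermitian Gram matrix is the change-of-basis matrix times the bilinear one, so determinants
  -- multiply. With `hdet` the phase of `w²` cancels and a real value is left.
  have key : (a * d - b * c) * (Quv ^ 2 - Quu * Qvv) = (R : ℂ) := by
    have hR' : (R : ℂ) = (κ : ℂ) ^ 2 * X ^ 2 + κ ^ 2 * (θ * conj θ) - s ^ 2 := by
      rw [hθn]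
      simp only [R]
      push_cast
      ring
    rw [hR']
    linear_combination (-(c * Quv + d * Qvv)) * p1 - (κ * X + -s * 1 : ℂ) * p4 +
      (c * Quu + d * Quv) * p2 + (κ * θ : ℂ) * p3
  have hval : (F.w⁻¹) ^ 2 * (Quv ^ 2 - Quu * Qvv) = ((R / ‖F.w‖ ^ 2 : ℝ) : ℂ) := by
    rw [Complex.ofReal_div, ← hwc, ← key, hdet]
    have hd0 : a * d - b * c ≠ 0 := by
      intro h0
      rw [h0, zero_mul] at hdet
      exact hw ((map_eq_zero _).1 hdet)
    field_simp
  have hR0 : 0 ≤ R := (sq_nonneg _).trans hR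
  refine ⟨√(R / ‖F.w‖ ^ 2), ?_, fun z => ?_⟩
  · refine Real.le_sqrt_of_sq_le ?_
    rw [le_div_iff₀ (by positivity), ← mul_pow]
    exact hR
  · rw [F.average_average hp, hval, ← Complex.ofReal_pow, Real.sq_sqrt (by positivity)]

end PeriodicFrame

/-! ### The gap -/

/-- A continuous function with limits at `±∞` is bounded. -/
lemma exists_abs_le_of_tendsto {f : ℝ → ℝ} (hf : Continuous f) {a b : ℝ}
    (ht : Filter.Tendsto f Filter.atTop (nhds a)) (hb : Filter.Tendsto f Filter.atBot (nhds b)) :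
    ∃ K, ∀ x, |f x| ≤ K := by
  obtain ⟨R, hR⟩ := Filter.eventually_atTop.1 (ht.abs.eventually_le_const (lt_add_one |a|))
  obtain ⟨L, hL⟩ := Filter.eventually_atBot.1 (hb.abs.eventually_le_const (lt_add_one |b|))
  obtain ⟨M, hM⟩ := (isCompact_Icc (a := L) (b := R)).exists_bound_of_continuousOn hf.continuousOn
  refine ⟨max M (max (|a| + 1) (|b| + 1)), fun x => ?_⟩
  rcases le_total x L with h | h
  · exact (hL x h).trans ((le_max_right _ _).trans (le_max_right _ _))
  rcases le_total R x with h' | h'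
  · exact (hR x h').trans ((le_max_left _ _).trans (le_max_right _ _))
  · exact (hM x ⟨h, h'⟩).trans (le_max_left _ _)

/-- Near the energy of a Dirac point, `-∂ₓ² + V + ρ - x` is invertible when `ρ` is uniformly close
to `± δ κ_∞ W`. -/
lemma DiracPoint.exists_locallySolvable {V W : ℝ → ℝ} (hV : IsEvenCosineSeries V)
    (hW : IsOddCosineSeries W) {κinf : ℝ} (hκinf : 0 < κinf) {k E : ℝ} (D : DiracPoint V k E)
    (hθ : D.theta W ≠ 0) {c : ℝ} (hc0 : 0 < c) (hc : c < 1) :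
    ∃ δ₀ > 0, ∃ ε > 0, ∀ δ, 0 < δ → δ < δ₀ → ∀ κ, |κ| = κinf →
      ∀ x ∈ Ioo (E - c * δ * κinf * ‖D.theta W‖) (E + c * δ * κinf * ‖D.theta W‖),
      ∀ ρ : ℝ → ℝ, AEStronglyMeasurable ρ volume → (∀ y, |ρ y - δ * κ * W y| ≤ δ * ε) →
        LocallySolvable (fun y => V y + ρ y - x) univ := by
  obtain ⟨hVc, hVb⟩ := hV.continuous
  obtain ⟨hWc, BW, hBW⟩ := hW.continuous
  obtain ⟨F, μ, hμ, hu, hv, huu, hvv, huv, huWv⟩ := D.exists_frame (W := W) hVc hVb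
  have htr := F.trace_eq_zero (fun x => by rw [hV.add_half]) hWc hW.add_half hμ hu hv huu hvv huv
  have hW1 : Function.Periodic W 1 := fun x => by
    rw [show x + 1 = x + 1 / 2 + 1 / 2 by ring, hW.add_half, hW.add_half, neg_neg]
  have hθ0 : 0 < ‖D.theta W‖ := norm_pos_iff.2 hθ
  have hw0 : 0 < ‖F.w‖ := norm_pos_iff.2 F.w_ne
  have hc2 : 0 < 1 - c ^ 2 := by nlinarith
  -- A lower bound for `a` valid throughout the energy interval, from `κ_∞² |θ|² - s² ≥ (1 - c²)
  -- κ_∞² |θ|²`.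
  set r := κinf * ‖D.theta W‖ * √(1 - c ^ 2) / ‖F.w‖
  have hr : 0 < r := by positivity
  obtain ⟨δ₀, hδ₀, ε, hε, H⟩ := F.exists_threshold (hVc.sub continuous_const)
    (κinf * BW + c * κinf * ‖D.theta W‖) r hr
  refine ⟨δ₀, hδ₀, ε, hε, fun δ hδ hδδ₀ κ hκ x hx ρ hρ hρε => ?_⟩
  -- The energy offset is treated as part of the perturbation, being of the same order `δ`; `|s|`
  -- stays bounded uniformly in `δ` and `x`.
  set s := (x - E) / δ
  have hδs : δ * s = x - E := mul_div_cancel₀ _ hδ.ne'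
  have hs : |s| ≤ c * κinf * ‖D.theta W‖ := by
    rw [abs_div, abs_of_pos hδ, div_le_iff₀ hδ, abs_le]
    constructor <;> nlinarith [hx.1, hx.2]
  obtain ⟨a, hra, ha⟩ := F.exists_average_average hWc huu hvv huv huWv htr (κ := κ) (s := s)
    (r := r) (by
      have h1 : (r * ‖F.w‖) ^ 2 = κinf ^ 2 * ‖D.theta W‖ ^ 2 * (1 - c ^ 2) := by
        rw [div_mul_cancel₀ _ hw0.ne', mul_pow, mul_pow, Real.sq_sqrt hc2.le]
      have h2 : s ^ 2 ≤ (c * κinf * ‖D.theta W‖) ^ 2 := sq_le_sq' (abs_le.1 hs).1 (abs_le.1 hs).2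
      rw [h1, ← sq_abs κ, hκ]
      linarith)
  have := H δ hδ hδδ₀ (fun y => κ * W y - s) ((continuous_const.mul hWc).sub continuous_const)
    (fun y => by beta_reduce; rw [hW1]) (fun y => by
      refine (abs_sub _ _).trans (add_le_add ?_ hs)
      rw [abs_mul, hκ]
      exact mul_le_mul_of_nonneg_left (hBW y) hκinf.le)
    a hra ha (fun y => ρ y - δ * s) (hρ.sub aestronglyMeasurable_const) (fun y => by
      rw [show ρ y - δ * s - δ * (κ * W y - s) = ρ y - δ * κ * W y by ring]
      exact hρε y)
  refine this.mono ordConnected_univ subset_rfl fun y _ => ?_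
  rw [hδs]
  ring

/-- Local solvability on both half-lines, with possibly different extensions of the potential,
keeps an energy off the essential spectrum. -/
lemma notMem_essentialSpectrum_of_eqOn {U : ℝ → ℝ} (hU : Continuous U) {B : ℝ}
    (hB : ∀ x, |U x| ≤ B) {R E : ℝ} (hR : 0 ≤ R) {q₁ q₂ : ℝ → ℝ} (h₁ : LocallySolvable q₁ univ)
    (h₂ : LocallySolvable q₂ univ) (e₁ : ∀ x ≤ -R, U x - E = q₁ x) (e₂ : ∀ x ≥ R, U x - E = q₂ x) :
    (E : ℂ) ∉ essentialSpectrum (lineOp U) := by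
  have hm : LocallySolvable (fun x => U x - E) (Icc (-R) R) :=
    locallySolvable_Icc (B := B + |E|) (hU.sub continuous_const)
      (fun x => (abs_sub _ _).trans (add_le_add_left (hB x) _)) _ _
  exact notMem_essentialSpectrum hU hB (neg_le_self hR)
    (h₁.mono ordConnected_Iic (subset_univ _) fun x hx => (e₁ x hx).symm) hm
    (h₂.mono ordConnected_Ici (subset_univ _) fun x hx => (e₂ x hx).symm)

end DomainWall

/-! ### The domain-wall operator and its two asymptotic operators. -/

theorem proposition4p1
    (V W : ℝ → ℝ) (hV : DomainWall.IsEvenCosineSeries V) (hW : DomainWall.IsOddCosineSeries W)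
    (κ : ℝ → ℝ) (κinf : ℝ) (hκinf : 0 < κinf) (hκ : ContDiff ℝ ∞ κ)
    (hκ_top : Filter.Tendsto κ Filter.atTop (nhds κinf))
    (hκ_bot : Filter.Tendsto κ Filter.atBot (nhds (-κinf)))
    (k E : ℝ) (D : DomainWall.DiracPoint V k E) (hθ : D.theta W ≠ 0)
    (c : ℝ) (hc : c < 1) :
    ∃ δ₀ : ℝ, 0 < δ₀ ∧ ∀ δ : ℝ, 0 < δ → δ < δ₀ →
      ∀ x ∈ Set.Ioo (E - c * δ * κinf * ‖D.theta W‖) (E + c * δ * κinf * ‖D.theta W‖),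
        (x : ℂ) ∉ DomainWall.essentialSpectrum (DomainWall.domainWallOp V W κ δ) ∧
        (x : ℂ) ∉ DomainWall.essentialSpectrum (DomainWall.asympOpMinus V W κinf δ) ∧
        (x : ℂ) ∉ DomainWall.essentialSpectrum (DomainWall.asympOpPlus V W κinf δ) := by
  rcases le_or_gt c 0 with hc0 | hc0
  -- For `c ≤ 0` the interval is empty.
  · refine ⟨1, one_pos, fun δ hδ _ x hx => absurd (hx.1.trans hx.2) (not_lt.2 ?_)⟩
    have : 0 ≤ -c * (δ * κinf * ‖D.theta W‖) := by
      have := neg_nonneg.2 hc0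
      positivity
    linarith
  obtain ⟨δ₀, hδ₀, ε, hε, H⟩ := D.exists_locallySolvable hV hW hκinf hθ hc0 hc
  refine ⟨δ₀, hδ₀, fun δ hδ hδδ₀ x hx => ?_⟩
  obtain ⟨hVc, BV, hBV⟩ := hV.continuous
  obtain ⟨hWc, BW, hBW⟩ := hW.continuous
  have hBW0 : 0 ≤ BW := (abs_nonneg _).trans (hBW 0)
  -- the operators with a constant mass term
  have asymp : ∀ κ', |κ'| = κinf →
      (x : ℂ) ∉ DomainWall.essentialSpectrum (DomainWall.lineOp fun y => V y + δ * κ' * W y) := by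
    intro κ' hκ'
    have hc1 : Continuous fun y => δ * κ' * W y := continuous_const.mul hWc
    have h := H δ hδ hδδ₀ κ' hκ' x hx _ hc1.aestronglyMeasurable fun y => by
      rw [sub_self, abs_zero]; positivity
    refine DomainWall.notMem_essentialSpectrum_of_eqOn (B := BV + δ * κinf * BW) (hVc.add hc1) (fun y => ?_)
      le_rfl h h (fun _ _ => rfl) (fun _ _ => rfl)
    refine (abs_add_le _ _).trans (add_le_add (hBV y) ?_)
    rw [abs_mul, abs_mul, hκ', abs_of_pos hδ]
    exact mul_le_mul_of_nonneg_left (hBW y) (by positivity)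
  refine ⟨?_, ?_, asymp κinf (abs_of_pos hκinf)⟩
  · obtain ⟨K, hK⟩ := DomainWall.exists_abs_le_of_tendsto hκ.continuous hκ_top hκ_bot
    have hK0 : 0 ≤ K := (abs_nonneg _).trans (hK 0)
    have hκc : Continuous fun y => δ * κ (δ * y) * W y :=
      (continuous_const.mul (hκ.continuous.comp (continuous_const.mul continuous_id))).mul hWc
    -- `κ` is close to its limits far out
    have hη : 0 < ε / (BW + 1) := by positivity
    have close : ∀ {t κ' : ℝ} (y : ℝ), |t - κ'| < ε / (BW + 1) →
        |δ * t * W y - δ * κ' * W y| ≤ δ * ε := by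
      intro t κ' y h
      rw [← sub_mul, ← mul_sub, abs_mul, abs_mul, abs_of_pos hδ, mul_assoc]
      refine mul_le_mul_of_nonneg_left ?_ hδ.le
      calc |t - κ'| * |W y| ≤ ε / (BW + 1) * (BW + 1) :=
            mul_le_mul h.le ((hBW y).trans (le_add_of_nonneg_right zero_le_one))
              (abs_nonneg _) hη.le
        _ = ε := div_mul_cancel₀ _ (by positivity)
    obtain ⟨R₁, hR₁⟩ := Filter.eventually_atTop.1 (Metric.tendsto_nhds.1 hκ_top _ hη)
    obtain ⟨R₂, hR₂⟩ := Filter.eventually_atBot.1 (Metric.tendsto_nhds.1 hκ_bot _ hη)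
    -- Since `κ` is evaluated at `δ y`, the transition region has width of order `1/δ`. This is
    -- harmless, as a bounded interval of any length is solvable.
    set R := (|R₁| + |R₂|) / δ
    have hδR : δ * R = |R₁| + |R₂| := mul_div_cancel₀ _ hδ.ne'
    have far₁ : ∀ y ≥ R, |κ (δ * y) - κinf| < ε / (BW + 1) := fun y hy => hR₁ _ (by
      have := mul_le_mul_of_nonneg_left hy hδ.le
      linarith [le_abs_self R₁, abs_nonneg R₂])
    have far₂ : ∀ y ≤ -R, |κ (δ * y) - -κinf| < ε / (BW + 1) := fun y hy => hR₂ _ (by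
      have := mul_le_mul_of_nonneg_left hy hδ.le
      linarith [neg_abs_le R₂, abs_nonneg R₁])
    -- replace `κ` by its limit away from one end
    have ext : ∀ κ', |κ'| = κinf → ∀ s : Set ℝ, MeasurableSet s →
        (∀ y ∈ s, |κ (δ * y) - κ'| < ε / (BW + 1)) → ∃ q : ℝ → ℝ, DomainWall.LocallySolvable q univ ∧
          ∀ y ∈ s, V y + δ * κ (δ * y) * W y - x = q y := by
      classical
      intro κ' hκ' s hs hclose
      -- The extended perturbation is within `δ ε` of `δ κ' W` on the whole line but may jump at the
      -- edge of `s`, so only its measurability can be supplied.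
      refine ⟨_, H δ hδ hδδ₀ κ' hκ' x hx
        (s.piecewise (fun y => δ * κ (δ * y) * W y) fun y => δ * κ' * W y) ?_ fun y => ?_,
        fun y hy => ?_⟩
      · exact (hκc.measurable.piecewise hs
          (continuous_const.mul hWc).measurable).aestronglyMeasurable
      · by_cases hy : y ∈ s
        · rw [piecewise_eq_of_mem _ _ _ hy]
          exact close y (hclose y hy)
        · rw [piecewise_eq_of_notMem _ _ _ hy, sub_self, abs_zero]
          positivity
      · rw [piecewise_eq_of_mem _ _ _ hy]
    obtain ⟨q₁, hq₁, e₁⟩ := ext (-κinf) (by rw [abs_neg, abs_of_pos hκinf]) _ measurableSet_Iic far₂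
    obtain ⟨q₂, hq₂, e₂⟩ := ext κinf (abs_of_pos hκinf) _ measurableSet_Ici far₁
    refine DomainWall.notMem_essentialSpectrum_of_eqOn (B := BV + δ * K * BW) (hVc.add hκc) (fun y => ?_)
      (R := R) (by positivity) hq₁ hq₂ e₁ e₂
    refine (abs_add_le _ _).trans (add_le_add (hBV y) ?_)
    rw [abs_mul, abs_mul, abs_of_pos hδ]
    exact mul_le_mul (mul_le_mul_of_nonneg_left (hK _) hδ.le) (hBW y) (abs_nonneg _) (by positivity)
  · have h := asymp (-κinf) (by rw [abs_neg, abs_of_pos hκinf])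
    simpa only [DomainWall.asympOpMinus, mul_neg, neg_mul, ← sub_eq_add_neg] using h
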